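/- All graphs are finite and simple. For a graph $G=(V,E)$ and $T\subseteq V$, an odd $T$-cycle is a cycle of $G$ with an odd number of vertices that contains a vertex of $T$; a set $S\subseteq V$ is an odd $T$-cycle transversal if it contains a vertex of every odd $T$-cycle. In \textsc{Weighted Subset Odd Cycle Transversal} one is given a graph $G=(V,E)$, a set $T\subseteq V$, a weighting $w:V\to\mathbb{R}_{\ge 0}$ and an integer $k\ge 1$, and has to decide whether $G$ has an odd $T$-cycle transversal $S$ with $w(S)=\sum_{v\in S}w(v)\le k$. Let $3P_1+P_2$ be the disjoint union of three isolated vertices and one edge; a graph is $(3P_1+P_2)$-free if it has no induced subgraph isomorphic to $3P_1+P_2$. Lemma. \textsc{Weighted Subset Odd Cycle Transversal} is polynomial-time solvable on $(3P_1+P_2)$-free graphs. Here the model of computation is a random access machine on natural numbers and weights, with addition, subtraction (truncated at $0$ for natural numbers) and comparison as its only arithmetic operations. Polynomial-time solvable means that there is one program that answers every instance whose graph is $(3P_1+P_2)$-free correctly, and that 1. for real weights, with unit-cost operations on weights, uses a number of steps that is bounded by a polynomial in $|V|$; and 2. for rational weights, runs in time bounded by a polynomial in the size of the instance, $|V|$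 plus the binary lengths of the weights and of $k$, when each step is charged $1$ plus the binary lengths of the operands and addresses that it uses (logarithmic cost). -/

import Mathlib

/-! ### Random access machines

A program works on natural-number variables and arrays, used for counting and for addressing, and
on weight variables and arrays, whose entries lie in an ordered group `R`. The only arithmetic is
addition, subtraction and comparison. -/

/-- The memory: variables and arrays of natural numbers, variables and arrays of weights. -/
structure Memory (R : Type) where
  num : ℕ → ℕ
  arr : ℕ → ℕ → ℕ
  wt : ℕ → R
  warr : ℕ → ℕ → R

/-- The elementary instructions. All arguments are names of variables or arrays, except the
constant `c` of `set`. -/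
inductive Instr where
  /-- `x := c` -/
  | set (x c : ℕ)
  /-- `x := y + z` -/
  | add (x y z : ℕ)
  /-- `x := max (y - z) 0` -/
  | sub (x y z : ℕ)
  /-- `x := a[i]`, where `i` is a variable -/
  | load (x a i : ℕ)
  /-- `a[i] := x`, where `i` is a variable -/
  | store (a i x : ℕ)
  /-- `x := y + z` for weights -/
  | wadd (x y z : ℕ)
  /-- `x := y - z` for weights -/
  | wsub (x y z : ℕ)
  /-- `x := a[i]`, where `x` and `a` hold weights and `i` is a natural-number variable -/
  | wload (x a i : ℕ)
  /-- `a[i] := x`, where `x` and `a` hold weights and `i` is a natural-number variable -/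
  | wstore (a i x : ℕ)

/-- The tests: comparison of two natural-number variables or of two weight variables. -/
inductive Test where
  | le (x y : ℕ)
  | wle (x y : ℕ)

/-- Structured programs. -/
inductive Program where
  | instr (c : Instr)
  | seq (P Q : Program)
  | ite (t : Test) (P Q : Program)
  | loop (t : Test) (P : Program)

/-- The effect of an instruction. -/
def Instr.exec {R : Type} [Add R] [Sub R] : Instr → Memory R → Memory R
  | .set x c, s => { s with num := Function.update s.num x c }
  | .add x y z, s => { s with num := Function.update s.num x (s.num y + s.num z) }
  | .sub x y z, s => { s with num := Function.update s.num x (s.num y - s.num z) }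
  | .load x a i, s => { s with num := Function.update s.num x (s.arr a (s.num i)) }
  | .store a i x, s =>
      { s with arr := Function.update s.arr a (Function.update (s.arr a) (s.num i) (s.num x)) }
  | .wadd x y z, s => { s with wt := Function.update s.wt x (s.wt y + s.wt z) }
  | .wsub x y z, s => { s with wt := Function.update s.wt x (s.wt y - s.wt z) }
  | .wload x a i, s => { s with wt := Function.update s.wt x (s.warr a (s.num i)) }
  | .wstore a i x, s =>
      { s with warr := Function.update s.warr a (Function.update (s.warr a) (s.num i) (s.wt x)) }

/-- The truth of a test. -/
def Test.Holds {R : Type} [LE R] : Test → Memory R → Prop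
  | .le x y, s => s.num x ≤ s.num y
  | .wle x y, s => s.wt x ≤ s.wt y

/-- A cost model charges for each number that an instruction handles. -/
structure CostModel (R : Type) where
  numSize : ℕ → ℕ
  wtSize : R → ℕ

/-- Uniform cost: each instruction and each test costs one. -/
def CostModel.uniform (R : Type) : CostModel R where
  numSize _ := 0
  wtSize _ := 0

/-- Logarithmic cost: each instruction and each test is charged, in addition, the binary lengths
of its operands and of the addresses that it uses; a rational number is written as a reduced
fraction. -/
def CostModel.logarithmic : CostModel ℚ where
  numSize m := Nat.size m
  wtSize q := Nat.size q.num.natAbs + Nat.size q.den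

/-- The cost of an instruction. -/
def Instr.cost {R : Type} (M : CostModel R) : Instr → Memory R → ℕ
  | .set _ c, _ => 1 + M.numSize c
  | .add _ y z, s => 1 + M.numSize (s.num y) + M.numSize (s.num z)
  | .sub _ y z, s => 1 + M.numSize (s.num y) + M.numSize (s.num z)
  | .load _ a i, s => 1 + M.numSize (s.num i) + M.numSize (s.arr a (s.num i))
  | .store _ i x, s => 1 + M.numSize (s.num i) + M.numSize (s.num x)
  | .wadd _ y z, s => 1 + M.wtSize (s.wt y) + M.wtSize (s.wt z)
  | .wsub _ y z, s => 1 + M.wtSize (s.wt y) + M.wtSize (s.wt z)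
  | .wload _ a i, s => 1 + M.numSize (s.num i) + M.wtSize (s.warr a (s.num i))
  | .wstore _ i x, s => 1 + M.numSize (s.num i) + M.wtSize (s.wt x)

/-- The cost of a test. -/
def Test.cost {R : Type} (M : CostModel R) : Test → Memory R → ℕ
  | .le x y, s => 1 + M.numSize (s.num x) + M.numSize (s.num y)
  | .wle x y, s => 1 + M.wtSize (s.wt x) + M.wtSize (s.wt y)

/-- `Runs M P s t s'`: started in memory `s`, the program `P` halts in memory `s'`, at total
cost `t`. -/
inductive Runs {R : Type} [Add R] [Sub R] [LE R] (M : CostModel R) :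
    Program → Memory R → ℕ → Memory R → Prop
  | instr (c : Instr) (s : Memory R) : Runs M (.instr c) s (c.cost M s) (c.exec s)
  | seq {P Q : Program} {s s₁ s₂ : Memory R} {t₁ t₂ : ℕ}
      (h₁ : Runs M P s t₁ s₁) (h₂ : Runs M Q s₁ t₂ s₂) : Runs M (.seq P Q) s (t₁ + t₂) s₂
  | ite_true {b : Test} {P Q : Program} {s s₁ : Memory R} {t : ℕ}
      (hb : b.Holds s) (h : Runs M P s t s₁) : Runs M (.ite b P Q) s (b.cost M s + t) s₁
  | ite_false {b : Test} {P Q : Program} {s s₁ : Memory R} {t : ℕ}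
      (hb : ¬ b.Holds s) (h : Runs M Q s t s₁) : Runs M (.ite b P Q) s (b.cost M s + t) s₁
  | loop_false {b : Test} {P : Program} {s : Memory R}
      (hb : ¬ b.Holds s) : Runs M (.loop b P) s (b.cost M s) s
  | loop_true {b : Test} {P : Program} {s s₁ s₂ : Memory R} {t₁ t₂ : ℕ}
      (hb : b.Holds s) (h₁ : Runs M P s t₁ s₁) (h₂ : Runs M (.loop b P) s₁ t₂ s₂) :
      Runs M (.loop b P) s (b.cost M s + t₁ + t₂) s₂

/-! ### Weighted Subset Odd Cycle Transversal -/

/-- `S` meets every cycle of `G` that has odd length and contains a vertex of `T`. -/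
def SimpleGraph.IsOddCycleTransversal {V : Type*} (G : SimpleGraph V) (T S : Set V) : Prop :=
  ∀ (v : V) (C : G.Walk v v), C.IsCycle → Odd C.length → (∃ x ∈ T, x ∈ C.support) →
    ∃ x ∈ S, x ∈ C.support

/-- An instance of the problem, with weights in `R`. -/
structure WSOCTInstance (R : Type) [Zero R] [LE R] where
  /-- the number of vertices -/
  n : ℕ
  G : SimpleGraph (Fin n)
  T : Finset (Fin n)
  w : Fin n → R
  w_nonneg : ∀ v, 0 ≤ w v
  k : ℕ
  one_le_k : 1 ≤ k

/-- The question: is there an odd `T`-cycle transversal of weight at most `k`? -/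
def WSOCTInstance.IsYes {R : Type} [Semiring R] [LE R] (I : WSOCTInstance R) : Prop :=
  ∃ S : Finset (Fin I.n), I.G.IsOddCycleTransversal (I.T : Set (Fin I.n)) (S : Set (Fin I.n)) ∧
    ∑ v ∈ S, I.w v ≤ (I.k : R)

open Classical in
/-- The input as it is presented to a program: the number `n` of vertices in variable `0`, the
adjacency matrix, row by row, in array `0`, the indicator function of `T` in array `1`, the bound
`k` in weight variable `0`, the weights in weight array `0`; everything else is zero. -/
noncomputable def WSOCTInstance.input {R : Type} [Semiring R] [LE R] (I : WSOCTInstance R) :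
    Memory R where
  num x := if x = 0 then I.n else 0
  arr a j :=
    if a = 0 then (if ∃ u v : Fin I.n, j = u * I.n + v ∧ I.G.Adj u v then 1 else 0)
    else if a = 1 then (if ∃ v ∈ I.T, j = v then 1 else 0)
    else 0
  wt x := if x = 0 then (I.k : R) else 0
  warr a j := if h : a = 0 ∧ j < I.n then I.w ⟨j, h.2⟩ else 0

/-- The size of an instance: the number of vertices plus the sizes of the weights and of the
bound. For uniform cost this is the number of vertices; for logarithmic cost, the binary lengths
of the numbers are included. -/
def WSOCTInstance.size {R : Type} [Semiring R] [LE R] (M : CostModel R) (I : WSOCTInstance R) :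
    ℕ :=
  I.n + ∑ v, M.wtSize (I.w v) + M.wtSize (I.k : R)

/-- In the given cost model, the program `P` decides all instances whose graph lies in the class
`𝒢`, in time polynomial in the size of the instance. The answer is yes if and only if variable `0`
holds `1` at the end. -/
def Program.DecidesWSOCTInPolyTime (P : Program) {R : Type} [Ring R] [LE R] (M : CostModel R)
    (𝒢 : ∀ n : ℕ, SimpleGraph (Fin n) → Prop) : Prop :=
  ∃ p : Polynomial ℕ, ∀ I : WSOCTInstance R, 𝒢 I.n I.G →
    ∃ (t : ℕ) (s : Memory R), Runs M P I.input t s ∧ t ≤ p.eval (I.size M) ∧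
      (s.num 0 = 1 ↔ I.IsYes)

/-- Polynomial-time solvability of the problem on the class `𝒢`: a single program solves it for
real weights with a number of steps that is polynomial in the number of vertices, and for rational
weights in time that is polynomial in the binary length of the input, when each step is charged
the binary lengths of the numbers involved. -/
def WSOCTPolyTimeSolvable (𝒢 : ∀ n : ℕ, SimpleGraph (Fin n) → Prop) : Prop :=
  ∃ P : Program, P.DecidesWSOCTInPolyTime (CostModel.uniform ℝ) 𝒢 ∧
    P.DecidesWSOCTInPolyTime CostModel.logarithmic 𝒢

/-! ### The graph `3P₁ + P₂` -/

/-- The disjoint union of three one-vertex paths and one two-vertex path. -/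
abbrev threeP1AddP2 : SimpleGraph (((Fin 1 ⊕ Fin 1) ⊕ Fin 1) ⊕ Fin 2) :=
  ((SimpleGraph.pathGraph 1 ⊕g SimpleGraph.pathGraph 1) ⊕g SimpleGraph.pathGraph 1) ⊕g
    SimpleGraph.pathGraph 2

/-- `G` is `H`-free: it has no induced subgraph isomorphic to `H`. -/
def SimpleGraph.IsInducedFree {V W : Type*} (G : SimpleGraph V) (H : SimpleGraph W) : Prop :=
  ¬ H.IsIndContained G

set_option linter.unusedSectionVars false

/-! ### Uniform and logarithmic cost -/

/-! A transversal is the complement of a set `B` without odd `T`-cycles, so the task is to find a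
heaviest such `B`. The combinatorial heart is `SimpleGraph.OddFree.exists_model`: in a `(3P₁ +
P₂)`-free graph every nonempty `B` without odd `T`-cycles is a union of a set `F` of at most 39
vertices and two sets `K₁`, `K₂`, and the absence of odd `T`-cycles is guaranteed by finite data.
These are the pattern of `F` (adjacency and membership in `T`), the types over `F` of the vertices
in `K₁` and in `K₂`, and possibly the demand that no edge joins `K₁` to `K₂`. Any sets with these
data, in any graph of the class, again have no odd `T`-cycle.

There are three cases. If `B` misses `T`, membership in `T` is all that matters. If `B` is
bipartite, `F` contains three vertices of each side (or the whole side); vertices attached to `F` in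
the same way then form independent sets, since an edge among them together with three vertices of
`F` would induce `3P₁ + P₂` (`SimpleGraph.not_adj_of_types`). Otherwise, call a set a biparity set
if any two of its vertices are joined inside it by paths of both parities; odd cycles are such sets.
A core is a maximal biparity subset of `B` with at least two vertices. Cores avoid `T`, a vertex of
`B` outside a core has at most one neighbor in it, and two disjoint cores are joined by at most one
edge. With `(3P₁ + P₂)`-freeness this excludes four disjoint cores, bounds `B` when there are three,
and bounds everything outside the cores when there are one or two
(`SimpleGraph.exists_decomposition`). `F` then consists of the vertices outside the cores and of the
core vertices with neighbors outside their core. What the rest of a core looks like is irrelevant: a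
detour through it in a copy can be replaced by a path of the same parity in the original core
(`SimpleGraph.Resembles.oddFree`).

Hence finitely many schemes suffice. For a scheme and a tuple of 39 vertices, `K₁` and `K₂` range
over the subsets of two explicitly testable vertex sets, subject only to a forbidden relation
between the two. Discarding as little weight as possible is a weighted vertex cover problem in a
bipartite graph, that is, a minimum cut problem (`exists_cut_iff`).

The machine has no multiplication or division, and its running time may not depend on the weights
for unit cost. Minimum cuts are therefore found by pushing and relabelling, for which a bounded
integer potential gives a strongly polynomial number of rounds (`Preflow.Valid.iterate_round`). The
program has only counted loops, so its unit-cost time is a polynomial that can be read off its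
syntax (`Stmt.exists_runs`). Finally, each step lengthens the numbers by at most one bit over a
fixed common denominator, so polynomially many steps have polynomial logarithmic cost
(`Runs.exists_logarithmic`). -/

/-- The instruction only uses constants below `2 ^ N`. -/
def Instr.ConstsBelow (N : ℕ) : Instr → Prop
  | .set _ c => c < 2 ^ N
  | _ => True

/-- The program only uses constants below `2 ^ N`. -/
def Program.ConstsBelow (N : ℕ) : Program → Prop
  | .instr c => c.ConstsBelow N
  | .seq P Q => P.ConstsBelow N ∧ Q.ConstsBelow N
  | .ite _ P Q => P.ConstsBelow N ∧ Q.ConstsBelow N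
  | .loop _ P => P.ConstsBelow N

theorem Program.ConstsBelow.mono {N N' : ℕ} (h : N ≤ N') :
    ∀ {P : Program}, P.ConstsBelow N → P.ConstsBelow N'
  | .instr c, hP => by
      have h2 : 2 ^ N ≤ 2 ^ N' := Nat.pow_le_pow_right (by norm_num) h
      cases c <;> simp only [Program.ConstsBelow, Instr.ConstsBelow] at hP ⊢
      omega
  | .seq _ _, hP => ⟨mono h hP.1, mono h hP.2⟩
  | .ite _ _ _, hP => ⟨mono h hP.1, mono h hP.2⟩
  | .loop _ P, hP => mono (P := P) h hP

theorem Program.exists_constsBelow : ∀ P : Program, ∃ N, P.ConstsBelow N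
  | .instr c => by
      cases c with
      | set x c => exact ⟨c, Nat.lt_two_pow_self⟩
      | _ => exact ⟨0, trivial⟩
  | .seq P Q => by
      obtain ⟨N, hN⟩ := exists_constsBelow P
      obtain ⟨N', hN'⟩ := exists_constsBelow Q
      exact ⟨max N N', hN.mono (le_max_left _ _), hN'.mono (le_max_right _ _)⟩
  | .ite _ P Q => by
      obtain ⟨N, hN⟩ := exists_constsBelow P
      obtain ⟨N', hN'⟩ := exists_constsBelow Q
      exact ⟨max N N', hN.mono (le_max_left _ _), hN'.mono (le_max_right _ _)⟩
  | .loop _ P => exists_constsBelow P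

/-- `q` is a fraction with denominator `D` and numerator below `2 ^ L` in absolute value. -/
def IsFraction (D L : ℕ) (q : ℚ) : Prop := ∃ z : ℤ, q = z / D ∧ |z| < 2 ^ L

theorem IsFraction.mono {D L L' : ℕ} {q : ℚ} (h : L ≤ L') (hq : IsFraction D L q) :
    IsFraction D L' q := by
  obtain ⟨z, hz, hl⟩ := hq
  exact ⟨z, hz, hl.trans_le (pow_le_pow_right₀ (by norm_num) h)⟩

theorem IsFraction.add {D L : ℕ} {p q : ℚ} (hp : IsFraction D L p) (hq : IsFraction D L q) :
    IsFraction D (L + 1) (p + q) := by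
  obtain ⟨y, rfl, hy⟩ := hp
  obtain ⟨z, rfl, hz⟩ := hq
  refine ⟨y + z, by push_cast; ring, ?_⟩
  have := abs_add_le y z
  rw [pow_succ]
  linarith

theorem IsFraction.sub {D L : ℕ} {p q : ℚ} (hp : IsFraction D L p) (hq : IsFraction D L q) :
    IsFraction D (L + 1) (p - q) := by
  obtain ⟨y, rfl, hy⟩ := hp
  obtain ⟨z, rfl, hz⟩ := hq
  refine ⟨y - z, by push_cast; ring, ?_⟩
  have := abs_sub y z
  rw [pow_succ]
  linarith

/-- The cost is charged for the reduced fraction, while the bounds are kept over the fixed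
denominator `D`. Reduction replaces numerator and denominator by divisors, so it does not lengthen
them. -/
theorem IsFraction.size_le {D L : ℕ} {q : ℚ} (hD : D ≠ 0) (hq : IsFraction D L q) :
    Nat.size q.num.natAbs + Nat.size q.den ≤ L + Nat.size D := by
  obtain ⟨z, rfl, hz⟩ := hq
  have hD' : (D : ℤ) ≠ 0 := by exact_mod_cast hD
  have h1 : ((z : ℚ) / D).den ≤ D := by
    have := Rat.den_dvd z D
    rw [Rat.divInt_eq_div] at this
    have := Int.natCast_dvd_natCast.1 (by simpa using this)
    exact Nat.le_of_dvd (Nat.pos_of_ne_zero hD) this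
  have h2 : ((z : ℚ) / D).num.natAbs < 2 ^ L := by
    rcases eq_or_ne z 0 with rfl | hz0
    · simp
    have := Rat.num_dvd z hD'
    rw [Rat.divInt_eq_div] at this
    have h3 : ((z : ℚ) / D).num.natAbs ≤ z.natAbs :=
      Nat.le_of_dvd (Int.natAbs_pos.2 hz0) (Int.natAbs_dvd_natAbs.2 (by simpa using this))
    have h4 : (z.natAbs : ℤ) < 2 ^ L := by rw [Int.natCast_natAbs]; exact hz
    exact h3.trans_lt (by exact_mod_cast h4)
  exact Nat.add_le_add (Nat.size_le.2 h2) (Nat.size_le_size h1)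

/-- All numbers in the memory are below `2 ^ N`, all weights are fractions with denominator `D`
and numerator below `2 ^ L`. -/
structure Memory.Bounded (s : Memory ℚ) (N D L : ℕ) : Prop where
  num : ∀ x, s.num x < 2 ^ N
  arr : ∀ a i, s.arr a i < 2 ^ N
  wt : ∀ x, IsFraction D L (s.wt x)
  warr : ∀ a i, IsFraction D L (s.warr a i)

theorem Memory.Bounded.mono {s : Memory ℚ} {N N' D L L' : ℕ} (h : s.Bounded N D L) (hN : N ≤ N')
    (hL : L ≤ L') : s.Bounded N' D L' := by
  have h2 : 2 ^ N ≤ 2 ^ N' := Nat.pow_le_pow_right (by norm_num) hN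
  exact ⟨fun x => (h.num x).trans_le h2, fun a i => (h.arr a i).trans_le h2,
    fun x => (h.wt x).mono hL, fun a i => (h.warr a i).mono hL⟩

/-- Addition and subtraction are the only arithmetic, and over a common denominator they lengthen
the numerator by at most one bit. With multiplication the lengths could double at each step. -/
theorem Memory.Bounded.exec {s : Memory ℚ} {N D L : ℕ} (h : s.Bounded N D L) {c : Instr}
    (hc : c.ConstsBelow N) : (c.exec s).Bounded (N + 1) D (L + 1) := by
  have h' := h.mono (Nat.le_succ N) (Nat.le_succ L)
  cases c with
  | set x c =>
    refine ⟨fun y => ?_, h'.arr, h'.wt, h'.warr⟩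
    by_cases hy : y = x
    · subst hy
      simp only [Instr.exec, Function.update_self]
      exact lt_of_lt_of_le hc (Nat.pow_le_pow_right (by norm_num) (Nat.le_succ N))
    · simpa [Instr.exec, hy] using h'.num y
  | add x y z =>
    refine ⟨fun y' => ?_, h'.arr, h'.wt, h'.warr⟩
    by_cases hy : y' = x
    · subst hy
      have := h.num y
      have := h.num z
      simp only [Instr.exec, Function.update_self, pow_succ]
      omega
    · simpa [Instr.exec, hy] using h'.num y'
  | sub x y z =>
    refine ⟨fun y' => ?_, h'.arr, h'.wt, h'.warr⟩
    by_cases hy : y' = x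
    · subst hy
      have := h.num y
      have := h.num z
      simp only [Instr.exec, Function.update_self, pow_succ]
      omega
    · simpa [Instr.exec, hy] using h'.num y'
  | load x a i =>
    refine ⟨fun y' => ?_, h'.arr, h'.wt, h'.warr⟩
    by_cases hy : y' = x
    · subst hy
      simpa [Instr.exec] using h'.arr a (s.num i)
    · simpa [Instr.exec, hy] using h'.num y'
  | store a i x =>
    refine ⟨h'.num, fun a' i' => ?_, h'.wt, h'.warr⟩
    by_cases ha : a' = a
    · subst ha
      by_cases hi : i' = s.num i
      · subst hi
        simpa [Instr.exec] using h'.num x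
      · simpa [Instr.exec, hi] using h'.arr a' i'
    · simpa [Instr.exec, ha] using h'.arr a' i'
  | wadd x y z =>
    refine ⟨h'.num, h'.arr, fun y' => ?_, h'.warr⟩
    by_cases hy : y' = x
    · subst hy
      simpa [Instr.exec] using (h.wt y).add (h.wt z)
    · simpa [Instr.exec, hy] using h'.wt y'
  | wsub x y z =>
    refine ⟨h'.num, h'.arr, fun y' => ?_, h'.warr⟩
    by_cases hy : y' = x
    · subst hy
      simpa [Instr.exec] using (h.wt y).sub (h.wt z)
    · simpa [Instr.exec, hy] using h'.wt y'
  | wload x a i =>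
    refine ⟨h'.num, h'.arr, fun y' => ?_, h'.warr⟩
    by_cases hy : y' = x
    · subst hy
      simpa [Instr.exec] using h'.warr a (s.num i)
    · simpa [Instr.exec, hy] using h'.wt y'
  | wstore a i x =>
    refine ⟨h'.num, h'.arr, h'.wt, fun a' i' => ?_⟩
    by_cases ha : a' = a
    · subst ha
      by_cases hi : i' = s.num i
      · subst hi
        simpa [Instr.exec] using h'.wt x
      · simpa [Instr.exec, hi] using h'.warr a' i'
    · simpa [Instr.exec, ha] using h'.warr a' i'

theorem Instr.cost_uniform {R : Type} (c : Instr) (s : Memory R) :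
    c.cost (CostModel.uniform R) s = 1 := by
  cases c <;> rfl

theorem Test.cost_uniform {R : Type} (b : Test) (s : Memory R) :
    b.cost (CostModel.uniform R) s = 1 := by
  cases b <;> rfl

/-- A bound on the logarithmic cost of a single step in a bounded memory. -/
def stepBound (N D L : ℕ) : ℕ := 1 + 2 * N + 2 * (L + Nat.size D)

theorem Memory.Bounded.instr_cost_le {s : Memory ℚ} {N D L : ℕ} (hD : D ≠ 0)
    (h : s.Bounded N D L) {c : Instr} (hc : c.ConstsBelow N) :
    c.cost CostModel.logarithmic s ≤ stepBound N D L := by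
  have h1 : ∀ x, Nat.size (s.num x) ≤ N := fun x => Nat.size_le.2 (h.num x)
  have h2 : ∀ a i, Nat.size (s.arr a i) ≤ N := fun a i => Nat.size_le.2 (h.arr a i)
  have h3 := fun x => (h.wt x).size_le hD
  have h4 := fun a i => (h.warr a i).size_le hD
  cases c with
  | set x c =>
    have : Nat.size c ≤ N := Nat.size_le.2 hc
    simp only [Instr.cost, CostModel.logarithmic, stepBound]
    omega
  | add x y z =>
    have := h1 y
    have := h1 z
    simp only [Instr.cost, CostModel.logarithmic, stepBound]
    omega
  | sub x y z =>
    have := h1 y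
    have := h1 z
    simp only [Instr.cost, CostModel.logarithmic, stepBound]
    omega
  | load x a i =>
    have := h1 i
    have := h2 a (s.num i)
    simp only [Instr.cost, CostModel.logarithmic, stepBound]
    omega
  | store a i x =>
    have := h1 i
    have := h1 x
    simp only [Instr.cost, CostModel.logarithmic, stepBound]
    omega
  | wadd x y z =>
    have := h3 y
    have := h3 z
    simp only [Instr.cost, CostModel.logarithmic, stepBound]
    omega
  | wsub x y z =>
    have := h3 y
    have := h3 z
    simp only [Instr.cost, CostModel.logarithmic, stepBound]
    omega
  | wload x a i =>
    have := h1 i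
    have := h4 a (s.num i)
    simp only [Instr.cost, CostModel.logarithmic, stepBound]
    omega
  | wstore a i x =>
    have := h1 i
    have := h3 x
    simp only [Instr.cost, CostModel.logarithmic, stepBound]
    omega

theorem Memory.Bounded.test_cost_le {s : Memory ℚ} {N D L : ℕ} (hD : D ≠ 0)
    (h : s.Bounded N D L) (b : Test) : b.cost CostModel.logarithmic s ≤ stepBound N D L := by
  have h1 : ∀ x, Nat.size (s.num x) ≤ N := fun x => Nat.size_le.2 (h.num x)
  have h3 := fun x => (h.wt x).size_le hD
  cases b with
  | le x y =>
    have := h1 x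
    have := h1 y
    simp only [Test.cost, CostModel.logarithmic, stepBound]
    omega
  | wle x y =>
    have := h3 x
    have := h3 y
    simp only [Test.cost, CostModel.logarithmic, stepBound]
    omega

theorem stepBound_mono {N N' D L L' : ℕ} (hN : N ≤ N') (hL : L ≤ L') :
    stepBound N D L ≤ stepBound N' D L' := by
  unfold stepBound
  omega

/-- After `t` steps the lengths have grown by at most `t`, so each of the `t` steps costs at most
the step bound for the final lengths. `Nmax` and `Lmax` are fixed in advance so that one bound
serves all parts of the run. -/
theorem Runs.exists_logarithmic {D Nmax Lmax : ℕ} (hD : D ≠ 0) {P : Program} {s s' : Memory ℚ}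
    {t : ℕ} (h : Runs (CostModel.uniform ℚ) P s t s') :
    ∀ {N L : ℕ}, s.Bounded N D L → P.ConstsBelow N → N + t ≤ Nmax → L + t ≤ Lmax →
      s'.Bounded (N + t) D (L + t) ∧
        ∃ t', Runs CostModel.logarithmic P s t' s' ∧ t' ≤ t * stepBound Nmax D Lmax := by
  have htest : ∀ (b : Test) {s : Memory ℚ} {N L : ℕ}, s.Bounded N D L → N ≤ Nmax → L ≤ Lmax →
      b.cost CostModel.logarithmic s ≤ stepBound Nmax D Lmax := fun b s N L hs hN hL =>
    (hs.test_cost_le hD b).trans (stepBound_mono hN hL)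
  induction h with
  | instr c s =>
    intro N L hs hc hN hL
    rw [Instr.cost_uniform] at *
    refine ⟨hs.exec hc, _, Runs.instr c s, ?_⟩
    rw [one_mul]
    exact (hs.instr_cost_le hD hc).trans (stepBound_mono (by omega) (by omega))
  | seq h₁ h₂ ih₁ ih₂ =>
    intro N L hs hc hN hL
    obtain ⟨hs₁, u₁, hu₁, hb₁⟩ := ih₁ hs hc.1 (by omega) (by omega)
    obtain ⟨hs₂, u₂, hu₂, hb₂⟩ := ih₂ hs₁ (hc.2.mono (by omega)) (by omega) (by omega)
    refine ⟨hs₂.mono (by omega) (by omega), _, Runs.seq hu₁ hu₂, ?_⟩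
    rw [add_mul]
    omega
  | @ite_true b P Q s s₁ t hb h ih =>
    intro N L hs hc hN hL
    rw [Test.cost_uniform] at *
    obtain ⟨hs₁, u₁, hu₁, hb₁⟩ := ih hs hc.1 (by omega) (by omega)
    refine ⟨hs₁.mono (by omega) (by omega), _, Runs.ite_true hb hu₁, ?_⟩
    have := htest b hs (by omega) (by omega)
    rw [add_mul]
    omega
  | @ite_false b P Q s s₁ t hb h ih =>
    intro N L hs hc hN hL
    rw [Test.cost_uniform] at *
    obtain ⟨hs₁, u₁, hu₁, hb₁⟩ := ih hs hc.2 (by omega) (by omega)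
    refine ⟨hs₁.mono (by omega) (by omega), _, Runs.ite_false hb hu₁, ?_⟩
    have := htest b hs (by omega) (by omega)
    rw [add_mul]
    omega
  | @loop_false b P s hb =>
    intro N L hs hc hN hL
    rw [Test.cost_uniform] at *
    refine ⟨hs.mono (by omega) (by omega), _, Runs.loop_false hb, ?_⟩
    have := htest b hs (by omega) (by omega)
    omega
  | @loop_true b P s s₁ s₂ t₁ t₂ hb h₁ h₂ ih₁ ih₂ =>
    intro N L hs hc hN hL
    rw [Test.cost_uniform] at *
    obtain ⟨hs₁, u₁, hu₁, hb₁⟩ := ih₁ hs hc (by omega) (by omega)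
    obtain ⟨hs₂, u₂, hu₂, hb₂⟩ :=
      ih₂ hs₁ (Program.ConstsBelow.mono (P := .loop b P) (by omega) hc) (by omega) (by omega)
    refine ⟨hs₂.mono (by omega) (by omega), _, Runs.loop_true hb hu₁ hu₂, ?_⟩
    have := htest b hs (by omega) (by omega)
    rw [add_mul, add_mul]
    omega

theorem Nat.size_prod_le {ι : Type*} (s : Finset ι) (f : ι → ℕ) :
    Nat.size (∏ i ∈ s, f i) ≤ 1 + ∑ i ∈ s, Nat.size (f i) := by
  rw [Nat.size_le, pow_add, ← Finset.prod_pow_eq_pow_sum]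
  have : ∏ i ∈ s, f i ≤ ∏ i ∈ s, 2 ^ (f i).size :=
    Finset.prod_le_prod' fun i _ => (Nat.lt_size_self _).le
  have h2 : 0 < ∏ i ∈ s, 2 ^ (f i).size := Finset.prod_pos fun i _ => by positivity
  omega

/-- The product of all denominators serves as common denominator. Its length is at most one more
than the sum of their lengths, so it is linear in the size of the instance. -/
theorem WSOCTInstance.input_bounded (I : WSOCTInstance ℚ) :
    ∃ D, D ≠ 0 ∧ Nat.size D ≤ 1 + I.size CostModel.logarithmic ∧
      I.input.Bounded (1 + I.n) D (1 + 2 * I.size CostModel.logarithmic) := by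
  set σ := I.size CostModel.logarithmic with hσ
  have hk : Nat.size I.k ≤ σ := by
    simp [hσ, WSOCTInstance.size, CostModel.logarithmic]
    omega
  have hden : ∑ v, Nat.size (I.w v).den ≤ σ := by
    simp only [hσ, WSOCTInstance.size, CostModel.logarithmic, Finset.sum_add_distrib]
    omega
  have hD : Nat.size (∏ v, (I.w v).den) ≤ 1 + σ := by
    have := Nat.size_prod_le Finset.univ fun v => (I.w v).den
    omega
  have hnum : ∀ v, Nat.size (I.w v).num.natAbs + ∑ v, Nat.size (I.w v).den ≤ σ := by
    intro v
    have := Finset.single_le_sum (f := fun v => Nat.size (I.w v).num.natAbs)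
      (fun _ _ => Nat.zero_le _) (Finset.mem_univ v)
    simp only [hσ, WSOCTInstance.size, CostModel.logarithmic, Finset.sum_add_distrib]
    omega
  have hne : (∏ v, (I.w v).den) ≠ 0 := Finset.prod_ne_zero_iff.2 fun v _ => (I.w v).den_ne_zero
  have hzero : IsFraction (∏ v, (I.w v).den) (1 + 2 * σ) 0 := ⟨0, by simp, by simp⟩
  have h2 : ∀ m, Nat.size m ≤ σ →
      m * (∏ v, (I.w v).den) < 2 ^ (1 + 2 * σ) := by
    intro m hm
    have h3 : m < 2 ^ σ := Nat.size_le.1 hm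
    have h4 : (∏ v, (I.w v).den) < 2 ^ (1 + σ) := Nat.size_le.1 hD
    calc m * (∏ v, (I.w v).den) < 2 ^ σ * 2 ^ (1 + σ) :=
          Nat.mul_lt_mul_of_le_of_lt h3.le h4 (by positivity)
      _ = 2 ^ (1 + 2 * σ) := by rw [← pow_add]; congr 1; ring
  refine ⟨_, hne, hD, ⟨fun x => ?_, fun a i => ?_, fun x => ?_, fun a i => ?_⟩⟩
  · simp only [WSOCTInstance.input]
    have : I.n < 2 ^ I.n := Nat.lt_two_pow_self
    split_ifs
    · rw [pow_add]; omega
    · positivity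
  · simp only [WSOCTInstance.input]
    have : 1 < 2 ^ (1 + I.n) := Nat.one_lt_two_pow (by omega)
    split_ifs <;> omega
  · simp only [WSOCTInstance.input]
    split_ifs
    · refine ⟨I.k * (∏ v, (I.w v).den : ℕ), ?_, ?_⟩
      · have : ((∏ v, (I.w v).den : ℕ) : ℚ) ≠ 0 := by exact_mod_cast hne
        push_cast at this ⊢
        field_simp
      · have := h2 _ hk
        rw [abs_of_nonneg (by positivity)]
        exact_mod_cast this
    · exact hzero
  · simp only [WSOCTInstance.input]
    split_ifs with h
    · set v : Fin I.n := ⟨i, h.2⟩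
      have hv : (∏ v, (I.w v).den) = (I.w v).den * ∏ u ∈ Finset.univ.erase v, (I.w u).den :=
        (Finset.mul_prod_erase _ _ (Finset.mem_univ v)).symm
      refine ⟨(I.w v).num * (∏ u ∈ Finset.univ.erase v, (I.w u).den : ℕ), ?_, ?_⟩
      · rw [hv]
        have h1 : ((I.w v).den : ℚ) ≠ 0 := by exact_mod_cast (I.w v).den_ne_zero
        have h3 : ((∏ u ∈ Finset.univ.erase v, (I.w u).den : ℕ) : ℚ) ≠ 0 := by
          have := Finset.prod_ne_zero_iff.2 fun u (_ : u ∈ Finset.univ.erase v) =>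
            (I.w u).den_ne_zero
          exact_mod_cast this
        conv_lhs => rw [← Rat.num_div_den (I.w v)]
        push_cast at h3 ⊢
        rw [mul_div_mul_right _ _ h3]
      · rw [abs_mul, Nat.abs_cast]
        have h5 : (I.w v).num.natAbs * (∏ u ∈ Finset.univ.erase v, (I.w u).den) ≤
            (I.w v).num.natAbs * (∏ v, (I.w v).den) := by
          apply Nat.mul_le_mul_left
          rw [hv]
          exact Nat.le_mul_of_pos_left _ (I.w v).den_pos
        have h6 := h5.trans_lt (h2 _ (by have := hnum v; omega))
        rw [← Int.natCast_natAbs (I.w v).num]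
        exact_mod_cast h6
    · exact hzero

theorem Polynomial.eval_nat_mono (p : Polynomial ℕ) {a b : ℕ} (h : a ≤ b) :
    p.eval a ≤ p.eval b := by
  rw [Polynomial.eval_eq_sum, Polynomial.eval_eq_sum]
  exact Finset.sum_le_sum fun i _ => Nat.mul_le_mul_left _ (Nat.pow_le_pow_left h i)

/-- A program that is polynomial for uniform cost over `ℚ` is polynomial for logarithmic cost. -/
theorem Program.DecidesWSOCTInPolyTime.logarithmic {P : Program}
    {𝒢 : ∀ n : ℕ, SimpleGraph (Fin n) → Prop}
    (h : P.DecidesWSOCTInPolyTime (CostModel.uniform ℚ) 𝒢) :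
    P.DecidesWSOCTInPolyTime CostModel.logarithmic 𝒢 := by
  obtain ⟨p, hp⟩ := h
  obtain ⟨c, hc⟩ := P.exists_constsBelow
  -- The second factor is `stepBound` for the final lengths: those of the input, increased by the
  -- number `p` of steps and, for the natural numbers, by the length `c` of the constants in the
  -- program. The last summand `1 + X` bounds the length of the common denominator.
  open Polynomial in
  refine ⟨p * (1 + 2 * (1 + X + C c + p) + 2 * (1 + 2 * X + p + (1 + X))), fun I hI => ?_⟩
  obtain ⟨t, s, hr, ht, hs⟩ := hp I hI
  obtain ⟨D, hD, hDs, hb⟩ := I.input_bounded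
  set σ := I.size CostModel.logarithmic with hσ
  have hn : I.n ≤ σ := by
    simp only [hσ, WSOCTInstance.size]
    omega
  have hun : I.size (CostModel.uniform ℚ) = I.n := by
    simp [WSOCTInstance.size, CostModel.uniform]
  rw [hun] at ht
  have ht' : t ≤ p.eval σ := ht.trans (p.eval_nat_mono hn)
  obtain ⟨-, t', hr', ht''⟩ := hr.exists_logarithmic (Nmax := 1 + σ + c + p.eval σ)
    (Lmax := 1 + 2 * σ + p.eval σ) hD (hb.mono (N' := 1 + σ + c) (by omega) le_rfl)
    (hc.mono (by omega)) (by omega) (by omega)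
  refine ⟨t', s, hr', ht''.trans ?_, hs⟩
  simp only [Polynomial.eval_mul, Polynomial.eval_add, Polynomial.eval_one, Polynomial.eval_X,
    Polynomial.eval_C, Polynomial.eval_ofNat]
  refine Nat.mul_le_mul ht' ?_
  unfold stepBound
  omega

/-! ### Programs with bounded loops -/

/-- Programs all of whose loops are counted: `for_ i b S` runs `S` for `i` from `0` up to and
including the value of `b`. -/
inductive Stmt where
  | instr (c : Instr)
  | seq (S S' : Stmt)
  | ite (t : Test) (S S' : Stmt)
  | for_ (i b : ℕ) (S : Stmt)

/-- Assignment to a natural-number variable. -/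
def Memory.setNum {R : Type} (s : Memory R) (x m : ℕ) : Memory R :=
  { s with num := Function.update s.num x m }

open Classical in
/-- The effect of a program with bounded loops. -/
noncomputable def Stmt.run {R : Type} [Add R] [Sub R] [LE R] : Stmt → Memory R → Memory R
  | .instr c, s => c.exec s
  | .seq S S', s => S'.run (S.run s)
  | .ite t S S', s => if t.Holds s then S.run s else S'.run s
  | .for_ i b S, s =>
      (fun s' => (S.run s').setNum i ((S.run s').num i + 1))^[s.num b + 1] (s.setNum i 0)

/-- The translation into programs; variable `3` has to hold the constant `1`. -/
def Stmt.toProgram : Stmt → Program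
  | .instr c => .instr c
  | .seq S S' => .seq S.toProgram S'.toProgram
  | .ite t S S' => .ite t S.toProgram S'.toProgram
  | .for_ i b S =>
      .seq (.instr (.set i 0)) (.loop (.le i b) (.seq S.toProgram (.instr (.add i i 3))))

/-- The instruction does not assign to the natural-number variable `x`. -/
def Instr.Avoids (x : ℕ) : Instr → Prop
  | .set y _ => y ≠ x
  | .add y _ _ => y ≠ x
  | .sub y _ _ => y ≠ x
  | .load y _ _ => y ≠ x
  | _ => True

/-- The program does not assign to the natural-number variable `x`. -/
def Stmt.Avoids (x : ℕ) : Stmt → Prop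
  | .instr c => c.Avoids x
  | .seq S S' => S.Avoids x ∧ S'.Avoids x
  | .ite _ S S' => S.Avoids x ∧ S'.Avoids x
  | .for_ i _ S => i ≠ x ∧ S.Avoids x

/-- All loops are bounded by variable `1` or `2`, and the body does not assign to the counter. -/
def Stmt.LoopsOk : Stmt → Prop
  | .instr _ => True
  | .seq S S' => S.LoopsOk ∧ S'.LoopsOk
  | .ite _ S S' => S.LoopsOk ∧ S'.LoopsOk
  | .for_ i b S => (b = 1 ∨ b = 2) ∧ S.Avoids i ∧ S.LoopsOk

open Polynomial in
/-- The number of steps, as a polynomial in a strict upper bound for the variables `1` and `2`. -/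
noncomputable def Stmt.time : Stmt → ℕ[X]
  | .instr _ => 1
  | .seq S S' => S.time + S'.time
  | .ite _ S S' => 1 + S.time + S'.time
  | .for_ _ _ S => 2 + X * (2 + S.time)

theorem Memory.setNum_num {R : Type} (s : Memory R) (x m y : ℕ) :
    (s.setNum x m).num y = if y = x then m else s.num y := by
  simp [Memory.setNum, Function.update_apply]

theorem Instr.Avoids.exec_num {R : Type} [Add R] [Sub R] {x : ℕ} {c : Instr}
    (h : c.Avoids x) (s : Memory R) :
    (c.exec s).num x = s.num x := by
  cases c <;> first | rfl | exact Function.update_of_ne (Ne.symm h) _ _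

theorem Stmt.Avoids.run_num {R : Type} [Add R] [Sub R] [LE R] {x : ℕ} :
    ∀ {S : Stmt}, S.Avoids x → ∀ s : Memory R, (S.run s).num x = s.num x
  | .instr _, h, s => Instr.Avoids.exec_num h s
  | .seq S S', h, s => by rw [Stmt.run, run_num h.2, run_num h.1]
  | .ite t S S', h, s => by
      rw [Stmt.run]
      split_ifs
      · exact run_num h.1 s
      · exact run_num h.2 s
  | .for_ i b S, h, s => by
      rw [Stmt.run]
      have key : ∀ (k : ℕ) (s' : Memory R),
          ((fun s' : Memory R => (S.run s').setNum i ((S.run s').num i + 1))^[k] s').num x =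
            s'.num x := by
        intro k
        induction k with
        | zero => intro s'; rfl
        | succ k ih =>
          intro s'
          rw [Function.iterate_succ_apply, ih, Memory.setNum_num, if_neg h.1.symm, run_num h.2]
      rw [key, Memory.setNum_num, if_neg h.1.symm]

/-- The invariant rule for counted loops. -/
theorem Stmt.for_rule {R : Type} [Add R] [Sub R] [LE R] {i b m : ℕ} {S : Stmt}
    {s : Memory R} (hb : s.num b = m)
    (hi : S.Avoids i) (Inv : ℕ → Memory R → Prop) (h0 : Inv 0 (s.setNum i 0))
    (hstep : ∀ k ≤ m, ∀ s', s'.num i = k → Inv k s' → Inv (k + 1) ((S.run s').setNum i (k + 1))) :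
    Inv (m + 1) ((Stmt.for_ i b S).run s) := by
  have key : ∀ k ≤ m + 1,
      Inv k ((fun s' : Memory R => (S.run s').setNum i ((S.run s').num i + 1))^[k]
        (s.setNum i 0)) ∧
      ((fun s' : Memory R => (S.run s').setNum i ((S.run s').num i + 1))^[k]
        (s.setNum i 0)).num i = k := by
    intro k
    induction k with
    | zero => exact fun _ => ⟨h0, by simp [Memory.setNum_num]⟩
    | succ k ih =>
      intro hk
      obtain ⟨h1, h2⟩ := ih (by omega)
      rw [Function.iterate_succ_apply']
      have := hstep k (by omega) _ h2 h1
      rw [hi.run_num, h2]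
      exact ⟨this, by simp [Memory.setNum_num]⟩
  rw [Stmt.run, hb]
  exact (key (m + 1) le_rfl).1

/-- The variables `1`, `2` and `3` are never assigned to, so the loop bounds and the increment of
the counters are constant throughout the run. This fixes the number of iterations of each loop by
the input alone. -/
theorem Stmt.exists_runs {R : Type} [Add R] [Sub R] [LE R] (M : ℕ) :
    ∀ (S : Stmt), S.LoopsOk → S.Avoids 1 → S.Avoids 2 →
    S.Avoids 3 → ∀ s : Memory R, s.num 3 = 1 → s.num 1 < M → s.num 2 < M →
      ∃ t, Runs (CostModel.uniform R) S.toProgram s t (S.run s) ∧ t ≤ S.time.eval M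
  | .instr c, _, _, _, _, s, _, _, _ => by
      refine ⟨_, Runs.instr c s, ?_⟩
      rw [Instr.cost_uniform]
      simp [Stmt.time]
  | .seq S S', hl, a1, a2, a3, s, h3, h1, h2 => by
      obtain ⟨t, ht, hb⟩ := exists_runs M S hl.1 a1.1 a2.1 a3.1 s h3 h1 h2
      obtain ⟨t', ht', hb'⟩ := exists_runs M S' hl.2 a1.2 a2.2 a3.2 (S.run s)
        (by rw [a3.1.run_num, h3]) (by rwa [a1.1.run_num]) (by rwa [a2.1.run_num])
      refine ⟨_, Runs.seq ht ht', ?_⟩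
      simp only [Stmt.time, Polynomial.eval_add]
      omega
  | .ite b S S', hl, a1, a2, a3, s, h3, h1, h2 => by
      rw [Stmt.run]
      split_ifs with hb
      · obtain ⟨t, ht, htb⟩ := exists_runs M S hl.1 a1.1 a2.1 a3.1 s h3 h1 h2
        refine ⟨_, Runs.ite_true hb ht, ?_⟩
        rw [Test.cost_uniform]
        simp only [Stmt.time, Polynomial.eval_add, Polynomial.eval_one]
        omega
      · obtain ⟨t, ht, htb⟩ := exists_runs M S' hl.2 a1.2 a2.2 a3.2 s h3 h1 h2
        refine ⟨_, Runs.ite_false hb ht, ?_⟩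
        rw [Test.cost_uniform]
        simp only [Stmt.time, Polynomial.eval_add, Polynomial.eval_one]
        omega
  | .for_ i b S, hl, a1, a2, a3, s, h3, h1, h2 => by
      set f := fun s' : Memory R => (S.run s').setNum i ((S.run s').num i + 1) with hf
      have key : ∀ (k : ℕ) (s' : Memory R), s'.num 3 = 1 → s'.num 1 = s.num 1 →
          s'.num 2 = s.num 2 → s'.num i + k = s.num b + 1 →
          ∃ t, Runs (CostModel.uniform R)
            (.loop (.le i b) (.seq S.toProgram (.instr (.add i i 3)))) s' t (f^[k] s') ∧
            t ≤ 1 + k * (2 + S.time.eval M) := by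
        intro k
        induction k with
        | zero =>
          intro s' e3 e1 e2 e
          refine ⟨_, Runs.loop_false ?_, ?_⟩
          · have : s'.num b = s.num b := by rcases hl.1 with rfl | rfl <;> assumption
            simp only [Test.Holds, this]
            omega
          · rw [Test.cost_uniform]
            omega
        | succ k ih =>
          intro s' e3 e1 e2 e
          obtain ⟨t, ht, htb⟩ := exists_runs M S hl.2.2 a1.2 a2.2 a3.2 s' e3 (by omega) (by omega)
          have hfe : (Instr.add i i 3).exec (S.run s') = f s' := by
            simp only [Instr.exec, hf, Memory.setNum, a3.2.run_num, e3]
          obtain ⟨t', ht', htb'⟩ := ih (f s')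
            (by simp [hf, Memory.setNum_num, a3.1.symm, a3.2.run_num, e3])
            (by simp [hf, Memory.setNum_num, a1.1.symm, a1.2.run_num, e1])
            (by simp [hf, Memory.setNum_num, a2.1.symm, a2.2.run_num, e2])
            (by simp only [hf, Memory.setNum_num, if_true, hl.2.1.run_num]; omega)
          have hi := Runs.instr (M := CostModel.uniform R) (.add i i 3) (S.run s')
          rw [hfe] at hi
          refine ⟨_, Runs.loop_true ?_ (Runs.seq ht hi) ht', ?_⟩
          · have : s'.num b = s.num b := by rcases hl.1 with rfl | rfl <;> assumption
            simp only [Test.Holds, this]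
            omega
          · rw [Test.cost_uniform, Instr.cost_uniform, add_mul]
            omega
      obtain ⟨t, ht, htb⟩ := key (s.num b + 1) (s.setNum i 0)
        (by simp [Memory.setNum_num, a3.1.symm, h3])
        (by simp [Memory.setNum_num, a1.1.symm]) (by simp [Memory.setNum_num, a2.1.symm])
        (by simp [Memory.setNum_num])
      refine ⟨_, Runs.seq (Runs.instr (.set i 0) s) ht, ?_⟩
      rw [Instr.cost_uniform]
      simp only [Stmt.time, Polynomial.eval_add, Polynomial.eval_mul, Polynomial.eval_X,
        Polynomial.eval_ofNat]
      -- A loop includes its bound and makes `s.num b + 1` iterations, which is why `M` has to be a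
      -- strict upper bound.
      have : s.num b + 1 ≤ M := by rcases hl.1 with rfl | rfl <;> omega
      have := Nat.mul_le_mul_right (2 + S.time.eval M) this
      omega

/-! ### Minimum cuts by pushing and relabelling -/

/-- A preflow on the nodes `0, 1, 2, …`: residual capacities, excesses and labels. -/
structure Preflow (R : Type) where
  r : ℕ → ℕ → R
  e : ℕ → R
  d : ℕ → ℕ

namespace Preflow

section

variable {R : Type} [Field R] [LinearOrder R] [IsStrictOrderedRing R]

/-- An active node, with sink `t`. -/
def Active (t : ℕ) (σ : Preflow R) (u : ℕ) : Prop := u ≠ t ∧ 0 < σ.e u ∧ σ.d u ≤ t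

/-- The arc from `u` to `v` admits a push. -/
def Pushable (t : ℕ) (σ : Preflow R) (u v : ℕ) : Prop :=
  σ.Active t u ∧ σ.d u = σ.d v + 1 ∧ 0 < σ.r u v

/-- The node `u` may be relabelled. -/
def Relabelable (t : ℕ) (σ : Preflow R) (u : ℕ) : Prop :=
  σ.Active t u ∧ ∀ v ≤ t, 0 < σ.r u v → σ.d u ≤ σ.d v

/-- Sending `δ` units from `u` to `v`. -/
def send (σ : Preflow R) (u v : ℕ) (δ : R) : Preflow R where
  r x y := σ.r x y - (if x = u ∧ y = v then δ else 0) + (if x = v ∧ y = u then δ else 0)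
  e x := σ.e x - (if x = u then δ else 0) + (if x = v then δ else 0)
  d := σ.d

open Classical in
/-- Push from `u` to `v` if possible. -/
noncomputable def push (t u v : ℕ) (σ : Preflow R) : Preflow R :=
  if σ.Pushable t u v then σ.send u v (min (σ.e u) (σ.r u v)) else σ

open Classical in
/-- Relabel `u` if possible. -/
noncomputable def relabel (t u : ℕ) (σ : Preflow R) : Preflow R :=
  if σ.Relabelable t u then { σ with d := Function.update σ.d u (σ.d u + 1) } else σ

/-- The invariant: a valid labelling of a preflow with capacities `c` and initial excesses `b`. -/
structure Valid (t : ℕ) (c : ℕ → ℕ → R) (b : ℕ → R) (σ : Preflow R) : Prop where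
  r_nonneg : ∀ u ≤ t, ∀ v ≤ t, 0 ≤ σ.r u v
  e_nonneg : ∀ u ≤ t, 0 ≤ σ.e u
  r_add : ∀ u ≤ t, ∀ v ≤ t, σ.r u v + σ.r v u = c u v + c v u
  excess : ∀ v ≤ t, σ.e v = b v + ∑ u ∈ Finset.range (t + 1), (c u v - σ.r u v)
  d_sink : σ.d t = 0
  d_le : ∀ u ≤ t, σ.d u ≤ t + 1
  d_step : ∀ u ≤ t, ∀ v ≤ t, 0 < σ.r u v → σ.d u ≤ σ.d v + 1

open Classical in
/-- The number of saturated downhill arcs. -/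
noncomputable def saturated (t : ℕ) (σ : Preflow R) : ℕ :=
  ∑ x ∈ Finset.range (t + 1), ∑ y ∈ Finset.range (t + 1),
    if ¬ 0 < σ.r x y ∧ σ.d y < σ.d x then 1 else 0

open Classical in
/-- The depth of the nodes with positive excess. -/
noncomputable def depth (t : ℕ) (σ : Preflow R) : ℕ :=
  ∑ x ∈ Finset.range (t + 1), if x ≠ t ∧ 0 < σ.e x then t + 1 - σ.d x else t + 1

/-- A potential that increases with each push and each relabelling. -/
noncomputable def potential (t : ℕ) (σ : Preflow R) : ℕ :=
  ((t + 1) * (t + 1) + (t + 1) + 2) * (∑ x ∈ Finset.range (t + 1), σ.d x) +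
    (t + 2) * σ.saturated t + σ.depth t

/-- The label sum, the saturated arcs and the depth are each at most `(t + 1) ^ 2`, so the potential
is of order `(t + 1) ^ 4`. The generous exponent `7` absorbs the constants as soon as `t + 1 ≥ 3`.
-/
theorem Valid.potential_le {t : ℕ} {c : ℕ → ℕ → R} {b : ℕ → R} {σ : Preflow R}
    (h : σ.Valid t c b) (ht : 2 ≤ t) : σ.potential t < (t + 1) ^ 7 := by
  have h1 : ∑ x ∈ Finset.range (t + 1), σ.d x ≤ (t + 1) * (t + 1) := by
    have := Finset.sum_le_card_nsmul (Finset.range (t + 1)) (fun x => σ.d x) (t + 1)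
      (fun x hx => h.d_le x (by simpa [Nat.lt_succ_iff] using hx))
    simpa using this
  have h2 : σ.saturated t ≤ (t + 1) * (t + 1) := by
    have h3 : ∀ x ∈ Finset.range (t + 1), (∑ y ∈ Finset.range (t + 1),
        if ¬ 0 < σ.r x y ∧ σ.d y < σ.d x then 1 else 0) ≤ t + 1 := by
      intro x _
      have := Finset.sum_le_card_nsmul (Finset.range (t + 1))
        (fun y => if ¬ 0 < σ.r x y ∧ σ.d y < σ.d x then 1 else 0) 1
        (fun y _ => by split_ifs <;> omega)
      simpa using this
    have := Finset.sum_le_card_nsmul _ _ _ h3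
    unfold saturated
    simpa using this
  have h4 : σ.depth t ≤ (t + 1) * (t + 1) := by
    have := Finset.sum_le_card_nsmul (Finset.range (t + 1))
      (fun x => if x ≠ t ∧ 0 < σ.e x then t + 1 - σ.d x else t + 1) (t + 1)
      (fun y _ => by split_ifs <;> omega)
    unfold depth
    simpa using this
  unfold potential
  set n := t + 1 with hn
  have hn3 : 3 ≤ n := by omega
  have h5 := Nat.mul_le_mul_left (n * n + n + 2) h1
  have h6 := Nat.mul_le_mul_left (n + 1) h2
  have h7 : 9 * n ^ 4 < n ^ 7 := by
    have : n ^ 7 = n ^ 3 * n ^ 4 := by ring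
    rw [this]
    have h27 : 3 ^ 3 ≤ n ^ 3 := Nat.pow_le_pow_left hn3 3
    have : 0 < n ^ 4 := by positivity
    nlinarith
  have h8 : n * (n * n) ≤ n ^ 4 := by nlinarith [pow_pos (show 0 < n by omega) 3]
  have h9 : n * n ≤ n ^ 4 := by nlinarith [pow_pos (show 0 < n by omega) 3]
  have : t + 2 = n + 1 := by omega
  rw [this]
  nlinarith

theorem Valid.push_ne {t : ℕ} {σ : Preflow R} {u v : ℕ} (hp : σ.Pushable t u v) : u ≠ v := by
  rintro rfl
  have := hp.2.1
  omega

theorem sum_send_r {t u v y : ℕ} (hu : u ≤ t) (hv : v ≤ t) (σ : Preflow R) (δ : R) :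
    ∑ x ∈ Finset.range (t + 1), (σ.send u v δ).r x y =
      ∑ x ∈ Finset.range (t + 1), σ.r x y - (if y = v then δ else 0) +
        (if y = u then δ else 0) := by
  simp only [send, Finset.sum_add_distrib, Finset.sum_sub_distrib, ite_and]
  rw [Finset.sum_ite_eq', Finset.sum_ite_eq', if_pos (Finset.mem_range_succ_iff.2 hu),
    if_pos (Finset.mem_range_succ_iff.2 hv)]

/-- Only the reverse arc gains residual capacity, and it leads uphill by one, so the labelling stays
valid. -/
theorem Valid.push {t : ℕ} {c : ℕ → ℕ → R} {b : ℕ → R} {σ : Preflow R} (h : σ.Valid t c b)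
    {u v : ℕ} (hu : u ≤ t) (hv : v ≤ t) : (σ.push t u v).Valid t c b := by
  by_cases hp : σ.Pushable t u v
  swap
  · rwa [Preflow.push, if_neg hp]
  rw [Preflow.push, if_pos hp]
  set δ := min (σ.e u) (σ.r u v) with hδ
  have hne := Valid.push_ne hp
  have hδ0 : 0 < δ := lt_min hp.1.2.1 hp.2.2
  have hδe : δ ≤ σ.e u := min_le_left _ _
  have hδr : δ ≤ σ.r u v := min_le_right _ _
  refine ⟨fun x hx y hy => ?_, fun x hx => ?_, fun x hx y hy => ?_, fun y hy => ?_, h.d_sink,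
    h.d_le, fun x hx y hy hr => ?_⟩
  · have := h.r_nonneg x hx y hy
    simp only [send]
    split_ifs with h1 h2 h2
    · exact absurd (h1.1.symm.trans h2.1) hne
    · rw [h1.1, h1.2]; linarith
    · linarith
    · linarith
  · have := h.e_nonneg x hx
    simp only [send]
    split_ifs with h1 h2 h2
    · linarith
    · rw [h1]; linarith
    · linarith
    · linarith
  · have := h.r_add x hx y hy
    simp only [send, and_comm (a := y = u), and_comm (a := y = v)]
    linarith
  · have := h.excess y hy
    rw [Finset.sum_sub_distrib, sum_send_r hu hv]
    rw [Finset.sum_sub_distrib] at this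
    simp only [send]
    linarith
  · simp only [send] at hr ⊢
    by_cases h2 : x = v ∧ y = u
    · rw [h2.1, h2.2, hp.2.1]
      omega
    · rw [if_neg h2] at hr
      refine h.d_step x hx y hy ?_
      split_ifs at hr <;> linarith

/-- All residual arcs out of `u` lead to nodes at least as high, so after raising `u` by one none of
them descends by more than one. -/
theorem Valid.relabel {t : ℕ} {c : ℕ → ℕ → R} {b : ℕ → R} {σ : Preflow R} (h : σ.Valid t c b)
    {u : ℕ} : (σ.relabel t u).Valid t c b := by
  by_cases hp : σ.Relabelable t u
  swap
  · rwa [Preflow.relabel, if_neg hp]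
  rw [Preflow.relabel, if_pos hp]
  refine ⟨h.r_nonneg, h.e_nonneg, h.r_add, h.excess, ?_, fun x hx => ?_, fun x hx y hy hr => ?_⟩
  · simp only [Function.update_of_ne hp.1.1.symm]
    exact h.d_sink
  · have h1 := h.d_le x hx
    have h2 := hp.1.2.2
    simp only [Function.update_apply]
    split_ifs <;> omega
  · have h1 := h.d_step x hx y hy hr
    have h2 := hp.2 y hy
    simp only [Function.update_apply]
    split_ifs with hxu hyu hyu
    · omega
    · subst hxu
      have := h2 hr
      omega
    · subst hyu
      omega
    · exact h1

/-- A push that empties `u` raises the depth by `d u` there and lowers it by at most `d v = d u - 1`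
at `v`. Any other push saturates the arc, which is worth `t + 2`, while the depth falls by at most
`d v ≤ t + 1`. No saturated downhill arc is lost, because the arc that regains capacity leads
uphill. -/
theorem Valid.potential_push {t : ℕ} {c : ℕ → ℕ → R} {b : ℕ → R} {σ : Preflow R}
    (h : σ.Valid t c b) {u v : ℕ} (hu : u ≤ t) (hv : v ≤ t) (hp : σ.Pushable t u v) :
    σ.potential t < (σ.push t u v).potential t := by
  classical
  rw [Preflow.push, if_pos hp]
  set δ := min (σ.e u) (σ.r u v) with hδ
  have hne := Valid.push_ne hp
  have hδ0 : 0 < δ := lt_min hp.1.2.1 hp.2.2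
  have hu' : u ∈ Finset.range (t + 1) := by simpa [Nat.lt_succ_iff] using hu
  have hv' : v ∈ Finset.range (t + 1) := by simpa [Nat.lt_succ_iff] using hv
  have hdv := h.d_le v hv
  have hduv := hp.2.1
  have hd : ∑ x ∈ Finset.range (t + 1), (σ.send u v δ).d x =
    ∑ x ∈ Finset.range (t + 1), σ.d x := rfl
  have hz : ∀ x y, (if ¬ 0 < σ.r x y ∧ σ.d y < σ.d x then 1 else 0 : ℕ) ≤
      if ¬ 0 < (σ.send u v δ).r x y ∧ (σ.send u v δ).d y < (σ.send u v δ).d x then 1 else 0 := by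
    intro x y
    by_cases h1 : ¬ 0 < σ.r x y ∧ σ.d y < σ.d x
    · rw [if_pos h1, if_pos]
      refine ⟨?_, h1.2⟩
      simp only [send]
      have h2 : ¬ (x = v ∧ y = u) := by
        rintro ⟨rfl, rfl⟩
        have := h1.2
        omega
      rw [if_neg h2]
      intro h3
      apply h1.1
      split_ifs at h3 <;> linarith
    · rw [if_neg h1]
      exact Nat.zero_le _
  have hsat : σ.saturated t ≤ (σ.send u v δ).saturated t :=
    Finset.sum_le_sum fun x _ => Finset.sum_le_sum fun y _ => hz x y
  have hdepth : ∀ g : ℕ, (g = 0 ∨ (δ = σ.e u ∧ g = σ.d u)) →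
      σ.depth t + g ≤ (σ.send u v δ).depth t + σ.d v := by
    intro g hg
    have key : ∀ x ∈ Finset.range (t + 1),
        (if x ≠ t ∧ 0 < σ.e x then t + 1 - σ.d x else t + 1) + (if x = u then g else 0) ≤
        (if x ≠ t ∧ 0 < (σ.send u v δ).e x then t + 1 - (σ.send u v δ).d x else t + 1) +
          (if x = v then σ.d v else 0) := by
      intro x hx
      have hdx := h.d_le x (by simpa [Nat.lt_succ_iff] using hx)
      by_cases hxu : x = u
      · subst hxu
        rw [if_pos (⟨hp.1.1, hp.1.2.1⟩ : x ≠ t ∧ 0 < σ.e x), if_pos rfl, if_neg hne]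
        rcases hg with rfl | ⟨h1, rfl⟩
        · simp only [send]
          split_ifs <;> omega
        · rw [if_neg]
          · omega
          · simp [send, hne, h1]
      · by_cases hxv : x = v
        · subst hxv
          simp only [send, if_neg hxu, if_true]
          split_ifs <;> omega
        · simp only [send, if_neg hxu, if_neg hxv, sub_zero, add_zero]
          exact le_rfl
    have := Finset.sum_le_sum key
    rw [Finset.sum_add_distrib, Finset.sum_add_distrib, Finset.sum_ite_eq', if_pos hu',
      Finset.sum_ite_eq', if_pos hv'] at this
    exact this
  unfold potential
  rw [hd]
  rcases le_or_gt (σ.e u) (σ.r u v) with hle | hlt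
  · have := hdepth (σ.d u) (Or.inr ⟨min_eq_left hle, rfl⟩)
    have := Nat.mul_le_mul_left (t + 2) hsat
    omega
  · have h1 := hdepth 0 (Or.inl rfl)
    have h2 : σ.saturated t < (σ.send u v δ).saturated t := by
      refine Finset.sum_lt_sum (fun x _ => Finset.sum_le_sum fun y _ => hz x y) ⟨u, hu', ?_⟩
      refine Finset.sum_lt_sum (fun y _ => hz u y) ⟨v, hv', ?_⟩
      rw [if_neg (fun h3 => h3.1 hp.2.2), if_pos]
      · exact Nat.one_pos
      · refine ⟨?_, by simp only [send]; omega⟩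
        simp [send, hne, hδ, min_eq_right hlt.le]
    have := Nat.mul_le_mul_left (t + 2) (Nat.succ_le_of_lt h2)
    rw [Nat.succ_eq_add_one, mul_add] at this
    omega

/-- Raising `u` spoils at most the `t + 1` saturated downhill arcs that enter `u`, and lowers the
depth by at most one. The coefficient of the label sum is `(t + 2) * (t + 1) + 2`, just enough to
outweigh this. -/
theorem potential_relabel {t : ℕ} {σ : Preflow R} {u : ℕ} (hu : u ≤ t)
    (hp : σ.Relabelable t u) :
    σ.potential t < (σ.relabel t u).potential t := by
  classical
  rw [Preflow.relabel, if_pos hp]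
  have hu' : u ∈ Finset.range (t + 1) := by simpa [Nat.lt_succ_iff] using hu
  set σ' : Preflow R := { σ with d := Function.update σ.d u (σ.d u + 1) } with hσ'
  have hd' : ∀ x, σ'.d x = σ.d x + if x = u then 1 else 0 := by
    intro x
    simp only [hσ', Function.update_apply]
    split_ifs with hx
    · rw [hx]
    · rfl
  have hd : ∑ x ∈ Finset.range (t + 1), σ'.d x = ∑ x ∈ Finset.range (t + 1), σ.d x + 1 := by
    simp only [hd', Finset.sum_add_distrib]
    rw [Finset.sum_ite_eq', if_pos hu']
  have hsat : σ.saturated t ≤ σ'.saturated t + (t + 1) := by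
    have key : ∀ x ∈ Finset.range (t + 1), (∑ y ∈ Finset.range (t + 1),
        if ¬ 0 < σ.r x y ∧ σ.d y < σ.d x then 1 else 0) ≤
        (∑ y ∈ Finset.range (t + 1), if ¬ 0 < σ'.r x y ∧ σ'.d y < σ'.d x then 1 else 0) + 1 := by
      intro x _
      have : ∀ y ∈ Finset.range (t + 1),
          (if ¬ 0 < σ.r x y ∧ σ.d y < σ.d x then 1 else 0) ≤
          (if ¬ 0 < σ'.r x y ∧ σ'.d y < σ'.d x then 1 else 0) + if y = u then 1 else 0 := by
        intro y _
        by_cases hy : y = u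
        · rw [if_pos hy]
          split_ifs <;> omega
        · by_cases h1 : ¬ 0 < σ.r x y ∧ σ.d y < σ.d x
          · rw [if_pos h1, if_pos]
            · omega
            · refine ⟨h1.1, ?_⟩
              rw [hd', hd', if_neg hy]
              have := h1.2
              omega
          · rw [if_neg h1]
            exact Nat.zero_le _
      have := Finset.sum_le_sum this
      rw [Finset.sum_add_distrib, Finset.sum_ite_eq', if_pos hu'] at this
      exact this
    have := Finset.sum_le_sum key
    rw [Finset.sum_add_distrib] at this
    simpa [saturated] using this
  have hdepth : σ.depth t ≤ σ'.depth t + 1 := by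
    have : ∀ x ∈ Finset.range (t + 1),
        (if x ≠ t ∧ 0 < σ.e x then t + 1 - σ.d x else t + 1) ≤
        (if x ≠ t ∧ 0 < σ'.e x then t + 1 - σ'.d x else t + 1) + if x = u then 1 else 0 := by
      intro x _
      have : σ'.e x = σ.e x := rfl
      rw [hd', this]
      split_ifs <;> omega
    have := Finset.sum_le_sum this
    rw [Finset.sum_add_distrib, Finset.sum_ite_eq', if_pos hu'] at this
    exact this
  unfold potential
  rw [hd]
  have := Nat.mul_le_mul_left (t + 2) hsat
  have h2 : (t + 2) * (t + 1) = (t + 1) * (t + 1) + (t + 1) := by ring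
  rw [mul_add (t + 2), h2] at this
  generalize hK : (t + 1) * (t + 1) + (t + 1) + 2 = K
  rw [mul_add K, mul_one]
  omega

/-! ### Rounds of pushes and relabellings -/

/-- Applying `f 0`, …, `f (k - 1)` in turn. -/
def foldUpTo {α : Type*} (f : ℕ → α → α) : ℕ → α → α
  | 0, a => a
  | k + 1, a => f k (foldUpTo f k a)

theorem foldUpTo_eq_self {α : Type*} {f : ℕ → α → α} {a : α} :
    ∀ {k : ℕ}, (∀ i < k, f i a = a) → foldUpTo f k a = a
  | 0, _ => rfl
  | k + 1, h => by
      rw [foldUpTo, foldUpTo_eq_self fun i hi => h i (by omega), h k (by omega)]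

/-- One round: try all pushes, then all relabellings. -/
noncomputable def round (t : ℕ) (σ : Preflow R) : Preflow R :=
  foldUpTo (fun u => relabel t u) (t + 1)
    (foldUpTo (fun u => foldUpTo (fun v => push t u v) (t + 1)) (t + 1) σ)

/-- `f` preserves validity, and increases the potential unless it does nothing. -/
def Progressive (t : ℕ) (c : ℕ → ℕ → R) (b : ℕ → R) (f : Preflow R → Preflow R) : Prop :=
  ∀ σ, σ.Valid t c b → (f σ).Valid t c b ∧ σ.potential t ≤ (f σ).potential t ∧
    ((f σ).potential t ≤ σ.potential t → f σ = σ)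

/-- If the whole sequence does not raise the potential, no member of it does, so each acts as the
identity. All of them are then applied to the original preflow, and each is known to fix it. -/
theorem Progressive.foldUpTo {t : ℕ} {c : ℕ → ℕ → R} {b : ℕ → R}
    {f : ℕ → Preflow R → Preflow R} :
    ∀ k, (∀ i < k, Progressive t c b (f i)) → Progressive t c b (foldUpTo f k) ∧
      ∀ σ, σ.Valid t c b → (Preflow.foldUpTo f k σ).potential t ≤ σ.potential t →
        ∀ i < k, f i σ = σ := by
  intro k
  induction k with
  | zero => exact fun _ => ⟨fun σ h => ⟨h, le_rfl, fun _ => rfl⟩, fun σ _ _ i hi => by omega⟩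
  | succ k ih =>
    intro hf
    obtain ⟨ih1, ih2⟩ := ih fun i hi => hf i (by omega)
    have key : ∀ σ, σ.Valid t c b →
        (Preflow.foldUpTo f (k + 1) σ).potential t ≤ σ.potential t →
        Preflow.foldUpTo f k σ = σ ∧ f k σ = σ := by
      intro σ h hle
      obtain ⟨a1, a2, a3⟩ := ih1 σ h
      obtain ⟨b1, b2, b3⟩ := hf k (by omega) _ a1
      simp only [Preflow.foldUpTo] at hle
      have e1 := a3 (by omega)
      have e2 := b3 (by omega)
      rw [e1] at e2
      exact ⟨e1, e2⟩
    refine ⟨fun σ h => ?_, fun σ h hle i hi => ?_⟩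
    · obtain ⟨a1, a2, a3⟩ := ih1 σ h
      obtain ⟨b1, b2, b3⟩ := hf k (by omega) _ a1
      refine ⟨b1, a2.trans b2, fun hle => ?_⟩
      obtain ⟨e1, e2⟩ := key σ h hle
      simp only [Preflow.foldUpTo, e1, e2]
    · obtain ⟨e1, e2⟩ := key σ h hle
      rcases Nat.lt_succ_iff_lt_or_eq.1 hi with hi | rfl
      · exact ih2 σ h (by rw [e1]) i hi
      · exact e2

theorem progressive_push {t : ℕ} {c : ℕ → ℕ → R} {b : ℕ → R} {u v : ℕ} (hu : u ≤ t)
    (hv : v ≤ t) : Progressive t c b (push t u v) := by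
  intro σ h
  refine ⟨h.push hu hv, ?_⟩
  by_cases hp : σ.Pushable t u v
  · have := h.potential_push hu hv hp
    exact ⟨this.le, fun h' => absurd h' (not_le.2 this)⟩
  · rw [push, if_neg hp]
    exact ⟨le_rfl, fun _ => rfl⟩

theorem progressive_relabel {t : ℕ} {c : ℕ → ℕ → R} {b : ℕ → R} {u : ℕ} (hu : u ≤ t) :
    Progressive t c b (relabel t u) := by
  intro σ h
  refine ⟨h.relabel, ?_⟩
  by_cases hp : σ.Relabelable t u
  · have := potential_relabel hu hp
    exact ⟨this.le, fun h' => absurd h' (not_le.2 this)⟩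
  · rw [relabel, if_neg hp]
    exact ⟨le_rfl, fun _ => rfl⟩

/-- A round without progress changes nothing, so no push and no relabelling was possible. But an
active node always admits one of them: by validity a residual arc descends by at most one, and if
none descends by exactly one, the node may be relabelled. -/
theorem progressive_round {t : ℕ} {c : ℕ → ℕ → R} {b : ℕ → R} :
    Progressive t c b (round t) ∧
      ∀ σ, σ.Valid t c b → (round t σ).potential t ≤ σ.potential t →
        ∀ u ≤ t, ¬ σ.Active t u := by
  have h1 : ∀ u ≤ t, _ := fun u hu => Progressive.foldUpTo (t := t) (c := c) (b := b)
    (f := fun v => push t u v) (t + 1) fun v hv => progressive_push hu (by omega)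
  have h2 := Progressive.foldUpTo (t := t) (c := c) (b := b)
    (f := fun u => Preflow.foldUpTo (fun v => push t u v) (t + 1)) (t + 1)
    fun u hu => (h1 u (by omega)).1
  have h3 := Progressive.foldUpTo (t := t) (c := c) (b := b)
    (f := fun u => relabel t u) (t + 1) fun u hu => progressive_relabel (by omega)
  refine ⟨fun σ h => ?_, fun σ h hle u hu hact => ?_⟩
  · obtain ⟨a1, a2, a3⟩ := h2.1 σ h
    obtain ⟨b1, b2, b3⟩ := h3.1 _ a1
    refine ⟨b1, a2.trans b2, fun hle => ?_⟩
    unfold round at hle ⊢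
    rw [b3 (by omega), a3 (by omega)]
  · obtain ⟨a1, a2, a3⟩ := h2.1 σ h
    obtain ⟨b1, b2, b3⟩ := h3.1 _ a1
    unfold round at hle
    have e1 := a3 (by omega)
    have p1 := h2.2 σ h (by rw [e1])
    have p2 := h3.2 σ h (by rw [e1] at hle; exact hle) u (by omega)
    have p3 := (h1 u hu).2 σ h (by rw [p1 u (by omega)])
    have hnr : ¬ σ.Relabelable t u := fun hp => by
      have := potential_relabel hu hp
      rw [p2] at this
      exact lt_irrefl _ this
    apply hnr
    refine ⟨hact, fun v hv hr => ?_⟩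
    by_contra hlt
    have hp : σ.Pushable t u v := by
      refine ⟨hact, ?_, hr⟩
      have := h.d_step u hu v hv hr
      omega
    have := h.potential_push hu hv hp
    rw [p3 v (by omega)] at this
    exact lt_irrefl _ this

/-- As long as a node is active, each round raises the potential by at least one; the bound on the
potential limits the number of such rounds. -/
theorem Valid.iterate_round {t : ℕ} {c : ℕ → ℕ → R} {b : ℕ → R} {σ : Preflow R}
    (h : σ.Valid t c b) (ht : 2 ≤ t) :
    ((round t)^[(t + 1) ^ 7] σ).Valid t c b ∧
      ∀ u ≤ t, ¬ ((round t)^[(t + 1) ^ 7] σ).Active t u := by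
  obtain ⟨hp, hq⟩ := progressive_round (t := t) (c := c) (b := b)
  have key : ∀ m, ((round t)^[m] σ).Valid t c b ∧
      (m ≤ ((round t)^[m] σ).potential t ∨ ∀ u ≤ t, ¬ ((round t)^[m] σ).Active t u) := by
    intro m
    induction m with
    | zero => exact ⟨h, Or.inl (Nat.zero_le _)⟩
    | succ m ih =>
      rw [Function.iterate_succ_apply']
      obtain ⟨a1, a2, a3⟩ := hp _ ih.1
      refine ⟨a1, ?_⟩
      rcases le_or_gt ((round t ((round t)^[m] σ)).potential t) (((round t)^[m] σ).potential t)
        with hle | hlt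
      · right
        rw [a3 hle]
        exact hq _ ih.1 hle
      · rcases ih.2 with h1 | h1
        · left
          omega
        · left
          exfalso
          -- Without active nodes all pushes and relabellings are void, so a further round is the
          -- identity.
          have h4 : round t ((round t)^[m] σ) = (round t)^[m] σ := by
            have e1 : foldUpTo (fun u => foldUpTo (fun v => Preflow.push t u v) (t + 1)) (t + 1)
                ((round t)^[m] σ) = (round t)^[m] σ :=
              foldUpTo_eq_self fun u hu => foldUpTo_eq_self fun v _ => by
                rw [Preflow.push, if_neg fun hpu => h1 u (by omega) hpu.1]
            rw [round, e1]
            exact foldUpTo_eq_self fun u hu => by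
              rw [Preflow.relabel, if_neg fun hpu => h1 u (by omega) hpu.1]
          rw [h4] at hlt
          exact lt_irrefl _ hlt
  obtain ⟨k1, k2⟩ := key ((t + 1) ^ 7)
  refine ⟨k1, k2.resolve_left ?_⟩
  have := k1.potential_le ht
  omega

/-! ### Reading the minimum cut off the final preflow -/

/-- The net flow along arcs inside `Y` is antisymmetric and cancels; only the arcs that enter `Y`
contribute. -/
theorem Valid.sum_excess {t : ℕ} {c : ℕ → ℕ → R} {b : ℕ → R} {σ : Preflow R}
    (h : σ.Valid t c b) {Y : Finset ℕ} (hY : Y ⊆ Finset.range (t + 1)) :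
    ∑ v ∈ Y, σ.e v = ∑ v ∈ Y, b v +
      ∑ v ∈ Y, ∑ u ∈ Finset.range (t + 1) \ Y, (c u v - σ.r u v) := by
  have hle : ∀ v ∈ Y, v ≤ t := fun v hv => by simpa [Nat.lt_succ_iff] using hY hv
  have h0 : ∑ v ∈ Y, ∑ u ∈ Y, (c u v - σ.r u v) = 0 := by
    have h1 : ∑ v ∈ Y, ∑ u ∈ Y, (c u v - σ.r u v) = - ∑ v ∈ Y, ∑ u ∈ Y, (c u v - σ.r u v) := by
      conv_lhs => rw [Finset.sum_comm]
      rw [← Finset.sum_neg_distrib]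
      refine Finset.sum_congr rfl fun v hv => ?_
      rw [← Finset.sum_neg_distrib]
      refine Finset.sum_congr rfl fun u hu => ?_
      have := h.r_add u (hle u hu) v (hle v hv)
      linarith
    linarith
  calc ∑ v ∈ Y, σ.e v
      = ∑ v ∈ Y, (b v + ∑ u ∈ Finset.range (t + 1), (c u v - σ.r u v)) :=
        Finset.sum_congr rfl fun v hv => h.excess v (hle v hv)
    _ = ∑ v ∈ Y, b v + ∑ v ∈ Y, ∑ u ∈ Finset.range (t + 1), (c u v - σ.r u v) :=
        Finset.sum_add_distrib
    _ = _ := by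
        congr 1
        rw [← add_zero (∑ v ∈ Y, ∑ u ∈ Finset.range (t + 1) \ Y, (c u v - σ.r u v)), ← h0,
          ← Finset.sum_add_distrib]
        exact Finset.sum_congr rfl fun v _ => (Finset.sum_sdiff hY).symm

/-- When no node is active, the excess of the sink is the minimum capacity of a cut. -/
theorem Valid.excess_sink_le_iff {t : ℕ} {c : ℕ → ℕ → R} {b : ℕ → R} {σ : Preflow R}
    (h : σ.Valid t c b) (hact : ∀ u ≤ t, ¬ σ.Active t u) (θ : R) :
    σ.e t ≤ θ ↔ ∃ Y ⊆ Finset.range (t + 1), t ∈ Y ∧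
      ∑ v ∈ Y, b v + ∑ v ∈ Y, ∑ u ∈ Finset.range (t + 1) \ Y, c u v ≤ θ := by
  have hmem : ∀ {v}, v ∈ Finset.range (t + 1) → v ≤ t := fun hv => by
    simpa [Nat.lt_succ_iff] using hv
  constructor
  · intro hle
    -- The `t + 1` nodes cannot use all `t + 2` labels. The nodes below a gap in the labels form the
    -- sink side of a minimum cut.
    obtain ⟨l, hl1, hl⟩ : ∃ l ∈ Finset.range (t + 2), ∀ v ≤ t, σ.d v ≠ l := by
      by_contra hcon
      push Not at hcon
      have : Finset.range (t + 2) ⊆ (Finset.range (t + 1)).image σ.d := fun l hl => by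
        obtain ⟨v, hv, e⟩ := hcon l hl
        exact Finset.mem_image.2 ⟨v, by simpa [Nat.lt_succ_iff] using hv, e⟩
      have := (Finset.card_le_card this).trans Finset.card_image_le
      simp at this
    have hl1 : l ≤ t + 1 := by simpa [Nat.lt_succ_iff] using hl1
    have hl0 : 0 < l := by
      have := hl t le_rfl
      rw [h.d_sink] at this
      omega
    set Y := (Finset.range (t + 1)).filter fun v => σ.d v < l with hY
    have hYs : Y ⊆ Finset.range (t + 1) := Finset.filter_subset _ _
    have htY : t ∈ Y := by simp [hY, h.d_sink, hl0]
    refine ⟨Y, hYs, htY, ?_⟩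
    -- The labels in `Y` are below `l ≤ t + 1`, hence at most `t`, and a node other than the sink
    -- with such a label and positive excess would be active.
    have h1 : ∑ v ∈ Y, σ.e v = σ.e t := by
      refine Finset.sum_eq_single_of_mem t htY fun v hv hvt => ?_
      have hvle := hmem (hYs hv)
      have hd : σ.d v < l := (Finset.mem_filter.1 hv).2
      by_contra hne
      exact hact v hvle ⟨hvt, lt_of_le_of_ne (h.e_nonneg v hvle) (Ne.symm hne), by omega⟩
    have h2 := h.sum_excess hYs
    rw [h1] at h2
    have h3 : ∑ v ∈ Y, ∑ u ∈ Finset.range (t + 1) \ Y, (c u v - σ.r u v) =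
        ∑ v ∈ Y, ∑ u ∈ Finset.range (t + 1) \ Y, c u v := by
      refine Finset.sum_congr rfl fun v hv => Finset.sum_congr rfl fun u hu => ?_
      obtain ⟨hu1, hu2⟩ := Finset.mem_sdiff.1 hu
      have hule := hmem hu1
      have hvle := hmem (hYs hv)
      have hdv : σ.d v < l := (Finset.mem_filter.1 hv).2
      -- An arc that enters `Y` from outside jumps over the gap and descends by at least two, so
      -- validity leaves it no residual capacity.
      have hdu : l < σ.d u := by
        have h5 : ¬ σ.d u < l := fun h' => hu2 (Finset.mem_filter.2 ⟨hu1, h'⟩)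
        have := hl u hule
        omega
      have : ¬ 0 < σ.r u v := fun hr => by
        have := h.d_step u hule v hvle hr
        omega
      have := h.r_nonneg u hule v hvle
      have h6 : σ.r u v = 0 := le_antisymm (not_lt.1 ‹_›) this
      rw [h6, sub_zero]
    rw [← h3, ← h2]
    exact hle
  · rintro ⟨Y, hYs, htY, hle⟩
    have h1 : σ.e t ≤ ∑ v ∈ Y, σ.e v :=
      Finset.single_le_sum (fun v hv => h.e_nonneg v (hmem (hYs hv))) htY
    rw [h.sum_excess hYs] at h1
    refine h1.trans (le_trans ?_ hle)
    gcongr with v hv u hu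
    have := h.r_nonneg u (hmem (Finset.mem_sdiff.1 hu).1) v (hmem (hYs hv))
    linarith

end

end Preflow

/-! ### Programs that only touch the working memory -/

/-- The instruction only assigns to the variables `5, …, 99`, to the arrays from `4` on, to the
weight variables from `3` on and to the weight arrays from `1` on. -/
def Instr.Local : Instr → Prop
  | .set x _ => 5 ≤ x ∧ x < 100
  | .add x _ _ => 5 ≤ x ∧ x < 100
  | .sub x _ _ => 5 ≤ x ∧ x < 100
  | .load x _ _ => 5 ≤ x ∧ x < 100
  | .store a _ _ => 4 ≤ a
  | .wadd x _ _ => 3 ≤ x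
  | .wsub x _ _ => 3 ≤ x
  | .wload x _ _ => 3 ≤ x
  | .wstore a _ _ => 1 ≤ a

/-- All instructions of the program are local. -/
def Stmt.Local : Stmt → Prop
  | .instr c => c.Local
  | .seq S S' => S.Local ∧ S'.Local
  | .ite _ S S' => S.Local ∧ S'.Local
  | .for_ i _ S => (5 ≤ i ∧ i < 100) ∧ S.Local

theorem Instr.Local.avoids {c : Instr} (h : c.Local) {x : ℕ} (hx : x < 5 ∨ 100 ≤ x) :
    c.Avoids x := by
  cases c <;> simp only [Instr.Local, Instr.Avoids] at h ⊢ <;> omega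

theorem Stmt.Local.avoids {x : ℕ} (hx : x < 5 ∨ 100 ≤ x) : ∀ {S : Stmt}, S.Local → S.Avoids x
  | .instr _, h => Instr.Local.avoids h hx
  | .seq _ _, h => ⟨avoids hx h.1, avoids hx h.2⟩
  | .ite _ _ _, h => ⟨avoids hx h.1, avoids hx h.2⟩
  | .for_ i _ _, h => ⟨by have := h.1; omega, avoids hx h.2⟩

/-- The two memories agree outside the working memory. -/
structure Memory.Frame {R : Type} (s s' : Memory R) : Prop where
  num : ∀ x, x < 5 ∨ 100 ≤ x → s'.num x = s.num x
  arr : ∀ a < 4, s'.arr a = s.arr a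
  wt : ∀ x < 3, s'.wt x = s.wt x
  warr : s'.warr 0 = s.warr 0

theorem Memory.Frame.refl {R : Type} (s : Memory R) : s.Frame s :=
  ⟨fun _ _ => rfl, fun _ _ => rfl, fun _ _ => rfl, rfl⟩

theorem Memory.Frame.trans {R : Type} {s s' s'' : Memory R} (h : s.Frame s') (h' : s'.Frame s'') :
    s.Frame s'' :=
  ⟨fun x hx => (h'.num x hx).trans (h.num x hx), fun a ha => (h'.arr a ha).trans (h.arr a ha),
    fun x hx => (h'.wt x hx).trans (h.wt x hx), h'.warr.trans h.warr⟩

theorem Memory.Frame.setNum {R : Type} (s : Memory R) {x : ℕ} (hx : 5 ≤ x ∧ x < 100) (m : ℕ) :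
    s.Frame (s.setNum x m) :=
  ⟨fun y hy => by rw [Memory.setNum_num, if_neg (by omega)], fun _ _ => rfl, fun _ _ => rfl, rfl⟩

theorem Instr.Local.frame {R : Type} [Add R] [Sub R] {c : Instr} (h : c.Local) (s : Memory R) :
    s.Frame (c.exec s) := by
  cases c <;> simp only [Instr.Local] at h <;>
    refine ⟨fun x hx => ?_, fun a ha => ?_, fun x hx => ?_, ?_⟩ <;>
    first | rfl | exact Function.update_of_ne (by omega) _ _

theorem Stmt.Local.frame {R : Type} [Add R] [Sub R] [LE R] :
    ∀ {S : Stmt}, S.Local → ∀ s : Memory R, s.Frame (S.run s)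
  | .instr _, h, s => Instr.Local.frame h s
  | .seq _ _, h, s => (frame h.1 s).trans (frame h.2 _)
  | .ite _ _ _, h, s => by
      rw [Stmt.run]
      split_ifs
      · exact frame h.1 s
      · exact frame h.2 s
  | .for_ i b S, h, s => by
      rw [Stmt.run]
      have key : ∀ (k : ℕ) (s' : Memory R), s'.Frame
          ((fun s' : Memory R => (S.run s').setNum i ((S.run s').num i + 1))^[k] s') := by
        intro k
        induction k with
        | zero => exact fun s' => Memory.Frame.refl s'
        | succ k ih =>
          intro s'
          exact ((frame h.2 s').trans (Memory.Frame.setNum _ h.1 _)).trans (ih _)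
      exact (Memory.Frame.setNum _ h.1 _).trans (key _ _)

/-- The program that does nothing. -/
def Stmt.skip : Stmt := .instr (.set 5 0)

/-- The instance `I`, together with some precomputed constants, is stored in memory. -/
structure WSOCTInstance.Stored {R : Type} [Ring R] [LE R] (I : WSOCTInstance R) (s : Memory R) :
    Prop where
  num0 : s.num 0 = I.n
  num1 : s.num 1 = I.n - 1
  num2 : s.num 2 = 2 * I.n
  num3 : s.num 3 = 1
  arr0 : s.arr 0 = I.input.arr 0
  arr1 : s.arr 1 = I.input.arr 1
  arr2 : ∀ u ≤ 2 * I.n, s.arr 2 u = u * I.n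
  arr3 : ∀ u ≤ 2 * I.n, s.arr 3 u = u * (2 * I.n + 1)
  wt0 : s.wt 0 = I.k
  wt1 : s.wt 1 = 0
  wt2 : s.wt 2 = ∑ v, I.w v
  warr0 : s.warr 0 = I.input.warr 0

/-- The input, the constants, the flag in variable `4` and the tuple from variable `100` on all lie
outside the working memory. Local programs can therefore be composed without tracking what they
leave behind in their scratch space. -/
theorem WSOCTInstance.Stored.frame {R : Type} [Ring R] [LE R] {I : WSOCTInstance R}
    {s s' : Memory R} (h : I.Stored s) (hf : s.Frame s') : I.Stored s' where
  num0 := (hf.num 0 (by omega)).trans h.num0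
  num1 := (hf.num 1 (by omega)).trans h.num1
  num2 := (hf.num 2 (by omega)).trans h.num2
  num3 := (hf.num 3 (by omega)).trans h.num3
  arr0 := (hf.arr 0 (by omega)).trans h.arr0
  arr1 := (hf.arr 1 (by omega)).trans h.arr1
  arr2 := by rw [hf.arr 2 (by omega)]; exact h.arr2
  arr3 := by rw [hf.arr 3 (by omega)]; exact h.arr3
  wt0 := (hf.wt 0 (by omega)).trans h.wt0
  wt1 := (hf.wt 1 (by omega)).trans h.wt1
  wt2 := (hf.wt 2 (by omega)).trans h.wt2
  warr0 := hf.warr.trans h.warr0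

/-! ### Boolean combinations of adjacency tests -/

/-- Boolean combinations of tests on vertices. -/
inductive Cond (ι : Type) where
  | adj (x y : ι)
  | eq (x y : ι)
  | mem (x : ι)
  | tt
  | not (c : Cond ι)
  | and (c d : Cond ι)

/-- The truth of a condition. -/
def Cond.Eval {ι V : Type} (G : SimpleGraph V) (T : Finset V) (ρ : ι → V) : Cond ι → Prop
  | .adj x y => G.Adj (ρ x) (ρ y)
  | .eq x y => ρ x = ρ y
  | .mem x => ρ x ∈ T
  | .tt => True
  | .not c => ¬ c.Eval G T ρ
  | .and c d => c.Eval G T ρ ∧ d.Eval G T ρ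

/-- Branching on a condition, where `f` says in which variables the vertices are stored. -/
def Cond.branch {ι : Type} (f : ι → ℕ) : Cond ι → Stmt → Stmt → Stmt
  | .adj x y, P, Q => .seq (.instr (.load 5 2 (f x))) (.seq (.instr (.add 5 5 (f y)))
      (.seq (.instr (.load 5 0 5)) (.ite (.le 3 5) P Q)))
  | .eq x y, P, Q => .ite (.le (f x) (f y)) (.ite (.le (f y) (f x)) P Q) Q
  | .mem x, P, Q => .seq (.instr (.load 5 1 (f x))) (.ite (.le 3 5) P Q)
  | .tt, P, _ => P
  | .not c, P, Q => c.branch f Q P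
  | .and c d, P, Q => c.branch f (d.branch f P Q) Q

theorem Cond.branch_local {ι : Type} (f : ι → ℕ) {P Q : Stmt} (c : Cond ι) (hP : P.Local)
    (hQ : Q.Local) : (c.branch f P Q).Local := by
  induction c generalizing P Q with
  | not c ih => exact ih hQ hP
  | and c d ihc ihd => exact ihc (ihd hP hQ) hQ
  | tt => exact hP
  | _ => simp [branch, Stmt.Local, Instr.Local, hP, hQ]

theorem Cond.branch_loopsOk {ι : Type} (f : ι → ℕ) {P Q : Stmt} (c : Cond ι) (hP : P.LoopsOk)
    (hQ : Q.LoopsOk) : (c.branch f P Q).LoopsOk := by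
  induction c generalizing P Q with
  | not c ih => exact ih hQ hP
  | and c d ihc ihd => exact ihc (ihd hP hQ) hQ
  | tt => exact hP
  | _ => simp [branch, Stmt.LoopsOk, hP, hQ]

theorem Cond.branch_avoids {ι : Type} (f : ι → ℕ) {x : ℕ} (hx : 5 ≠ x) {P Q : Stmt}
    (c : Cond ι) (hP : P.Avoids x) (hQ : Q.Avoids x) : (c.branch f P Q).Avoids x := by
  induction c generalizing P Q with
  | not c ih => exact ih hQ hP
  | and c d ihc ihd => exact ihc (ihd hP hQ) hQ
  | tt => exact hP
  | _ => simp [branch, Stmt.Avoids, Instr.Avoids, hP, hQ, hx]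

theorem Memory.setNum_setNum {R : Type} (s : Memory R) (x m m' : ℕ) :
    (s.setNum x m).setNum x m' = s.setNum x m' := by
  simp [Memory.setNum]

theorem Memory.setNum_self {R : Type} (s : Memory R) (x : ℕ) : s.setNum x (s.num x) = s := by
  simp [Memory.setNum]

theorem WSOCTInstance.Stored.setNum {R : Type} [Ring R] [LE R] {I : WSOCTInstance R}
    {s : Memory R} (h : I.Stored s) {x : ℕ} (hx : 5 ≤ x ∧ x < 100) (m : ℕ) :
    I.Stored (s.setNum x m) :=
  h.frame (Memory.Frame.setNum s hx m)

theorem WSOCTInstance.input_adj {R : Type} [Semiring R] [LE R] (I : WSOCTInstance R)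
    (u v : Fin I.n) : 1 ≤ I.input.arr 0 (u * I.n + v) ↔ I.G.Adj u v := by
  have : (∃ u' v' : Fin I.n, (u * I.n + v : ℕ) = u' * I.n + v' ∧ I.G.Adj u' v') ↔ I.G.Adj u v := by
    constructor
    · rintro ⟨u', v', he, ha⟩
      have h1 : (v : ℕ) = v' := by
        have := congrArg (· % I.n) he
        simpa [Nat.mod_eq_of_lt] using this
      have h2 : (u : ℕ) = u' := by
        rw [h1] at he
        exact Nat.eq_of_mul_eq_mul_right (by have := u.2; omega) (Nat.add_right_cancel he)
      rwa [Fin.ext h1, Fin.ext h2]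
    · exact fun h => ⟨u, v, rfl, h⟩
  simp only [WSOCTInstance.input, if_true]
  split_ifs with h <;> simp [this.symm, h]

theorem WSOCTInstance.input_mem {R : Type} [Semiring R] [LE R] (I : WSOCTInstance R)
    (v : Fin I.n) : 1 ≤ I.input.arr 1 v ↔ v ∈ I.T := by
  have : (∃ v' ∈ I.T, (v : ℕ) = v') ↔ v ∈ I.T :=
    ⟨fun ⟨v', h, e⟩ => by rwa [Fin.ext e], fun h => ⟨v, h, rfl⟩⟩
  simp only [WSOCTInstance.input, one_ne_zero, if_false, if_true]
  split_ifs with h <;> simp [this.symm, h]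

theorem WSOCTInstance.input_weight {R : Type} [Semiring R] [LE R] (I : WSOCTInstance R)
    (v : Fin I.n) : I.input.warr 0 v = I.w v := by
  simp [WSOCTInstance.input]

-- The tests use only variable `5`, whose final value `z` is left unspecified. By `hf` no vertex is
-- stored there, so the tests of a conjunction can follow one another.
open Classical in
theorem Cond.run_branch {R : Type} [Ring R] [LE R] {I : WSOCTInstance R} {ι : Type} (f : ι → ℕ)
    (hf : ∀ i, f i ≠ 5) (ρ : ι → Fin I.n) (c : Cond ι) : ∀ (P Q : Stmt) (s : Memory R),
    I.Stored s → (∀ i, s.num (f i) = ρ i) →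
      ∃ z, (c.branch f P Q).run s =
        if c.Eval I.G I.T ρ then P.run (s.setNum 5 z) else Q.run (s.setNum 5 z) := by
  induction c with
  | adj x y =>
    intro P Q s hs hρ
    have hx : s.arr 2 (ρ x) = ρ x * I.n := hs.arr2 _ (by have := (ρ x).2; omega)
    refine ⟨I.input.arr 0 (ρ x * I.n + ρ y), ?_⟩
    have h1 := I.input_adj (ρ x) (ρ y)
    simp only [Cond.Eval, ← h1]
    simp only [branch, Stmt.run, Instr.exec, Test.Holds, Memory.setNum]
    simp [hρ, hf, hx, hs.num3, hs.arr0]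
  | eq x y =>
    intro P Q s hs hρ
    refine ⟨s.num 5, ?_⟩
    rw [Memory.setNum_self]
    simp only [branch, Stmt.run, Test.Holds, Cond.Eval, hρ, Fin.ext_iff]
    split_ifs <;> first | rfl | omega
  | mem x =>
    intro P Q s hs hρ
    refine ⟨I.input.arr 1 (ρ x), ?_⟩
    have h1 := I.input_mem (ρ x)
    simp only [Cond.Eval, ← h1]
    simp only [branch, Stmt.run, Instr.exec, Test.Holds, Memory.setNum]
    simp [hρ, hs.num3, hs.arr1]
  | tt =>
    intro P Q s hs hρ
    refine ⟨s.num 5, ?_⟩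
    rw [Memory.setNum_self]
    simp [branch, Cond.Eval]
  | not c ih =>
    intro P Q s hs hρ
    obtain ⟨z, hz⟩ := ih Q P s hs hρ
    refine ⟨z, ?_⟩
    rw [branch, hz]
    by_cases h : c.Eval I.G I.T ρ <;> simp [Cond.Eval, h]
  | and c d ihc ihd =>
    intro P Q s hs hρ
    obtain ⟨z, hz⟩ := ihc (d.branch f P Q) Q s hs hρ
    by_cases h : c.Eval I.G I.T ρ
    · obtain ⟨z', hz'⟩ := ihd P Q (s.setNum 5 z) (hs.setNum (by omega) z)
        (fun i => by rw [Memory.setNum_num, if_neg (hf i), hρ])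
      refine ⟨z', ?_⟩
      rw [branch, hz, if_pos h, hz', Memory.setNum_setNum]
      simp [Cond.Eval, h]
    · refine ⟨z, ?_⟩
      rw [branch, hz, if_neg h]
      simp [Cond.Eval, h]

/-! ### The push-relabel program -/

/-- The preflow `σ` on the nodes `0, …, 2n` is stored in memory. -/
structure Preflow.Stored {R : Type} (n : ℕ) (σ : Preflow R) (s : Memory R) : Prop where
  r : ∀ u ≤ 2 * n, ∀ v ≤ 2 * n, s.warr 1 (u * (2 * n + 1) + v) = σ.r u v
  e : ∀ u ≤ 2 * n, s.warr 2 u = σ.e u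
  d : ∀ u ≤ 2 * n, s.arr 4 u = σ.d u

theorem Preflow.Stored.congr {R : Type} {n : ℕ} {σ : Preflow R} {s s' : Memory R}
    (h : σ.Stored n s) (h1 : s'.warr = s.warr) (h2 : s'.arr = s.arr) : σ.Stored n s' := by
  refine ⟨?_, ?_, ?_⟩
  · rw [h1]; exact h.r
  · rw [h1]; exact h.e
  · rw [h2]; exact h.d

theorem index_inj {N u v x y : ℕ} (hv : v < N) (hy : y < N) :
    x * N + y = u * N + v ↔ x = u ∧ y = v := by
  constructor
  · intro he
    have h1 : y = v := by
      have := congrArg (· % N) he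
      simpa [Nat.mod_eq_of_lt, hv, hy] using this
    refine ⟨?_, h1⟩
    rw [h1] at he
    exact Nat.eq_of_mul_eq_mul_right (by omega) (Nat.add_right_cancel he)
  · rintro ⟨rfl, rfl⟩
    rfl

/-- The program for sending the minimum of weight variables `4` and `5` along the arc at
position `8`, which leads from node `10` to node `11`. -/
def sendStmt : Stmt :=
  .seq (.ite (.wle 4 5) (.instr (.wadd 6 4 1)) (.instr (.wadd 6 5 1))) <|
  .seq (.instr (.wsub 5 5 6)) <| .seq (.instr (.wstore 1 8 5)) <|
  .seq (.instr (.load 9 3 11)) <| .seq (.instr (.add 9 9 10)) <|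
  .seq (.instr (.wload 5 1 9)) <| .seq (.instr (.wadd 5 5 6)) <| .seq (.instr (.wstore 1 9 5)) <|
  .seq (.instr (.wsub 4 4 6)) <| .seq (.instr (.wstore 2 10 4)) <|
  .seq (.instr (.wload 4 2 11)) <| .seq (.instr (.wadd 4 4 6)) (.instr (.wstore 2 11 4))

/-- The program for a push from node `10` to node `11`. -/
def pushStmt : Stmt :=
  .ite (.le 2 10) .skip <|
  .seq (.instr (.wload 4 2 10)) <| .ite (.wle 4 1) .skip <|
  .seq (.instr (.load 6 4 10)) <| .ite (.le 6 2) (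
    .seq (.instr (.load 7 4 11)) <| .seq (.instr (.add 7 7 3)) <|
    .ite (.le 6 7) (.ite (.le 7 6) (
      .seq (.instr (.load 8 3 10)) <| .seq (.instr (.add 8 8 11)) <|
      .seq (.instr (.wload 5 1 8)) <| .ite (.wle 5 1) .skip sendStmt) .skip) .skip) .skip

/-- The program for relabelling node `10`. -/
def relabelStmt : Stmt :=
  .ite (.le 2 10) .skip <|
  .seq (.instr (.wload 4 2 10)) <| .ite (.wle 4 1) .skip <|
  .seq (.instr (.load 6 4 10)) <| .ite (.le 6 2) (
    .seq (.instr (.set 9 0)) <|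
    .seq (.for_ 11 2 (
      .seq (.instr (.load 8 3 10)) <| .seq (.instr (.add 8 8 11)) <|
      .seq (.instr (.wload 5 1 8)) <| .ite (.wle 5 1) .skip <|
      .seq (.instr (.load 7 4 11)) <| .seq (.instr (.add 7 7 3)) <|
      .ite (.le 7 6) (.instr (.set 9 1)) .skip)) <|
    .ite (.le 3 9) .skip (.seq (.instr (.add 6 6 3)) (.instr (.store 4 10 6)))) .skip

/-- The program for one round. -/
def roundStmt : Stmt :=
  .seq (.for_ 10 2 (.for_ 11 2 pushStmt)) (.for_ 10 2 relabelStmt)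

section

variable {R : Type} [Field R] [LinearOrder R] [IsStrictOrderedRing R]

theorem run_sendStmt {I : WSOCTInstance R} {σ : Preflow R} {s : Memory R} {u v : ℕ}
    (hs : I.Stored s) (hσ : σ.Stored I.n s) (hu : u ≤ 2 * I.n) (hv : v ≤ 2 * I.n) (hne : u ≠ v)
    (h10 : s.num 10 = u) (h11 : s.num 11 = v) (h8 : s.num 8 = u * (2 * I.n + 1) + v)
    (h4 : s.wt 4 = σ.e u) (h5 : s.wt 5 = σ.r u v) :
    (σ.send u v (min (σ.e u) (σ.r u v))).Stored I.n (sendStmt.run s) := by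
  have hv3 := hs.arr3 v hv
  have hr' := hσ.r v hv u hu
  have hev := hσ.e v hv
  -- The arc and its reverse occupy different positions, so the second update does not overwrite the
  -- first.
  have hidx : v * (2 * I.n + 1) + u ≠ u * (2 * I.n + 1) + v := by
    rw [Ne, index_inj (by omega) (by omega)]
    exact fun h => hne h.2
  have hmin : ∀ s' : Memory R, s' = (Stmt.ite (.wle 4 5) (.instr (.wadd 6 4 1))
      (.instr (.wadd 6 5 1))).run s →
      s' = { s with wt := Function.update s.wt 6 (min (σ.e u) (σ.r u v)) } := by
    rintro s' rfl
    simp only [Stmt.run, Test.Holds, Instr.exec, h4, h5, hs.wt1, add_zero]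
    split_ifs with h
    · rw [min_eq_left h]
    · rw [min_eq_right (not_le.1 h).le]
  rw [sendStmt, Stmt.run, hmin _ rfl]
  generalize min (σ.e u) (σ.r u v) = δ
  simp only [Stmt.run, Instr.exec]
  refine ⟨fun x hx y hy => ?_, fun x hx => ?_, fun x hx => ?_⟩
  · have hxy := hσ.r x hx y hy
    have e1 := index_inj (x := x) (u := v) (show u < 2 * I.n + 1 by omega)
      (show y < 2 * I.n + 1 by omega)
    have e2 := index_inj (x := x) (u := u) (show v < 2 * I.n + 1 by omega)
      (show y < 2 * I.n + 1 by omega)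
    simp [Function.update_apply, h10, h11, h8, h4, h5, hv3, Preflow.send, hidx, hr', hxy, e1, e2]
    by_cases c1 : x = u ∧ y = v
    · obtain ⟨rfl, rfl⟩ := c1
      simp [hne]
    · by_cases c2 : x = v ∧ y = u
      · obtain ⟨rfl, rfl⟩ := c2
        simp [hne, hne.symm]
      · simp [c1, c2]
  · have hxe := hσ.e x hx
    simp [Function.update_apply, h10, h11, h8, h4, h5, hv3, Preflow.send, hev, hne.symm]
    by_cases c1 : x = u
    · subst c1
      simp [hne]
    · by_cases c2 : x = v
      · subst c2
        simp [c1]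
      · simp [c1, c2, hxe]
  · exact hσ.d x hx

/-- The nested tests go through the clauses of `Preflow.Pushable`. Whenever one fails, the program
skips and the push is the identity by definition. -/
theorem run_pushStmt {I : WSOCTInstance R} {σ : Preflow R} {s : Memory R} {u v : ℕ}
    (hs : I.Stored s) (hσ : σ.Stored I.n s) (hu : u ≤ 2 * I.n) (hv : v ≤ 2 * I.n)
    (h10 : s.num 10 = u) (h11 : s.num 11 = v) :
    (σ.push (2 * I.n) u v).Stored I.n (pushStmt.run s) := by
  have hskip : ∀ s' : Memory R, s'.warr = s.warr → s'.arr = s.arr →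
      ¬ σ.Pushable (2 * I.n) u v → (σ.push (2 * I.n) u v).Stored I.n (Stmt.skip.run s') := by
    intro s' h1 h2 hp
    rw [Preflow.push, if_neg hp]
    exact hσ.congr h1 h2
  have hu3 := hs.arr3 u hu
  have hr := hσ.r u hu v hv
  have heu := hσ.e u hu
  have hdu := hσ.d u hu
  have hdv := hσ.d v hv
  unfold pushStmt
  simp only [Stmt.run, Instr.exec, Test.Holds, Function.update_apply, hs.num2, hs.num3, h10, h11,
    hs.wt1, heu, hdu, hdv, hu3, hr, if_true, if_false, Nat.reduceEqDiff, OfNat.one_ne_ofNat]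
  split_ifs with g1 g2 g3 g4 g5 g6
  · exact hskip _ rfl rfl fun hp => by have := hp.1.1; omega
  · exact hskip _ rfl rfl fun hp => by have := hp.1.2.1; linarith
  · exact hskip _ rfl rfl fun hp => by have := hp.2.2; linarith
  · have hp : σ.Pushable (2 * I.n) u v :=
      ⟨⟨by omega, not_le.1 g2, g3⟩, by omega, not_le.1 g6⟩
    rw [Preflow.push, if_pos hp]
    refine run_sendStmt (hs.frame ⟨fun x hx => ?_, fun _ _ => rfl, fun x hx => ?_, rfl⟩)
      (hσ.congr rfl rfl) hu hv (Preflow.Valid.push_ne hp) ?_ ?_ ?_ ?_ ?_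
    · simp only [Function.update_apply]
      split_ifs <;> omega
    · simp only [Function.update_apply]
      split_ifs <;> first | omega | rfl
    all_goals simp [h10, h11]
  · exact hskip _ rfl rfl fun hp => by have := hp.2.1; omega
  · exact hskip _ rfl rfl fun hp => by have := hp.2.1; omega
  · exact hskip _ rfl rfl fun hp => by have := hp.1.2.2; omega

theorem Stmt.run_seq (S S' : Stmt) (s : Memory R) : (S.seq S').run s = S'.run (S.run s) := by
  rw [Stmt.run]

open Classical in
theorem Stmt.run_ite (t : Test) (S S' : Stmt) (s : Memory R) :
    (Stmt.ite t S S').run s = if t.Holds s then S.run s else S'.run s := by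
  rw [Stmt.run]

/-- Variable `9` records whether a residual arc leads strictly downhill from `u`; for an active node
this is the only obstacle to relabelling. -/
theorem run_relabelStmt {I : WSOCTInstance R} {σ : Preflow R} {s : Memory R} {u : ℕ}
    (hs : I.Stored s) (hσ : σ.Stored I.n s) (hu : u ≤ 2 * I.n) (h10 : s.num 10 = u) :
    (σ.relabel (2 * I.n) u).Stored I.n (relabelStmt.run s) := by
  classical
  have hskip : ∀ s' : Memory R, s'.warr = s.warr → s'.arr = s.arr →
      ¬ σ.Relabelable (2 * I.n) u →
      (σ.relabel (2 * I.n) u).Stored I.n (Stmt.skip.run s') := by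
    intro s' h1 h2 hp
    rw [Preflow.relabel, if_neg hp]
    exact hσ.congr h1 h2
  have heu := hσ.e u hu
  have hdu := hσ.d u hu
  unfold relabelStmt
  rw [Stmt.run]
  split_ifs with g1
  · simp only [Test.Holds, hs.num2, h10] at g1
    exact hskip _ rfl rfl fun hp => by have := hp.1.1; omega
  rw [Stmt.run_seq, Stmt.run_ite]
  split_ifs with g2
  · simp only [Test.Holds, Stmt.run, Instr.exec, Function.update_apply, hs.wt1, h10, heu] at g2
    exact hskip _ rfl rfl fun hp => by have := hp.1.2.1; simp at g2; linarith
  rw [Stmt.run_seq, Stmt.run_ite]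
  split_ifs with g3
  swap
  · simp only [Test.Holds, Stmt.run, Instr.exec, Function.update_apply, hs.num2, h10, hdu] at g3
    exact hskip _ rfl rfl fun hp => by have := hp.1.2.2; simp at g3; omega
  simp [Test.Holds, Stmt.run, Instr.exec, hs.num2, hs.wt1, h10, heu,
    hdu] at g1 g2 g3
  rw [Stmt.run_seq, Stmt.run_seq]
  set L : Stmt := Stmt.seq (.instr (.load 8 3 10)) <| .seq (.instr (.add 8 8 11)) <|
      .seq (.instr (.wload 5 1 8)) <| .ite (.wle 5 1) .skip <|
      .seq (.instr (.load 7 4 11)) <| .seq (.instr (.add 7 7 3)) <|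
      .ite (.le 7 6) (.instr (.set 9 1)) .skip with hL
  set s₀ := (Stmt.instr (.set 9 0)).run ((Stmt.instr (.load 6 4 10)).run
    ((Stmt.instr (.wload 4 2 10)).run s)) with hs₀
  have key := Stmt.for_rule (S := L) (i := 11) (b := 2) (m := 2 * I.n) (s := s₀)
    (by simp [hs₀, Stmt.run, Instr.exec, hs.num2])
    (by simp [hL, Stmt.Avoids, Instr.Avoids, Stmt.skip])
    (fun k s' => I.Stored s' ∧ s'.warr = s.warr ∧ s'.arr = s.arr ∧ s'.num 6 = σ.d u ∧
      s'.num 10 = u ∧ s'.num 9 = if ∃ v < k, 0 < σ.r u v ∧ σ.d v + 1 ≤ σ.d u then 1 else 0)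
    ?_ ?_
  · obtain ⟨k0, k1, k2, k3, k4, k5⟩ := key
    rw [Stmt.run]
    have hiff : (Test.le 3 9).Holds ((Stmt.for_ 11 2 L).run s₀) ↔
        ∃ v < 2 * I.n + 1, 0 < σ.r u v ∧ σ.d v + 1 ≤ σ.d u := by
      simp only [Test.Holds, k5, k0.num3]
      split_ifs with h
      · exact iff_of_true le_rfl h
      · exact iff_of_false (by omega) h
    split_ifs with g4
    · rw [hiff] at g4
      refine hskip _ k1 k2 fun hp => ?_
      obtain ⟨v, hv, hr, hd⟩ := g4
      have := hp.2 v (by omega) hr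
      omega
    · rw [hiff] at g4
      have hp : σ.Relabelable (2 * I.n) u := by
        refine ⟨⟨by omega, g2, g3⟩, fun v hv hr => ?_⟩
        by_contra hlt
        exact g4 ⟨v, by omega, hr, by omega⟩
      rw [Preflow.relabel, if_pos hp]
      have h3 := k0.num3
      generalize (Stmt.for_ 11 2 L).run s₀ = s₁ at *
      refine ⟨fun x hx y hy => ?_, fun x hx => ?_, fun x hx => ?_⟩
      · simpa only [Stmt.run, Instr.exec, k1] using hσ.r x hx y hy
      · simpa only [Stmt.run, Instr.exec, k1] using hσ.e x hx
      · have := hσ.d x hx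
        simp [Stmt.run, Instr.exec, Function.update_apply, k2, k3, k4, h3, this]
  · refine ⟨?_, rfl, rfl, ?_, ?_, ?_⟩
    · refine hs.frame ((Stmt.Local.frame (S := Stmt.seq (.instr (.wload 4 2 10))
        (.seq (.instr (.load 6 4 10)) (.instr (.set 9 0)))) ?_ s).trans
        (Memory.Frame.setNum _ (by omega) _))
      simp [Stmt.Local, Instr.Local]
    all_goals simp [hs₀, Stmt.run, Instr.exec, Memory.setNum_num, h10, hdu]
  · rintro k hk s' h11 ⟨k0, k1, k2, k3, k4, k5⟩
    have hu3 := k0.arr3 u hu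
    have hr := hσ.r u hu k hk
    have hdk := hσ.d k hk
    rw [← k1] at hr
    rw [← k2] at hdk
    have hLl : L.Local := by simp [hL, Stmt.Local, Instr.Local, Stmt.skip]
    have hsplit : (∃ v < k + 1, 0 < σ.r u v ∧ σ.d v + 1 ≤ σ.d u) ↔
        (∃ v < k, 0 < σ.r u v ∧ σ.d v + 1 ≤ σ.d u) ∨ (0 < σ.r u k ∧ σ.d k + 1 ≤ σ.d u) := by
      constructor
      · rintro ⟨v, hv, h⟩
        rcases Nat.lt_succ_iff_lt_or_eq.1 hv with hv | rfl
        · exact Or.inl ⟨v, hv, h⟩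
        · exact Or.inr h
      · rintro (⟨v, hv, h⟩ | h)
        · exact ⟨v, by omega, h⟩
        · exact ⟨k, by omega, h⟩
    have hrun : (L.run s').warr = s.warr ∧ (L.run s').arr = s.arr ∧ (L.run s').num 6 = σ.d u ∧
        (L.run s').num 10 = u ∧ (L.run s').num 9 =
          if ∃ v < k + 1, 0 < σ.r u v ∧ σ.d v + 1 ≤ σ.d u then 1 else 0 := by
      rw [← k1, ← k2, hL]
      simp only [Stmt.run, Instr.exec, Test.Holds, Function.update_apply, k0.num3, k4, h11,
        k0.wt1, k3, hdk, hu3, hr, if_true, if_false, Nat.reduceEqDiff, OfNat.one_ne_ofNat]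
      rw [if_congr hsplit rfl rfl]
      split_ifs with g4 g5 g6 g7 g8 <;>
        simp_all [Stmt.skip, Stmt.run, Instr.exec] <;> grind
    exact ⟨(k0.frame (hLl.frame s')).setNum (by omega) _, hrun.1, hrun.2.1,
      by simp [Memory.setNum_num, hrun.2.2.1], by simp [Memory.setNum_num, hrun.2.2.2.1],
      by simp [Memory.setNum_num, hrun.2.2.2.2]⟩

end

section

variable {R : Type} [Field R] [LinearOrder R] [IsStrictOrderedRing R]

theorem Preflow.Stored.setNum {n : ℕ} {σ : Preflow R} {s : Memory R} (h : σ.Stored n s)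
    (x m : ℕ) : σ.Stored n (s.setNum x m) :=
  h.congr rfl rfl

theorem pushStmt_local : pushStmt.Local := by
  simp [pushStmt, sendStmt, Stmt.skip, Stmt.Local, Instr.Local]

theorem relabelStmt_local : relabelStmt.Local := by
  simp [relabelStmt, Stmt.skip, Stmt.Local, Instr.Local]

theorem roundStmt_local : roundStmt.Local := by
  simp [roundStmt, pushStmt_local, relabelStmt_local, Stmt.Local]

theorem roundStmt_avoids {x : ℕ} (hx : 20 ≤ x) : roundStmt.Avoids x := by
  simp only [roundStmt, pushStmt, sendStmt, relabelStmt, Stmt.skip, Stmt.Avoids, Instr.Avoids,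
    ne_eq, and_true, true_and]
  omega

theorem roundStmt_loopsOk : roundStmt.LoopsOk := by
  simp [roundStmt, pushStmt, sendStmt, relabelStmt, Stmt.skip, Stmt.LoopsOk, Stmt.Avoids,
    Instr.Avoids]

theorem run_roundStmt {I : WSOCTInstance R} {σ : Preflow R} {s : Memory R}
    (hs : I.Stored s) (hσ : σ.Stored I.n s) :
    (σ.round (2 * I.n)).Stored I.n (roundStmt.run s) := by
  have hpush : ∀ (u : ℕ) (τ : Preflow R) (s : Memory R), u ≤ 2 * I.n → I.Stored s →
      s.num 10 = u → τ.Stored I.n s →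
      (Preflow.foldUpTo (fun v => Preflow.push (2 * I.n) u v) (2 * I.n + 1) τ).Stored I.n
        ((Stmt.for_ 11 2 pushStmt).run s) := by
    intro u τ s hu hs h10 hτ
    refine (Stmt.for_rule (m := 2 * I.n) hs.num2
      (by simp [pushStmt, sendStmt, Stmt.skip, Stmt.Avoids, Instr.Avoids])
      (fun k s' => I.Stored s' ∧ s'.num 10 = u ∧
        (Preflow.foldUpTo (fun v => Preflow.push (2 * I.n) u v) k τ).Stored I.n s')
      ⟨hs.setNum (by omega) _, by simpa [Memory.setNum_num] using h10, hτ.setNum _ _⟩ ?_).2.2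
    rintro k hk s' h11 ⟨h1, h2, h3⟩
    refine ⟨(h1.frame (pushStmt_local.frame s')).setNum (by omega) _, ?_,
      (run_pushStmt h1 h3 hu hk h2 h11).setNum _ _⟩
    rw [Memory.setNum_num, if_neg (by omega), Stmt.Avoids.run_num _ s', h2]
    simp [pushStmt, sendStmt, Stmt.skip, Stmt.Avoids, Instr.Avoids]
  rw [roundStmt, Stmt.run_seq]
  have h1 := Stmt.for_rule (S := .for_ 11 2 pushStmt) (i := 10) (m := 2 * I.n) hs.num2
    (by simp [pushStmt, sendStmt, Stmt.skip, Stmt.Avoids, Instr.Avoids])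
    (fun k s' => I.Stored s' ∧ (Preflow.foldUpTo
      (fun u => Preflow.foldUpTo (fun v => Preflow.push (2 * I.n) u v) (2 * I.n + 1)) k σ).Stored
        I.n s')
    ⟨hs.setNum (by omega) _, hσ.setNum _ _⟩
    (fun k hk s' h10 h => ⟨(h.1.frame (Stmt.Local.frame
      (by simp [Stmt.Local, pushStmt_local]) s')).setNum (by omega) _,
      (hpush k _ s' hk h.1 h10 h.2).setNum _ _⟩)
  exact (Stmt.for_rule (S := relabelStmt) (i := 10) (m := 2 * I.n) h1.1.num2
    (by simp [relabelStmt, Stmt.skip, Stmt.Avoids, Instr.Avoids])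
    (fun k s' => I.Stored s' ∧ (Preflow.foldUpTo (fun u => Preflow.relabel (2 * I.n) u) k
      (Preflow.foldUpTo (fun u => Preflow.foldUpTo (fun v => Preflow.push (2 * I.n) u v)
        (2 * I.n + 1)) (2 * I.n + 1) σ)).Stored I.n s')
    ⟨h1.1.setNum (by omega) _, h1.2.setNum _ _⟩
    (fun k hk s' h10 h => ⟨(h.1.frame (relabelStmt_local.frame s')).setNum (by omega) _,
      (run_relabelStmt h.1 h.2 hk h10).setNum _ _⟩)).2

/-- Repeating a program `(2n + 1) ^ j` times. -/
def repeatStmt (S : Stmt) : ℕ → Stmt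
  | 0 => S
  | j + 1 => .for_ (20 + j) 2 (repeatStmt S j)

theorem repeatStmt_avoids {S : Stmt} {x : ℕ} (h : S.Avoids x) :
    ∀ {j : ℕ}, (x < 20 ∨ 20 + j ≤ x) → (repeatStmt S j).Avoids x
  | 0, _ => h
  | j + 1, hx => ⟨by omega, repeatStmt_avoids h (by omega)⟩

theorem repeatStmt_local {S : Stmt} (h : S.Local) : ∀ {j : ℕ}, j ≤ 80 → (repeatStmt S j).Local
  | 0, _ => h
  | _ + 1, hj => ⟨by omega, repeatStmt_local h (by omega)⟩

theorem repeatStmt_loopsOk {S : Stmt} (h : S.LoopsOk) (ha : ∀ x, 20 ≤ x → S.Avoids x) :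
    ∀ j : ℕ, (repeatStmt S j).LoopsOk
  | 0 => h
  | j + 1 => ⟨Or.inr rfl, repeatStmt_avoids (ha _ (by omega)) (by omega),
      repeatStmt_loopsOk h ha j⟩

theorem run_repeatStmt {I : WSOCTInstance R} : ∀ (j : ℕ), j ≤ 80 → ∀ {σ : Preflow R}
    {s : Memory R}, I.Stored s → σ.Stored I.n s →
    ((Preflow.round (2 * I.n))^[(2 * I.n + 1) ^ j] σ).Stored I.n
      ((repeatStmt roundStmt j).run s)
  | 0, _, σ, s, hs, hσ => by simpa [repeatStmt] using run_roundStmt hs hσ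
  | j + 1, hj, σ, s, hs, hσ => by
      have := (Stmt.for_rule (S := repeatStmt roundStmt j) (i := 20 + j) (m := 2 * I.n) hs.num2
        (repeatStmt_avoids (roundStmt_avoids (by omega)) (by omega))
        (fun k s' => I.Stored s' ∧
          ((Preflow.round (2 * I.n))^[k * (2 * I.n + 1) ^ j] σ).Stored I.n s')
        ⟨hs.setNum (by omega) _, by simpa using hσ.setNum _ _⟩
        (fun k hk s' _ h => ⟨(h.1.frame ((repeatStmt_local roundStmt_local (by omega)).frame
          s')).setNum (by omega) _, by
          rw [add_mul, one_mul, add_comm, Function.iterate_add_apply]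
          exact (run_repeatStmt j (by omega) h.1 h.2).setNum _ _⟩)).2
      -- Each further loop makes `2n + 1` iterations, so seven nested loops give exactly the `(t +
      -- 1) ^ 7` rounds for the sink `t = 2n`.
      rw [pow_succ, mul_comm ((2 * I.n + 1) ^ j)]
      exact this

/-! ### Bipartite networks -/

open Classical in
/-- The initial excesses of the network for sets `A₁` and `A₂` of vertices. -/
noncomputable def netExcess {n : ℕ} (w : Fin n → R) (A₁ : Fin n → Prop) (u : ℕ) : R :=
  if hu : u < n then if A₁ ⟨u, hu⟩ then w ⟨u, hu⟩ else 0 else 0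

open Classical in
/-- The capacities of the network for sets `A₁` and `A₂` of vertices and a relation between
them. -/
noncomputable def netCap {n : ℕ} (w : Fin n → R) (A₁ A₂ : Fin n → Prop)
    (rel : Fin n → Fin n → Prop) (u v : ℕ) : R :=
  if hu : u < n then
    if hv : n ≤ v ∧ v < 2 * n then
      if A₁ ⟨u, hu⟩ ∧ A₂ ⟨v - n, by omega⟩ ∧ rel ⟨u, hu⟩ ⟨v - n, by omega⟩ then ∑ x, w x else 0
    else 0
  else if huv : v = 2 * n ∧ u < 2 * n then
    if A₂ ⟨u - n, by omega⟩ then w ⟨u - n, by omega⟩ else 0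
  else 0

theorem netExcess_nonneg {n : ℕ} {w : Fin n → R} (hw : ∀ v, 0 ≤ w v) (A₁ : Fin n → Prop)
    (u : ℕ) : 0 ≤ netExcess w A₁ u := by
  unfold netExcess
  split_ifs <;> first | exact hw _ | exact le_rfl

theorem netCap_nonneg {n : ℕ} {w : Fin n → R} (hw : ∀ v, 0 ≤ w v) (A₁ A₂ : Fin n → Prop)
    (rel : Fin n → Fin n → Prop) (u v : ℕ) : 0 ≤ netCap w A₁ A₂ rel u v := by
  unfold netCap
  split_ifs <;> first | exact hw _ | exact le_rfl | exact Finset.sum_nonneg fun x _ => hw x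

-- Each vertex has a left copy `u` and a right copy `n + v`, and `2n` is the sink. The excesses on
-- the left stand for saturated arcs from a source, which is not represented. In a cut with sink
-- side `Y`, the vertices kept are those of `A₁` outside `Y` and those of `A₂` inside `Y`. Arcs for
-- related pairs have the total weight as capacity, which makes them too expensive to be worth
-- cutting.
open Classical in
theorem exists_cut_iff {n : ℕ} {w : Fin n → R} (hw : ∀ v, 0 ≤ w v) (A₁ A₂ : Fin n → Prop)
    (rel : Fin n → Fin n → Prop) (θ : R) :
    (∃ Y ⊆ Finset.range (2 * n + 1), 2 * n ∈ Y ∧ ∑ v ∈ Y, netExcess w A₁ v +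
      ∑ v ∈ Y, ∑ u ∈ Finset.range (2 * n + 1) \ Y, netCap w A₁ A₂ rel u v ≤ θ) ↔
    ∃ K₁ K₂ : Finset (Fin n), (∀ u ∈ K₁, A₁ u) ∧ (∀ v ∈ K₂, A₂ v) ∧
      (∀ u ∈ K₁, ∀ v ∈ K₂, ¬ rel u v) ∧
      ∑ v with A₁ v ∧ v ∉ K₁, w v + ∑ v with A₂ v ∧ v ∉ K₂, w v ≤ θ := by
  set N := Finset.range (2 * n + 1) with hN
  have hc := netCap_nonneg hw A₁ A₂ rel
  have hb := netExcess_nonneg hw A₁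
  have hL : ∀ f : ℕ → R, ∑ v ∈ N, f v =
      ∑ v : Fin n, f v + ∑ v : Fin n, f (n + v) + f (2 * n) := by
    intro f
    rw [hN, Finset.sum_range_succ, two_mul, Finset.sum_range_add, Finset.sum_range,
      Finset.sum_range]
  have hsplit : ∀ (Y : Finset ℕ), Y ⊆ N → ∀ f : ℕ → R,
      ∑ v ∈ Y, f v = ∑ v : Fin n, (if (v : ℕ) ∈ Y then f v else 0) +
        ∑ v : Fin n, (if n + (v : ℕ) ∈ Y then f (n + v) else 0) +
        (if 2 * n ∈ Y then f (2 * n) else 0) := by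
    intro Y hY f
    rw [← hL fun v => if v ∈ Y then f v else 0, ← Finset.sum_filter,
      Finset.filter_mem_eq_inter, Finset.inter_eq_right.2 hY]
  have hsplit' : ∀ (Y : Finset ℕ), Y ⊆ N → ∀ f : ℕ → R,
      ∑ v ∈ N \ Y, f v = ∑ v : Fin n, (if (v : ℕ) ∉ Y then f v else 0) +
        ∑ v : Fin n, (if n + (v : ℕ) ∉ Y then f (n + v) else 0) +
        (if 2 * n ∉ Y then f (2 * n) else 0) := by
    intro Y hY f
    rw [← hL fun v => if v ∉ Y then f v else 0, ← Finset.sum_filter, Finset.sdiff_eq_filter]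
  have hcap1 : ∀ (u : ℕ) (v : Fin n), netCap w A₁ A₂ rel u v = 0 := by
    intro u v
    have := v.2
    unfold netCap
    split_ifs <;> first | omega | rfl
  have hcap2 : ∀ (u v : Fin n), netCap w A₁ A₂ rel u (n + v) =
      if A₁ u ∧ A₂ v ∧ rel u v then ∑ x, w x else 0 := by
    intro u v
    have := v.2
    have := u.2
    unfold netCap
    rw [dif_pos u.2, dif_pos (by omega)]
    simp
  have hcap3 : ∀ (u : ℕ) (v : Fin n), netCap w A₁ A₂ rel (n + u) (n + v) = 0 := by
    intro u v
    have := v.2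
    unfold netCap
    rw [dif_neg (by omega), dif_neg (by omega)]
  have hcap4 : ∀ (u : Fin n), netCap w A₁ A₂ rel u (2 * n) = 0 := by
    intro u
    unfold netCap
    rw [dif_pos u.2, dif_neg (by omega)]
  have hcap5 : ∀ (u : Fin n), netCap w A₁ A₂ rel (n + u) (2 * n) = if A₂ u then w u else 0 := by
    intro u
    have := u.2
    unfold netCap
    rw [dif_neg (by omega), dif_pos (by omega)]
    simp
  have hex1 : ∀ (u : Fin n), netExcess w A₁ u = if A₁ u then w u else 0 := by
    intro u
    unfold netExcess
    rw [dif_pos u.2]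
  have hex2 : ∀ (u : ℕ), netExcess w A₁ (n + u) = 0 := by
    intro u
    unfold netExcess
    rw [dif_neg (by omega)]
  have hex3 : netExcess w A₁ (2 * n) = 0 := by
    rw [two_mul]
    exact hex2 n
  -- The three surviving terms are the discarded vertices of `A₁`, the related pairs that are cut,
  -- and the discarded vertices of `A₂`.
  have value : ∀ Y ⊆ N, 2 * n ∈ Y → ∑ v ∈ Y, netExcess w A₁ v +
      ∑ v ∈ Y, ∑ u ∈ N \ Y, netCap w A₁ A₂ rel u v =
      ∑ v : Fin n, (if (v : ℕ) ∈ Y then if A₁ v then w v else 0 else 0) +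
      (∑ v : Fin n, (if n + (v : ℕ) ∈ Y then ∑ u : Fin n, (if (u : ℕ) ∉ Y then
          if A₁ u ∧ A₂ v ∧ rel u v then ∑ x, w x else 0 else 0) else 0) +
        ∑ v : Fin n, (if n + (v : ℕ) ∉ Y then if A₂ v then w v else 0 else 0)) := by
    intro Y hY ht
    rw [hsplit Y hY, hsplit Y hY]
    simp only [hsplit' Y hY, hex1, hex2, hex3, hcap1, hcap2, hcap3, hcap4, hcap5, ite_self,
      Finset.sum_const_zero, if_pos ht, if_false, add_zero, zero_add,
      show ¬ ¬ (2 * n ∈ Y) from not_not.2 ht]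
  constructor
  · rintro ⟨Y, hY, ht, hle⟩
    rw [value Y hY ht] at hle
    -- A single related pair that is cut already costs the total weight. Keeping all of `A₂` and
    -- nothing of `A₁` is then no worse.
    by_cases hcross : ∃ u v : Fin n, (u : ℕ) ∉ Y ∧ n + (v : ℕ) ∈ Y ∧ A₁ u ∧ A₂ v ∧ rel u v
    · obtain ⟨u, v, hu, hv, h⟩ := hcross
      refine ⟨∅, Finset.univ.filter A₂, by simp, by simp, by simp, ?_⟩
      have h1 : ∑ x, w x ≤ ∑ v : Fin n, (if n + (v : ℕ) ∈ Y then ∑ u : Fin n,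
          (if (u : ℕ) ∉ Y then if A₁ u ∧ A₂ v ∧ rel u v then ∑ x, w x else 0 else 0) else 0) := by
        have hW : 0 ≤ ∑ x, w x := Finset.sum_nonneg fun x _ => hw x
        have hin : ∑ x, w x ≤ ∑ u : Fin n,
            (if (u : ℕ) ∉ Y then if A₁ u ∧ A₂ v ∧ rel u v then ∑ x, w x else 0 else 0) := by
          refine le_trans ?_ (Finset.single_le_sum (f := fun u : Fin n => (if (u : ℕ) ∉ Y then
            if A₁ u ∧ A₂ v ∧ rel u v then ∑ x, w x else 0 else 0)) (fun x _ => ?_)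
            (Finset.mem_univ u))
          · rw [if_pos hu, if_pos h]
          · split_ifs <;> first | exact hW | exact le_rfl
        refine le_trans ?_ (Finset.single_le_sum (f := fun v : Fin n => (if n + (v : ℕ) ∈ Y then
          ∑ u : Fin n, (if (u : ℕ) ∉ Y then if A₁ u ∧ A₂ v ∧ rel u v then ∑ x, w x else 0
            else 0) else 0)) (fun x _ => ?_) (Finset.mem_univ v))
        · rw [if_pos hv]
          exact hin
        · split_ifs
          · refine Finset.sum_nonneg fun y _ => ?_
            split_ifs <;> first | exact hW | exact le_rfl
          · exact le_rfl
      have h2 : 0 ≤ ∑ v : Fin n, (if (v : ℕ) ∈ Y then if A₁ v then w v else 0 else 0) := by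
        refine Finset.sum_nonneg fun y _ => ?_
        split_ifs <;> first | exact hw _ | exact le_rfl
      have h3 : 0 ≤ ∑ v : Fin n, (if n + (v : ℕ) ∉ Y then if A₂ v then w v else 0 else 0) := by
        refine Finset.sum_nonneg fun y _ => ?_
        split_ifs <;> first | exact hw _ | exact le_rfl
      have h4 : ∑ v with A₁ v ∧ v ∉ (∅ : Finset (Fin n)), w v ≤ ∑ x, w x :=
        Finset.sum_le_sum_of_subset_of_nonneg (Finset.filter_subset _ _) fun x _ _ => hw x
      have h5 : ∑ v with A₂ v ∧ v ∉ Finset.univ.filter A₂, w v = 0 := by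
        rw [Finset.filter_false_of_mem, Finset.sum_empty]
        simp
      linarith
    · refine ⟨Finset.univ.filter fun u => A₁ u ∧ (u : ℕ) ∉ Y,
        Finset.univ.filter fun v => A₂ v ∧ n + (v : ℕ) ∈ Y, by simp +contextual,
        by simp +contextual, ?_, ?_⟩
      · intro u hu v hv hr
        simp only [Finset.mem_filter, Finset.mem_univ, true_and] at hu hv
        exact hcross ⟨u, v, hu.2, hv.2, hu.1, hv.1, hr⟩
      · have h1 : 0 ≤ ∑ v : Fin n, (if n + (v : ℕ) ∈ Y then ∑ u : Fin n,
            (if (u : ℕ) ∉ Y then if A₁ u ∧ A₂ v ∧ rel u v then ∑ x, w x else 0 else 0)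
              else 0) := by
          have hW : 0 ≤ ∑ x, w x := Finset.sum_nonneg fun x _ => hw x
          refine Finset.sum_nonneg fun y _ => ?_
          split_ifs
          · refine Finset.sum_nonneg fun y _ => ?_
            split_ifs <;> first | exact hW | exact le_rfl
          · exact le_rfl
        have h2 : ∑ v with A₁ v ∧ v ∉ Finset.univ.filter (fun u : Fin n => A₁ u ∧ (u : ℕ) ∉ Y),
            w v = ∑ v : Fin n, (if (v : ℕ) ∈ Y then if A₁ v then w v else 0 else 0) := by
          rw [Finset.sum_filter]
          refine Finset.sum_congr rfl fun v _ => ?_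
          by_cases a : A₁ v <;> by_cases b : (v : ℕ) ∈ Y <;> simp [a, b]
        have h3 : ∑ v with A₂ v ∧ v ∉ Finset.univ.filter (fun v : Fin n => A₂ v ∧ n + (v : ℕ) ∈ Y),
            w v = ∑ v : Fin n, (if n + (v : ℕ) ∉ Y then if A₂ v then w v else 0 else 0) := by
          rw [Finset.sum_filter]
          refine Finset.sum_congr rfl fun v _ => ?_
          by_cases a : A₂ v <;> by_cases b : n + (v : ℕ) ∈ Y <;> simp [a, b]
        rw [h2, h3]
        linarith
  · rintro ⟨K₁, K₂, h1, h2, h3, hle⟩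
    -- The sink side has to contain the left copies that are not kept, the right copies that are
    -- kept, and the sink, which satisfies both conditions vacuously.
    set Y : Finset ℕ := N.filter fun x => (∀ u : Fin n, x = u → u ∉ K₁) ∧
      (∀ v : Fin n, x = n + v → v ∈ K₂) with hY
    have hYl : ∀ u : Fin n, (u : ℕ) ∈ Y ↔ u ∉ K₁ := by
      intro u
      have hu := u.2
      simp only [hY, hN, Finset.mem_filter, Finset.mem_range]
      constructor
      · exact fun h => h.2.1 u rfl
      · refine fun h => ⟨by omega, fun u' e => ?_, fun v e => by omega⟩
        rwa [← Fin.ext e]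
    have hYr : ∀ v : Fin n, n + (v : ℕ) ∈ Y ↔ v ∈ K₂ := by
      intro v
      have hv := v.2
      simp only [hY, hN, Finset.mem_filter, Finset.mem_range]
      constructor
      · exact fun h => h.2.2 v rfl
      · refine fun h => ⟨by omega, fun u' e => by have := u'.2; omega, fun v' e => ?_⟩
        rwa [← Fin.ext (by omega : (v : ℕ) = v')]
    have hYt : 2 * n ∈ Y := by
      simp only [hY, hN, Finset.mem_filter, Finset.mem_range]
      exact ⟨by omega, fun u e => by have := u.2; omega, fun v e => by have := v.2; omega⟩
    refine ⟨Y, Finset.filter_subset _ _, hYt, ?_⟩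
    rw [value Y (Finset.filter_subset _ _) hYt]
    simp only [hYl, hYr]
    have e1 : ∑ v : Fin n, (if v ∈ K₂ then ∑ u : Fin n, (if ¬ u ∉ K₁ then
          if A₁ u ∧ A₂ v ∧ rel u v then ∑ x, w x else 0 else 0) else 0) = 0 := by
      refine Finset.sum_eq_zero fun v _ => ?_
      split_ifs with hv
      · refine Finset.sum_eq_zero fun u _ => ?_
        by_cases hu : u ∈ K₁
        · rw [if_pos (not_not.2 hu), if_neg fun hr => h3 u hu v hv hr.2.2]
        · rw [if_neg (not_not.2 hu)]
      · rfl
    have e2 : ∑ v with A₁ v ∧ v ∉ K₁, w v =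
        ∑ v : Fin n, (if v ∉ K₁ then if A₁ v then w v else 0 else 0) := by
      rw [Finset.sum_filter]
      refine Finset.sum_congr rfl fun v _ => ?_
      by_cases a : A₁ v <;> by_cases b : v ∈ K₁ <;> simp [a, b]
    have e3 : ∑ v with A₂ v ∧ v ∉ K₂, w v =
        ∑ v : Fin n, (if v ∉ K₂ then if A₂ v then w v else 0 else 0) := by
      rw [Finset.sum_filter]
      refine Finset.sum_congr rfl fun v _ => ?_
      by_cases a : A₂ v <;> by_cases b : v ∈ K₂ <;> simp [a, b]
    rw [e1, ← e2, ← e3]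
    linarith

end

/-! ### Schemes -/

/-- The conjunction of a list of conditions. -/
def Cond.all {ι : Type} : List (Cond ι) → Cond ι
  | [] => .tt
  | c :: l => .and c (all l)

theorem Cond.eval_all {ι V : Type} (G : SimpleGraph V) (T : Finset V) (ρ : ι → V) :
    ∀ l : List (Cond ι), (Cond.all l).Eval G T ρ ↔ ∀ c ∈ l, c.Eval G T ρ
  | [] => by simp [Cond.all, Cond.Eval]
  | c :: l => by simp [Cond.all, Cond.Eval, eval_all G T ρ l]

/-- A scheme for candidate solutions that consist of `c` vertices, of a subset of the vertices
that satisfy `A₁`, and of a subset of the vertices that satisfy `A₂`. -/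
structure Scheme (c : ℕ) where
  pat : Cond (Fin c)
  A₁ : Cond (Option (Fin c))
  A₂ : Cond (Option (Fin c))
  cut : Bool

/-- The position of a vertex and of the vertices of a tuple. -/
def regs {c : ℕ} (x : ℕ) (o : Option (Fin c)) : ℕ := o.elim x fun j => 100 + (j : ℕ)

/-- The condition that no chosen vertices may satisfy. -/
def Scheme.relCond {c : ℕ} (L : Scheme c) : Cond Bool :=
  if L.cut then .not (.and (.not (.eq false true)) (.not (.adj false true))) else .eq false true

/-- The vertex is in the tuple. -/
def tupleCond (c : ℕ) : Cond (Option (Fin c)) :=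
  .not (Cond.all ((List.finRange c).map fun j => .not (.eq none (some j))))

theorem eval_tupleCond {V : Type} {c : ℕ} (G : SimpleGraph V) (T : Finset V)
    (ρ : Option (Fin c) → V) : (tupleCond c).Eval G T ρ ↔ ∃ j, ρ none = ρ (some j) := by
  simp [tupleCond, Cond.Eval, Cond.eval_all]

/-- `v` satisfies the condition `A` relative to the tuple `a`. -/
def Cond.At {V : Type} {c : ℕ} (A : Cond (Option (Fin c))) (G : SimpleGraph V) (T : Finset V)
    (a : Fin c → V) (v : V) : Prop :=
  A.Eval G T fun o => o.elim v a

/-- Vertices that must not both be chosen. -/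
def Scheme.Rel {V : Type} {c : ℕ} (L : Scheme c) (G : SimpleGraph V) (u v : V) : Prop :=
  u = v ∨ (L.cut = true ∧ G.Adj u v)

/-- Equality is part of the forbidden relation, which forces the two chosen sets to be disjoint;
adjacency is added only for schemes with the flag `cut`. -/
theorem Scheme.eval_relCond {V : Type} {c : ℕ} (L : Scheme c) (G : SimpleGraph V) (T : Finset V)
    (u v : V) : L.relCond.Eval G T (fun b => if b then v else u) ↔ L.Rel G u v := by
  unfold relCond Rel
  by_cases h : L.cut = true
  · simp [h, Cond.Eval]
    tauto
  · simp [h, Cond.Eval]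

/-- The program that stores the initial excesses and labels. -/
def Scheme.excessStmt {c : ℕ} (L : Scheme c) : Stmt :=
  .for_ 10 2 <| .seq (.instr (.wadd 4 1 1)) <|
    .seq (.ite (.le 10 1) (L.A₁.branch (regs 10) (.instr (.wload 4 0 10)) .skip) .skip) <|
    .seq (.instr (.wstore 2 10 4)) <| .seq (.instr (.set 6 0)) (.instr (.store 4 10 6))

/-- The program that computes the capacity from node `10` to node `11`. -/
def Scheme.cellStmt {c : ℕ} (L : Scheme c) : Stmt :=
  .seq (.instr (.wadd 4 1 1)) <| .ite (.le 10 1)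
    (.ite (.le 0 11) (.ite (.le 2 11) .skip <| .seq (.instr (.sub 12 11 0)) <|
      L.A₁.branch (regs 10) (L.A₂.branch (regs 12) (L.relCond.branch (fun b => if b then 12 else 10)
        (.instr (.wadd 4 2 1)) .skip) .skip) .skip) .skip)
    (.ite (.le 2 11) (.ite (.le 2 10) .skip <| .seq (.instr (.sub 12 10 0)) <|
      L.A₂.branch (regs 12) (.instr (.wload 4 0 12)) .skip) .skip)

/-- The program that stores the capacities. -/
def Scheme.capStmt {c : ℕ} (L : Scheme c) : Stmt :=
  .for_ 10 2 <| .for_ 11 2 <| .seq L.cellStmt <| .seq (.instr (.load 6 3 10)) <|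
    .seq (.instr (.add 6 6 11)) (.instr (.wstore 1 6 4))

/-- The program that computes the bound for the capacity of a cut. -/
def Scheme.boundStmt {c : ℕ} (L : Scheme c) : Stmt :=
  .seq (.instr (.wadd 3 0 1)) <| .for_ 10 1 <| .seq (.instr (.wload 4 0 10)) <|
    .seq (.instr (.wsub 3 3 4)) <|
    .seq ((tupleCond c).branch (regs 10) (.instr (.wadd 3 3 4)) .skip) <|
    .seq (L.A₁.branch (regs 10) (.instr (.wadd 3 3 4)) .skip)
      (L.A₂.branch (regs 10) (.instr (.wadd 3 3 4)) .skip)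

/-- The program that computes a minimum cut and the bound. -/
def Scheme.cutStmt {c : ℕ} (L : Scheme c) : Stmt :=
  .seq L.excessStmt <| .seq L.capStmt <| .seq (repeatStmt roundStmt 7) <|
    .seq L.boundStmt (.instr (.wload 4 2 2))

/-- The program that tests the scheme for one tuple. -/
def Scheme.testStmt {c : ℕ} (L : Scheme c) : Stmt :=
  L.pat.branch (fun j : Fin c => 100 + (j : ℕ))
    (.seq L.cutStmt (.ite (.wle 4 3) (.instr (.set 4 1)) .skip)) .skip

/-- Loops over the first `j` entries of the tuple. -/
def nestStmt (S : Stmt) : ℕ → Stmt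
  | 0 => S
  | j + 1 => .for_ (100 + j) 1 (nestStmt S j)

theorem regs_ne {c x y : ℕ} (h : x ≠ y) (hy : y < 100) (o : Option (Fin c)) : regs x o ≠ y := by
  cases o with
  | none => exact h
  | some j =>
    simp only [regs, Option.elim]
    omega

theorem Stmt.skip_local : Stmt.skip.Local := by simp [skip, Local, Instr.Local]

theorem Stmt.skip_avoids {x : ℕ} (hx : 5 ≠ x) : Stmt.skip.Avoids x := hx

section

variable {c : ℕ} (L : Scheme c)

theorem Scheme.excessStmt_local : L.excessStmt.Local := by
  refine ⟨by omega, ?_, ⟨?_, Stmt.skip_local⟩, ?_, ?_, ?_⟩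
  · simp [Stmt.Local, Instr.Local]
  · exact Cond.branch_local _ _ (by simp [Stmt.Local, Instr.Local]) Stmt.skip_local
  all_goals simp [Stmt.Local, Instr.Local]

theorem Scheme.cellStmt_local : L.cellStmt.Local := by
  refine ⟨?_, ⟨⟨Stmt.skip_local, ?_, Cond.branch_local _ _ (Cond.branch_local _ _
    (Cond.branch_local _ _ ?_ Stmt.skip_local) Stmt.skip_local) Stmt.skip_local⟩,
    Stmt.skip_local⟩, ⟨Stmt.skip_local, ?_, Cond.branch_local _ _ ?_ Stmt.skip_local⟩,
    Stmt.skip_local⟩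
  all_goals simp [Stmt.Local, Instr.Local]

theorem Scheme.cellStmt_avoids {x : ℕ} (h : 5 ≠ x) (h' : 12 ≠ x) : L.cellStmt.Avoids x := by
  refine ⟨?_, ⟨⟨Stmt.skip_avoids h, ?_, Cond.branch_avoids _ h _ (Cond.branch_avoids _ h _
    (Cond.branch_avoids _ h _ ?_ (Stmt.skip_avoids h)) (Stmt.skip_avoids h))
    (Stmt.skip_avoids h)⟩, Stmt.skip_avoids h⟩, ⟨Stmt.skip_avoids h, ?_,
    Cond.branch_avoids _ h _ ?_ (Stmt.skip_avoids h)⟩, Stmt.skip_avoids h⟩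
  all_goals simp [Stmt.Avoids, Instr.Avoids, h']

theorem Scheme.cellStmt_loopsOk : L.cellStmt.LoopsOk := by
  refine ⟨trivial, ⟨⟨trivial, trivial, Cond.branch_loopsOk _ _ (Cond.branch_loopsOk _ _
    (Cond.branch_loopsOk _ _ trivial trivial) trivial) trivial⟩,
    trivial⟩, ⟨trivial, trivial, Cond.branch_loopsOk _ _ trivial trivial⟩, trivial⟩

theorem Scheme.capStmt_local : L.capStmt.Local := by
  simp [capStmt, Stmt.Local, Instr.Local, L.cellStmt_local]

theorem Scheme.boundStmt_local : L.boundStmt.Local := by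
  refine ⟨?_, by omega, ?_, ?_, Cond.branch_local _ _ ?_ Stmt.skip_local,
    Cond.branch_local _ _ ?_ Stmt.skip_local, Cond.branch_local _ _ ?_ Stmt.skip_local⟩
  all_goals simp [Stmt.Local, Instr.Local]

theorem Scheme.cutStmt_local : L.cutStmt.Local :=
  ⟨L.excessStmt_local, L.capStmt_local, repeatStmt_local roundStmt_local (by omega),
    L.boundStmt_local, by simp [Stmt.Local, Instr.Local]⟩

theorem Scheme.testStmt_avoids {x : ℕ} (hx : x < 4 ∨ 100 ≤ x) : L.testStmt.Avoids x := by
  have h : 5 ≠ x := by omega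
  refine Cond.branch_avoids _ h _ ⟨L.cutStmt_local.avoids (by omega), ?_, Stmt.skip_avoids h⟩
    (Stmt.skip_avoids h)
  simp only [Stmt.Avoids, Instr.Avoids]
  omega

theorem Scheme.testStmt_loopsOk : L.testStmt.LoopsOk := by
  refine Cond.branch_loopsOk _ _ ⟨⟨⟨Or.inr rfl, ?_, trivial, ⟨Cond.branch_loopsOk _ _ trivial
    trivial, trivial⟩, trivial, trivial, trivial⟩, ⟨Or.inr rfl, ?_, Or.inr rfl, ?_,
    L.cellStmt_loopsOk, trivial, trivial, trivial⟩, repeatStmt_loopsOk roundStmt_loopsOk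
    (fun x hx => roundStmt_avoids hx) 7, ⟨trivial, Or.inl rfl, ?_, trivial, trivial,
    Cond.branch_loopsOk _ _ trivial trivial, Cond.branch_loopsOk _ _ trivial trivial,
    Cond.branch_loopsOk _ _ trivial trivial⟩, trivial⟩, trivial, trivial⟩ trivial
  · refine ⟨trivial, ⟨Cond.branch_avoids _ (by omega) _ trivial (Stmt.skip_avoids (by omega)),
      Stmt.skip_avoids (by omega)⟩, trivial, ?_, trivial⟩
    simp [Stmt.Avoids, Instr.Avoids]
  · refine ⟨by omega, L.cellStmt_avoids (by omega) (by omega), ?_⟩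
    simp [Stmt.Avoids, Instr.Avoids]
  · refine ⟨L.cellStmt_avoids (by omega) (by omega), ?_⟩
    simp [Stmt.Avoids, Instr.Avoids]
  · exact ⟨trivial, trivial, Cond.branch_avoids _ (by omega) _ trivial
      (Stmt.skip_avoids (by omega)), Cond.branch_avoids _ (by omega) _ trivial
      (Stmt.skip_avoids (by omega)), Cond.branch_avoids _ (by omega) _ trivial
      (Stmt.skip_avoids (by omega))⟩

theorem nestStmt_avoids {S : Stmt} {x : ℕ} (h : S.Avoids x) :
    ∀ {j : ℕ}, (x < 100 ∨ 100 + j ≤ x) → (nestStmt S j).Avoids x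
  | 0, _ => h
  | j + 1, hx => ⟨by omega, nestStmt_avoids h (by omega)⟩

theorem nestStmt_loopsOk {S : Stmt} (h : S.LoopsOk) (ha : ∀ x, 100 ≤ x → S.Avoids x) :
    ∀ j : ℕ, (nestStmt S j).LoopsOk
  | 0 => h
  | j + 1 => ⟨Or.inl rfl, nestStmt_avoids (ha _ (by omega)) (by omega),
      nestStmt_loopsOk h ha j⟩

end

section

variable {R : Type} [Field R] [LinearOrder R] [IsStrictOrderedRing R]

/-- The instance and the tuple `a` are stored in memory. -/
structure TupleStored {c : ℕ} (I : WSOCTInstance R) (a : Fin c → Fin I.n) (s : Memory R) :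
    Prop where
  pos : 0 < I.n
  stored : I.Stored s
  tuple : ∀ j : Fin c, s.num (100 + (j : ℕ)) = a j

theorem TupleStored.frame {c : ℕ} {I : WSOCTInstance R} {a : Fin c → Fin I.n} {s s' : Memory R}
    (h : TupleStored I a s) (hf : s.Frame s') : TupleStored I a s' :=
  ⟨h.pos, h.stored.frame hf, fun j => (hf.num _ (by omega)).trans (h.tuple j)⟩

theorem TupleStored.setNum {c : ℕ} {I : WSOCTInstance R} {a : Fin c → Fin I.n} {s : Memory R}
    (h : TupleStored I a s) {x : ℕ} (hx : 5 ≤ x ∧ x < 100) (m : ℕ) :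
    TupleStored I a (s.setNum x m) :=
  h.frame (Memory.Frame.setNum s hx m)

open Classical in
theorem TupleStored.run_branch {c : ℕ} {I : WSOCTInstance R} {a : Fin c → Fin I.n}
    {s : Memory R} (h : TupleStored I a s) (A : Cond (Option (Fin c))) {x : ℕ} (hx : x ≠ 5)
    {v : Fin I.n} (hv : s.num x = v) (P Q : Stmt) :
    ∃ z, (A.branch (regs x) P Q).run s =
      if A.At I.G I.T a v then P.run (s.setNum 5 z) else Q.run (s.setNum 5 z) := by
  refine Cond.run_branch _ (regs_ne hx (by omega)) (fun o => o.elim v a) A P Q s h.stored ?_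
  intro o
  cases o with
  | none => exact hv
  | some j => exact h.tuple j

theorem run_excessStmt {c : ℕ} (L : Scheme c) {I : WSOCTInstance R} {a : Fin c → Fin I.n}
    {s : Memory R} (h : TupleStored I a s) :
    ∀ u ≤ 2 * I.n, (L.excessStmt.run s).warr 2 u = netExcess I.w (L.A₁.At I.G I.T a) u ∧
      (L.excessStmt.run s).arr 4 u = 0 := by
  have key := Stmt.for_rule (i := 10) (m := 2 * I.n) (s := s) (S := _) h.stored.num2
    (by
      refine ⟨trivial, ⟨Cond.branch_avoids _ (by omega) _ trivial (Stmt.skip_avoids (by omega)),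
        Stmt.skip_avoids (by omega)⟩, trivial, ?_, trivial⟩
      simp [Stmt.Avoids, Instr.Avoids] : Stmt.Avoids 10 (.seq (.instr (.wadd 4 1 1)) <|
    .seq (.ite (.le 10 1) (L.A₁.branch (regs 10) (.instr (.wload 4 0 10)) .skip) .skip) <|
    .seq (.instr (.wstore 2 10 4)) <| .seq (.instr (.set 6 0)) (.instr (.store 4 10 6))))
    (fun k s' => TupleStored I a s' ∧ ∀ u < k,
      s'.warr 2 u = netExcess I.w (L.A₁.At I.G I.T a) u ∧ s'.arr 4 u = 0)
    ⟨h.setNum (by omega) _, fun u hu => by omega⟩ ?_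
  · exact fun u hu => key.2 u (by omega)
  · rintro k hk s' h10 ⟨h1, h2⟩
    refine ⟨(h1.frame (Stmt.Local.frame L.excessStmt_local.2 s')).setNum (by omega) _, ?_⟩
    rw [Stmt.run_seq, Stmt.run_seq]
    set s₁ := (Stmt.instr (.wadd 4 1 1)).run s' with hs₁
    have e1 : TupleStored I a s₁ :=
      h1.frame (Stmt.Local.frame (by simp [Stmt.Local, Instr.Local]) s')
    have e10 : s₁.num 10 = k := h10
    have e4 : s₁.wt 4 = 0 := by
      simp [hs₁, Stmt.run, Instr.exec, h1.stored.wt1]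
    set s₂ := (Stmt.ite (.le 10 1) (L.A₁.branch (regs 10) (.instr (.wload 4 0 10)) .skip)
      .skip).run s₁ with hs₂
    have e2 : s₂.num 10 = k ∧ s₂.wt 4 = netExcess I.w (L.A₁.At I.G I.T a) k ∧
        s₂.warr = s'.warr ∧ s₂.arr = s'.arr := by
      rw [hs₂, Stmt.run_ite]
      -- Comparing with `n - 1` tests for left copies; with truncated subtraction this is correct
      -- only because `n` is positive.
      have hn1 : s₁.num 1 = I.n - 1 := e1.stored.num1
      unfold netExcess
      by_cases hkn : k < I.n
      · have hle : (Test.le 10 1).Holds s₁ := by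
          simp only [Test.Holds, e10, hn1]
          omega
        rw [if_pos hle, dif_pos hkn]
        obtain ⟨z, hz⟩ := e1.run_branch L.A₁ (x := 10) (by omega) (v := ⟨k, hkn⟩) e10
          (.instr (.wload 4 0 10)) .skip
        rw [hz]
        have hw := I.input_weight ⟨k, hkn⟩
        have hw0 := e1.stored.warr0
        split_ifs with hA
        · refine ⟨?_, ?_, rfl, rfl⟩
          · simp [Stmt.run, Instr.exec, Memory.setNum, e10]
          · simpa [Stmt.run, Instr.exec, Memory.setNum, e10, hw0] using hw
        · refine ⟨?_, ?_, rfl, rfl⟩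
          · simp [Stmt.skip, Stmt.run, Instr.exec, Memory.setNum, e10]
          · simpa [Stmt.skip, Stmt.run, Instr.exec, Memory.setNum] using e4
      · have hle : ¬ (Test.le 10 1).Holds s₁ := by
          have := h.pos
          simp only [Test.Holds, e10, hn1]
          omega
        rw [dif_neg hkn, if_neg hle]
        refine ⟨?_, ?_, rfl, rfl⟩
        · simp [Stmt.skip, Stmt.run, Instr.exec, e10]
        · simpa [Stmt.skip, Stmt.run, Instr.exec] using e4
    obtain ⟨f1, f2, f3, f4⟩ := e2
    intro u hu
    rcases Nat.lt_succ_iff_lt_or_eq.1 hu with hu | rfl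
    · have := h2 u hu
      simp [Stmt.run, Instr.exec, Memory.setNum, f1, f2, f3, f4, hu.ne, this]
    · simp [Stmt.run, Instr.exec, Memory.setNum, f1, f2]

-- The branching of the program mirrors that of `netCap`, with weight variable `4` preset to zero
-- for the cases without an arc.
open Classical in
theorem run_cellStmt {c : ℕ} (L : Scheme c) {I : WSOCTInstance R} {a : Fin c → Fin I.n}
    {s : Memory R} (h : TupleStored I a s) {u v : ℕ} (hu : u ≤ 2 * I.n) (hv : v ≤ 2 * I.n)
    (h10 : s.num 10 = u) (h11 : s.num 11 = v) :
    (L.cellStmt.run s).wt 4 =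
        netCap I.w (L.A₁.At I.G I.T a) (L.A₂.At I.G I.T a) (L.Rel I.G) u v ∧
      (L.cellStmt.run s).warr = s.warr ∧ (L.cellStmt.run s).arr = s.arr := by
  have hpos := h.pos
  rw [Scheme.cellStmt, Stmt.run_seq]
  set s₁ := (Stmt.instr (.wadd 4 1 1)).run s with hs₁
  have e1 : TupleStored I a s₁ :=
    h.frame (Stmt.Local.frame (by simp [Stmt.Local, Instr.Local]) s)
  have e4 : s₁.wt 4 = 0 := by simp [hs₁, Stmt.run, Instr.exec, h.stored.wt1]
  have e10 : s₁.num 10 = u := h10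
  have e11 : s₁.num 11 = v := h11
  have ew : s₁.warr = s.warr := rfl
  have ea : s₁.arr = s.arr := rfl
  rw [← ew, ← ea]
  generalize s₁ = s₁ at *
  have hn0 := e1.stored.num0
  have hn1 := e1.stored.num1
  have hn2 := e1.stored.num2
  have hskip : ∀ z, (Stmt.skip.run (s₁.setNum 5 z)).wt 4 = 0 := fun z => e4
  unfold netCap
  rw [Stmt.run_ite]
  by_cases hun : u < I.n
  · rw [if_pos (show (Test.le 10 1).Holds s₁ by simp only [Test.Holds]; omega), dif_pos hun,
      Stmt.run_ite]
    by_cases hvn : I.n ≤ v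
    · rw [if_pos (show (Test.le 0 11).Holds s₁ by simp only [Test.Holds]; omega), Stmt.run_ite]
      by_cases hvn2 : v < 2 * I.n
      · rw [if_neg (show ¬ (Test.le 2 11).Holds s₁ by simp only [Test.Holds]; omega),
          dif_pos ⟨hvn, hvn2⟩, Stmt.run_seq]
        set s₂ := (Stmt.instr (.sub 12 11 0)).run s₁ with hs₂
        have f1 : TupleStored I a s₂ :=
          e1.frame (Stmt.Local.frame (by simp [Stmt.Local, Instr.Local]) s₁)
        have f4 : s₂.wt 4 = 0 := e4
        have f10 : s₂.num 10 = u := by simp [hs₂, Stmt.run, Instr.exec, e10]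
        have f12 : s₂.num 12 = v - I.n := by simp [hs₂, Stmt.run, Instr.exec, e11, hn0]
        have fw : s₂.warr = s₁.warr := rfl
        have fa : s₂.arr = s₁.arr := rfl
        rw [← fw, ← fa]
        clear_value s₂
        obtain ⟨z, hz⟩ := f1.run_branch L.A₁ (x := 10) (by omega) (v := ⟨u, hun⟩) f10
          (L.A₂.branch (regs 12) (L.relCond.branch (fun b => if b then 12 else 10)
            (.instr (.wadd 4 2 1)) .skip) .skip) .skip
        rw [hz]
        by_cases hA1 : L.A₁.At I.G I.T a ⟨u, hun⟩
        swap
        · rw [if_neg hA1, if_neg fun hh => hA1 hh.1]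
          exact ⟨f4, rfl, rfl⟩
        rw [if_pos hA1]
        obtain ⟨z', hz'⟩ := (f1.setNum (x := 5) (by omega) z).run_branch L.A₂ (x := 12)
          (by omega) (v := ⟨v - I.n, by omega⟩) (by simpa [Memory.setNum_num] using f12)
          (L.relCond.branch (fun b => if b then 12 else 10) (.instr (.wadd 4 2 1)) .skip) .skip
        rw [hz', Memory.setNum_setNum]
        by_cases hA2 : L.A₂.At I.G I.T a ⟨v - I.n, by omega⟩
        swap
        · rw [if_neg hA2, if_neg fun hh => hA2 hh.2.1]
          exact ⟨f4, rfl, rfl⟩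
        rw [if_pos hA2]
        have f1' := f1.setNum (x := 5) (by omega) z'
        obtain ⟨z'', hz''⟩ := Cond.run_branch (I := I) (fun b : Bool => if b then 12 else 10)
          (by intro b; cases b <;> simp)
          (fun b => if b then ⟨v - I.n, by omega⟩ else ⟨u, hun⟩) L.relCond
          (.instr (.wadd 4 2 1)) .skip (s₂.setNum 5 z') f1'.stored
          (by intro b; cases b <;> simp [Memory.setNum_num, f10, f12])
        rw [hz'', Memory.setNum_setNum]
        have hrel := L.eval_relCond I.G I.T ⟨u, hun⟩ ⟨v - I.n, by omega⟩
        rw [if_congr hrel rfl rfl]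
        have hwt1 := f1.stored.wt1
        have hwt2 := f1.stored.wt2
        by_cases hr : L.Rel I.G ⟨u, hun⟩ ⟨v - I.n, by omega⟩
        · rw [if_pos hr, if_pos ⟨hA1, hA2, hr⟩]
          refine ⟨?_, rfl, rfl⟩
          simp [Stmt.run, Instr.exec, Memory.setNum, hwt1, hwt2]
        · rw [if_neg hr, if_neg fun hh => hr hh.2.2]
          exact ⟨f4, rfl, rfl⟩
      · rw [if_pos (show (Test.le 2 11).Holds s₁ by simp only [Test.Holds]; omega),
          dif_neg (by omega)]
        exact ⟨e4, rfl, rfl⟩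
    · rw [if_neg (show ¬ (Test.le 0 11).Holds s₁ by simp only [Test.Holds]; omega),
        dif_neg (by omega)]
      exact ⟨e4, rfl, rfl⟩
  · rw [if_neg (show ¬ (Test.le 10 1).Holds s₁ by simp only [Test.Holds]; omega), dif_neg hun,
      Stmt.run_ite]
    by_cases hvn : v = 2 * I.n
    · rw [if_pos (show (Test.le 2 11).Holds s₁ by simp only [Test.Holds]; omega), Stmt.run_ite]
      by_cases hun2 : u < 2 * I.n
      · rw [if_neg (show ¬ (Test.le 2 10).Holds s₁ by simp only [Test.Holds]; omega),
          dif_pos ⟨hvn, hun2⟩, Stmt.run_seq]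
        set s₂ := (Stmt.instr (.sub 12 10 0)).run s₁ with hs₂
        have f1 : TupleStored I a s₂ :=
          e1.frame (Stmt.Local.frame (by simp [Stmt.Local, Instr.Local]) s₁)
        have f4 : s₂.wt 4 = 0 := e4
        have f12 : s₂.num 12 = u - I.n := by simp [hs₂, Stmt.run, Instr.exec, e10, hn0]
        have fw : s₂.warr = s₁.warr := rfl
        have fa : s₂.arr = s₁.arr := rfl
        rw [← fw, ← fa]
        clear_value s₂
        obtain ⟨z, hz⟩ := f1.run_branch L.A₂ (x := 12) (by omega) (v := ⟨u - I.n, by omega⟩)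
          f12 (.instr (.wload 4 0 12)) .skip
        rw [hz]
        have hw := I.input_weight ⟨u - I.n, by omega⟩
        have hw0 := f1.stored.warr0
        by_cases hA2 : L.A₂.At I.G I.T a ⟨u - I.n, by omega⟩
        · rw [if_pos hA2, if_pos hA2]
          refine ⟨?_, rfl, rfl⟩
          simpa [Stmt.run, Instr.exec, Memory.setNum, f12, hw0] using hw
        · rw [if_neg hA2, if_neg hA2]
          exact ⟨f4, rfl, rfl⟩
      · rw [if_pos (show (Test.le 2 10).Holds s₁ by simp only [Test.Holds]; omega),
          dif_neg (by omega)]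
        exact ⟨e4, rfl, rfl⟩
    · rw [if_neg (show ¬ (Test.le 2 11).Holds s₁ by simp only [Test.Holds]; omega),
        dif_neg (by omega)]
      exact ⟨e4, rfl, rfl⟩

theorem run_capStmt {c : ℕ} (L : Scheme c) {I : WSOCTInstance R} {a : Fin c → Fin I.n}
    {s : Memory R} (h : TupleStored I a s) :
    (∀ u ≤ 2 * I.n, ∀ v ≤ 2 * I.n, (L.capStmt.run s).warr 1 (u * (2 * I.n + 1) + v) =
        netCap I.w (L.A₁.At I.G I.T a) (L.A₂.At I.G I.T a) (L.Rel I.G) u v) ∧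
      (L.capStmt.run s).warr 2 = s.warr 2 ∧ (L.capStmt.run s).arr = s.arr := by
  set f := netCap I.w (L.A₁.At I.G I.T a) (L.A₂.At I.G I.T a) (L.Rel I.G) with hf
  set B : Stmt := .seq L.cellStmt <| .seq (.instr (.load 6 3 10)) <|
    .seq (.instr (.add 6 6 11)) (.instr (.wstore 1 6 4)) with hB
  have hBl : B.Local := ⟨L.cellStmt_local, by simp [Stmt.Local, Instr.Local]⟩
  have ha10 : B.Avoids 10 := ⟨L.cellStmt_avoids (by omega) (by omega), by
    simp [Stmt.Avoids, Instr.Avoids]⟩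
  have ha11 : B.Avoids 11 := ⟨L.cellStmt_avoids (by omega) (by omega), by
    simp [Stmt.Avoids, Instr.Avoids]⟩
  have hbody : ∀ (u v : ℕ) (s : Memory R), u ≤ 2 * I.n → v ≤ 2 * I.n → TupleStored I a s →
      s.num 10 = u → s.num 11 = v → (B.run s).warr =
        Function.update s.warr 1 (Function.update (s.warr 1) (u * (2 * I.n + 1) + v) (f u v)) ∧
        (B.run s).arr = s.arr := by
    intro u v s hu hv hs h10 h11
    obtain ⟨c1, c2, c3⟩ := run_cellStmt L hs hu hv h10 h11
    have d10 : (L.cellStmt.run s).num 10 = u := by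
      rw [(L.cellStmt_avoids (by omega) (by omega)).run_num, h10]
    have d11 : (L.cellStmt.run s).num 11 = v := by
      rw [(L.cellStmt_avoids (by omega) (by omega)).run_num, h11]
    have d3 := (hs.stored.frame (L.cellStmt_local.frame s)).arr3 u hu
    rw [hB, Stmt.run_seq]
    generalize L.cellStmt.run s = s' at *
    rw [← c2, ← c3]
    simp only [Stmt.run, Instr.exec, Function.update_self, Function.update_of_ne, ne_eq,
      Nat.reduceEqDiff, not_false_eq_true, d10, d11, d3, c1, and_self, ← hf]
  -- A pass of the inner loop rewrites row `u` of the capacity matrix and leaves all other rows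
  -- alone.
  have hcol : ∀ (u : ℕ) (s : Memory R), u ≤ 2 * I.n → TupleStored I a s → s.num 10 = u →
      (∀ x ≤ 2 * I.n, ∀ y ≤ 2 * I.n, ((Stmt.for_ 11 2 B).run s).warr 1 (x * (2 * I.n + 1) + y) =
        if x = u then f u y else s.warr 1 (x * (2 * I.n + 1) + y)) ∧
      ((Stmt.for_ 11 2 B).run s).warr 2 = s.warr 2 ∧
      ((Stmt.for_ 11 2 B).run s).arr = s.arr := by
    intro u s hu hs h10
    have key := Stmt.for_rule (i := 11) (m := 2 * I.n) (S := B) hs.stored.num2 ha11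
      (fun k s' => TupleStored I a s' ∧ s'.num 10 = u ∧ (∀ x ≤ 2 * I.n, ∀ y ≤ 2 * I.n,
        s'.warr 1 (x * (2 * I.n + 1) + y) =
          if x = u ∧ y < k then f u y else s.warr 1 (x * (2 * I.n + 1) + y)) ∧
        s'.warr 2 = s.warr 2 ∧ s'.arr = s.arr)
      ⟨hs.setNum (by omega) _, by simpa [Memory.setNum_num] using h10, by simp [Memory.setNum],
        rfl, rfl⟩ ?_
    · refine ⟨fun x hx y hy => ?_, key.2.2.2⟩
      rw [key.2.2.1 x hx y hy]
      simp only [show y < 2 * I.n + 1 by omega, and_true]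
    · rintro k hk s' k11 ⟨k1, k2, k3, k4, k5⟩
      obtain ⟨b1, b2⟩ := hbody u k s' hu hk k1 k2 k11
      refine ⟨(k1.frame (hBl.frame s')).setNum (by omega) _, ?_, ?_, ?_, ?_⟩
      · rw [Memory.setNum_num, if_neg (by omega), ha10.run_num, k2]
      · intro x hx y hy
        show (B.run s').warr 1 _ = _
        rw [b1, Function.update_self, Function.update_apply, k3 x hx y hy]
        have e := index_inj (x := x) (u := u) (show k < 2 * I.n + 1 by omega)
          (show y < 2 * I.n + 1 by omega)
        by_cases c1 : x = u ∧ y = k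
        · rw [if_pos (e.2 c1), if_pos ⟨c1.1, by omega⟩, c1.2]
        · rw [if_neg fun hh => c1 (e.1 hh)]
          by_cases c2 : x = u ∧ y < k
          · rw [if_pos c2, if_pos ⟨c2.1, by omega⟩]
          · rw [if_neg c2, if_neg]
            rintro ⟨d1, d2⟩
            rcases Nat.lt_succ_iff_lt_or_eq.1 d2 with d2 | d2
            · exact c2 ⟨d1, d2⟩
            · exact c1 ⟨d1, d2⟩
      · show (B.run s').warr 2 = _
        rw [b1, Function.update_of_ne (by omega), k4]
      · exact b2.trans k5
  have key := Stmt.for_rule (i := 10) (m := 2 * I.n) (S := .for_ 11 2 B) h.stored.num2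
    ⟨by omega, ha10⟩
    (fun k s' => TupleStored I a s' ∧ (∀ x ≤ 2 * I.n, x < k → ∀ y ≤ 2 * I.n,
      s'.warr 1 (x * (2 * I.n + 1) + y) = f x y) ∧
      s'.warr 2 = s.warr 2 ∧ s'.arr = s.arr)
    ⟨h.setNum (by omega) _, fun x _ hx => by omega, rfl, rfl⟩ ?_
  · exact ⟨fun u hu v hv => key.2.1 u hu (by omega) v hv, key.2.2⟩
  · rintro k hk s' k10 ⟨k1, k2, k3, k4⟩
    obtain ⟨b1, b2, b3⟩ := hcol k s' hk k1 k10
    have hl : (Stmt.for_ 11 2 B).Local := ⟨by omega, hBl⟩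
    refine ⟨(k1.frame (hl.frame s')).setNum (by omega) _, fun x hx hxk y hy => ?_,
      b2.trans k3, b3.trans k4⟩
    refine (b1 x hx y hy).trans ?_
    split_ifs with hxu
    · rw [hxu]
    · exact k2 x hx (by omega) y hy

end

/-! ### Testing a scheme on one tuple -/

section

variable {R : Type} [Field R] [LinearOrder R] [IsStrictOrderedRing R]

open Classical in
theorem run_addIf {c : ℕ} (A : Cond (Option (Fin c))) {I : WSOCTInstance R}
    {a : Fin c → Fin I.n} {s : Memory R} (h : TupleStored I a s) {v : Fin I.n}
    (h10 : s.num 10 = v) : ∀ s', s' = (A.branch (regs 10) (.instr (.wadd 3 3 4)) .skip).run s →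
      TupleStored I a s' ∧ s'.num 10 = v ∧ s'.warr = s.warr ∧ s'.wt 4 = s.wt 4 ∧
      s'.wt 3 = s.wt 3 + if A.At I.G I.T a v then s.wt 4 else 0 := by
  rintro s' rfl
  have hl : (A.branch (regs 10) (.instr (.wadd 3 3 4)) .skip).Local :=
    Cond.branch_local _ _ (by simp [Stmt.Local, Instr.Local]) Stmt.skip_local
  refine ⟨h.frame (hl.frame s), ?_, ?_⟩
  · rw [(Cond.branch_avoids (regs 10) (by omega) A (P := .instr (.wadd 3 3 4)) trivial
      (Stmt.skip_avoids (by omega))).run_num, h10]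
  · obtain ⟨z, hz⟩ := h.run_branch A (x := 10) (by omega) h10 (.instr (.wadd 3 3 4)) .skip
    rw [hz]
    split_ifs with hA
    · refine ⟨rfl, ?_, ?_⟩ <;> simp [Stmt.run, Instr.exec, Memory.setNum]
    · exact ⟨rfl, rfl, (add_zero _).symm⟩

open Classical in
/-- The contribution of a vertex to the bound. -/
noncomputable def Scheme.gain {c : ℕ} (L : Scheme c) (I : WSOCTInstance R) (a : Fin c → Fin I.n)
    (v : Fin I.n) : R :=
  -I.w v + (if ∃ j, v = a j then I.w v else 0) + (if L.A₁.At I.G I.T a v then I.w v else 0) +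
    (if L.A₂.At I.G I.T a v then I.w v else 0)

theorem run_boundStmt {c : ℕ} (L : Scheme c) {I : WSOCTInstance R} {a : Fin c → Fin I.n}
    {s : Memory R} (h : TupleStored I a s) :
    (L.boundStmt.run s).wt 3 = I.k + ∑ v, L.gain I a v ∧
      (L.boundStmt.run s).warr = s.warr := by
  classical
  -- The gains are extended by zero to all natural numbers, so that partial sums over `Finset.range
  -- k` can serve as loop invariant.
  set g : ℕ → R := fun v => if hv : v < I.n then L.gain I a ⟨v, hv⟩ else 0 with hg
  have hsum : ∑ v, L.gain I a v = ∑ v ∈ Finset.range (I.n - 1 + 1), g v := by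
    rw [Nat.sub_add_cancel h.pos, Finset.sum_range]
    exact Finset.sum_congr rfl fun v _ => by simp [hg]
  rw [hsum, Scheme.boundStmt, Stmt.run_seq]
  set B : Stmt := .seq (.instr (.wload 4 0 10)) <| .seq (.instr (.wsub 3 3 4)) <|
    .seq ((tupleCond c).branch (regs 10) (.instr (.wadd 3 3 4)) .skip) <|
    .seq (L.A₁.branch (regs 10) (.instr (.wadd 3 3 4)) .skip)
      (L.A₂.branch (regs 10) (.instr (.wadd 3 3 4)) .skip) with hB
  set s₀ := (Stmt.instr (.wadd 3 0 1)).run s with hs₀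
  have e0 : TupleStored I a s₀ :=
    h.frame (Stmt.Local.frame (by simp [Stmt.Local, Instr.Local]) s)
  have e3 : s₀.wt 3 = I.k := by
    simp [hs₀, Stmt.run, Instr.exec, h.stored.wt0, h.stored.wt1]
  have ew : s₀.warr = s.warr := rfl
  rw [← ew]
  have hav : B.Avoids 10 := ⟨trivial, trivial, Cond.branch_avoids _ (by omega) _ trivial
    (Stmt.skip_avoids (by omega)), Cond.branch_avoids _ (by omega) _ trivial
    (Stmt.skip_avoids (by omega)), Cond.branch_avoids _ (by omega) _ trivial
    (Stmt.skip_avoids (by omega))⟩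
  have key := Stmt.for_rule (i := 10) (m := I.n - 1) (S := B) (s := s₀) e0.stored.num1 hav
    (fun k s' => TupleStored I a s' ∧ s'.warr = s₀.warr ∧
      s'.wt 3 = I.k + ∑ v ∈ Finset.range k, g v)
    ⟨e0.setNum (by omega) _, rfl, by simpa [Memory.setNum] using e3⟩ ?_
  · exact ⟨key.2.2, key.2.1⟩
  · rintro k hk s' h10 ⟨k1, k2, k3⟩
    have hkn : k < I.n := by have := h.pos; omega
    have hw := I.input_weight ⟨k, hkn⟩
    rw [← k1.stored.warr0] at hw
    suffices hsuff : TupleStored I a (B.run s') ∧ (B.run s').warr = s₀.warr ∧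
        (B.run s').wt 3 = I.k + ∑ v ∈ Finset.range (k + 1), g v from
      ⟨hsuff.1.setNum (by omega) _, hsuff.2.1, hsuff.2.2⟩
    rw [hB, Stmt.run_seq, Stmt.run_seq, Stmt.run_seq, Stmt.run_seq]
    set s₁ := (Stmt.instr (.wsub 3 3 4)).run ((Stmt.instr (.wload 4 0 10)).run s') with hs₁
    have f1 : TupleStored I a s₁ :=
      k1.frame (Stmt.Local.frame (S := .seq (.instr (.wload 4 0 10)) (.instr (.wsub 3 3 4)))
        (by simp [Stmt.Local, Instr.Local]) s')
    have f4 : s₁.wt 4 = I.w ⟨k, hkn⟩ := by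
      simpa [hs₁, Stmt.run, Instr.exec, h10] using hw
    have f3 : s₁.wt 3 = s'.wt 3 - I.w ⟨k, hkn⟩ := by
      rw [← hw]
      simp [hs₁, Stmt.run, Instr.exec, h10]
    have f10 : s₁.num 10 = k := h10
    have fw : s₁.warr = s₀.warr := k2
    generalize s₁ = s₁ at *
    obtain ⟨a1, a2, a3, a4, a5⟩ := run_addIf (tupleCond c) f1 (v := ⟨k, hkn⟩) f10 _ rfl
    generalize ((tupleCond c).branch (regs 10) (.instr (.wadd 3 3 4)) .skip).run s₁ = s₂ at *
    obtain ⟨b1, b2, b3, b4, b5⟩ := run_addIf L.A₁ a1 a2 _ rfl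
    generalize (L.A₁.branch (regs 10) (.instr (.wadd 3 3 4)) .skip).run s₂ = s₃ at *
    obtain ⟨c1, c2, c3, c4, c5⟩ := run_addIf L.A₂ b1 b2 _ rfl
    refine ⟨c1, c3.trans (b3.trans (a3.trans fw)), ?_⟩
    rw [Finset.sum_range_succ, c5, b5, b4, a5, a4, f3, f4, k3]
    have hgk : g k = L.gain I a ⟨k, hkn⟩ := by simp [hg, hkn]
    have ht : (tupleCond c).At I.G I.T a ⟨k, hkn⟩ ↔ ∃ j, ⟨k, hkn⟩ = a j :=
      eval_tupleCond _ _ _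
    rw [hgk, Scheme.gain, if_congr ht rfl rfl]
    ring

/-- The scheme yields a solution for the tuple `a`. -/
def Scheme.Succeeds {c : ℕ} (L : Scheme c) (I : WSOCTInstance R) (a : Fin c → Fin I.n) : Prop :=
  L.pat.Eval I.G I.T a ∧ ∃ K₁ K₂ : Finset (Fin I.n), (∀ u ∈ K₁, L.A₁.At I.G I.T a u) ∧
    (∀ v ∈ K₂, L.A₂.At I.G I.T a v) ∧ (∀ u ∈ K₁, ∀ v ∈ K₂, ¬ L.Rel I.G u v) ∧
    open Classical in
    ∑ v with L.A₁.At I.G I.T a v ∧ v ∉ K₁, I.w v + ∑ v with L.A₂.At I.G I.T a v ∧ v ∉ K₂, I.w v ≤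
      I.k + ∑ v, L.gain I a v

/-- With all labels zero and the capacities as residual capacities, the initial preflow is trivially
valid. After the rounds, the excess at the sink is the capacity of a minimum cut, which is the least
weight of `A₁` and `A₂` that has to be discarded. -/
theorem run_cutStmt {c : ℕ} (L : Scheme c) {I : WSOCTInstance R} {a : Fin c → Fin I.n}
    {s : Memory R} (h : TupleStored I a s) (hp : L.pat.Eval I.G I.T a) :
    (Test.wle 4 3).Holds (L.cutStmt.run s) ↔ L.Succeeds I a := by
  classical
  rw [Scheme.cutStmt, Stmt.run_seq, Stmt.run_seq, Stmt.run_seq, Stmt.run_seq]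
  have e1 := run_excessStmt L h
  have h1 := h.frame (L.excessStmt_local.frame s)
  generalize L.excessStmt.run s = s₁ at *
  obtain ⟨e2, e3, e4⟩ := run_capStmt L h1
  have h2 := h1.frame (L.capStmt_local.frame s₁)
  generalize L.capStmt.run s₁ = s₂ at *
  set cap := netCap I.w (L.A₁.At I.G I.T a) (L.A₂.At I.G I.T a) (L.Rel I.G) with hcap
  set ex := netExcess I.w (L.A₁.At I.G I.T a) with hex
  set σ : Preflow R := ⟨cap, ex, fun _ => 0⟩ with hσ
  have hst : σ.Stored I.n s₂ :=
    ⟨e2, fun u hu => by rw [e3]; exact (e1 u hu).1, fun u hu => by rw [e4]; exact (e1 u hu).2⟩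
  have hval : σ.Valid (2 * I.n) cap ex :=
    ⟨fun u _ v _ => netCap_nonneg I.w_nonneg _ _ _ u v, fun u _ => netExcess_nonneg I.w_nonneg _ u,
      fun _ _ _ _ => rfl, fun v _ => by simp [hσ], rfl, fun _ _ => Nat.zero_le _,
      fun _ _ _ _ _ => Nat.zero_le _⟩
  have e5 := run_repeatStmt 7 (by omega) h2.stored hst
  have h3 := h2.frame ((repeatStmt_local roundStmt_local (j := 7) (by omega)).frame s₂)
  generalize (repeatStmt roundStmt 7).run s₂ = s₃ at *
  obtain ⟨v1, v2⟩ := hval.iterate_round (by have := h.pos; omega)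
  generalize (Preflow.round (2 * I.n))^[(2 * I.n + 1) ^ 7] σ = τ at *
  obtain ⟨e6, e7⟩ := run_boundStmt L h3
  have h4 := h3.frame (L.boundStmt_local.frame s₃)
  generalize L.boundStmt.run s₃ = s₄ at *
  have e8 := e5.e (2 * I.n) le_rfl
  rw [← e7] at e8
  have hnum2 := h4.stored.num2
  have hle : (Test.wle 4 3).Holds ((Stmt.instr (.wload 4 2 2)).run s₄) ↔
      τ.e (2 * I.n) ≤ I.k + ∑ v, L.gain I a v := by
    simp [Test.Holds, Stmt.run, Instr.exec, hnum2, e8, e6]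
  rw [hle, v1.excess_sink_le_iff v2, exists_cut_iff I.w_nonneg]
  exact ⟨fun hh => ⟨hp, hh⟩, fun hh => hh.2⟩

/-- The flag in variable `4` is raised but never lowered, so over all tests it accumulates a
disjunction. -/
theorem run_testStmt {c : ℕ} (L : Scheme c) {I : WSOCTInstance R} {a : Fin c → Fin I.n}
    {s : Memory R} (h : TupleStored I a s) :
    I.Stored (L.testStmt.run s) ∧
      ((L.testStmt.run s).num 4 = 1 ↔ s.num 4 = 1 ∨ L.Succeeds I a) := by
  classical
  obtain ⟨z, hz⟩ := Cond.run_branch (I := I) (fun j : Fin c => 100 + (j : ℕ)) (fun i => by omega)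
    a L.pat (.seq L.cutStmt (.ite (.wle 4 3) (.instr (.set 4 1)) .skip)) .skip s h.stored h.tuple
  rw [Scheme.testStmt, hz]
  have h' := h.setNum (x := 5) (by omega) z
  have h4 : (s.setNum 5 z).num 4 = s.num 4 := by simp [Memory.setNum_num]
  split_ifs with hp
  · have hcut := run_cutStmt L h' hp
    have hfr := L.cutStmt_local.frame (s.setNum 5 z)
    have h2 := h'.frame hfr
    rw [Stmt.run_seq, Stmt.run_ite, if_congr hcut rfl rfl]
    split_ifs with hs
    · refine ⟨?_, ?_⟩
      · have hst := h2.stored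
        exact ⟨hst.num0, hst.num1, hst.num2, hst.num3, hst.arr0, hst.arr1, hst.arr2, hst.arr3,
          hst.wt0, hst.wt1, hst.wt2, hst.warr0⟩
      · simp [Stmt.run, Instr.exec, hs]
    · refine ⟨h2.stored.frame (Stmt.skip_local.frame _), ?_⟩
      rw [(Stmt.skip_local.frame _).num 4 (by omega), hfr.num 4 (by omega), h4]
      simp [hs]
  · refine ⟨h'.stored.frame (Stmt.skip_local.frame _), ?_⟩
    rw [(Stmt.skip_local.frame _).num 4 (by omega), h4]
    exact ⟨Or.inl, fun hh => hh.resolve_right fun hs => hp hs.1⟩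

/-! ### Enumerating tuples and schemes -/

/-- Induction on the number of loops: the entries from `j` on have been fixed by the outer loops,
and the inner `j` loops search all tuples that agree with `a` there. -/
theorem run_nestStmt {c : ℕ} {I : WSOCTInstance R} (hpos : 0 < I.n) {S : Stmt}
    {Q : (Fin c → Fin I.n) → Prop} (ha : ∀ x, 100 ≤ x → S.Avoids x)
    (hS : ∀ (a : Fin c → Fin I.n) (s : Memory R), TupleStored I a s →
      I.Stored (S.run s) ∧ ((S.run s).num 4 = 1 ↔ s.num 4 = 1 ∨ Q a)) :
    ∀ j ≤ c, ∀ (a : Fin c → Fin I.n) (s : Memory R), I.Stored s →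
      (∀ i : Fin c, j ≤ i → s.num (100 + (i : ℕ)) = a i) →
      I.Stored ((nestStmt S j).run s) ∧ (((nestStmt S j).run s).num 4 = 1 ↔ s.num 4 = 1 ∨
        ∃ a' : Fin c → Fin I.n, (∀ i : Fin c, j ≤ i → a' i = a i) ∧ Q a') := by
  intro j
  induction j with
  | zero =>
    intro _ a s hs hreg
    obtain ⟨h1, h2⟩ := hS a s ⟨hpos, hs, fun i => hreg i (Nat.zero_le _)⟩
    refine ⟨h1, h2.trans (or_congr_right ⟨fun hq => ⟨a, fun _ _ => rfl, hq⟩, ?_⟩)⟩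
    rintro ⟨a', ha', hq⟩
    rwa [← funext fun i => ha' i (Nat.zero_le _)]
  | succ j ih =>
    intro hj a s hs hreg
    have hset : ∀ {s : Memory R} (m : ℕ), I.Stored s → I.Stored (s.setNum (100 + j) m) := by
      intro s m hst
      have hnum : ∀ x, x < 100 → (s.setNum (100 + j) m).num x = s.num x := fun x hx => by
        rw [Memory.setNum_num, if_neg (by omega)]
      exact ⟨(hnum 0 (by omega)).trans hst.num0, (hnum 1 (by omega)).trans hst.num1,
        (hnum 2 (by omega)).trans hst.num2, (hnum 3 (by omega)).trans hst.num3, hst.arr0,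
        hst.arr1, hst.arr2, hst.arr3, hst.wt0, hst.wt1, hst.wt2, hst.warr0⟩
    have hav : ∀ x, 100 + j ≤ x → (nestStmt S j).Avoids x := fun x hx =>
      nestStmt_avoids (ha x (by omega)) (Or.inr hx)
    have key := Stmt.for_rule (i := 100 + j) (m := I.n - 1) (S := nestStmt S j) (s := s) hs.num1
      (hav _ le_rfl)
      (fun k s' => I.Stored s' ∧ (∀ i : Fin c, j + 1 ≤ i → s'.num (100 + (i : ℕ)) = a i) ∧
        (s'.num 4 = 1 ↔ s.num 4 = 1 ∨ ∃ a' : Fin c → Fin I.n,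
          (∀ i : Fin c, j + 1 ≤ i → a' i = a i) ∧ (a' ⟨j, hj⟩ : ℕ) < k ∧ Q a'))
      ⟨hset _ hs, fun i hi => by rw [Memory.setNum_num, if_neg (by omega), hreg i hi],
        by rw [Memory.setNum_num, if_neg (by omega)]; simp⟩ ?_
    · refine ⟨key.1, key.2.2.trans (or_congr_right (exists_congr fun a' => and_congr_right
        fun _ => ⟨fun hh => hh.2, fun hh => ⟨?_, hh⟩⟩))⟩
      have := (a' ⟨j, hj⟩).2
      omega
    · rintro k hk s' h10 ⟨k1, k2, k3⟩
      have hkn : k < I.n := by omega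
      obtain ⟨r1, r2⟩ := ih (by omega) (Function.update a ⟨j, hj⟩ ⟨k, hkn⟩) s' k1 (by
        intro i hi
        by_cases hij : i = ⟨j, hj⟩
        · subst hij
          simpa using h10
        · have : (i : ℕ) ≠ j := fun e => hij (Fin.ext e)
          rw [Function.update_of_ne hij, k2 i (by omega)])
      refine ⟨hset _ r1, fun i hi => ?_, ?_⟩
      · rw [Memory.setNum_num, if_neg (by omega), (hav _ (by omega)).run_num, k2 i hi]
      · rw [Memory.setNum_num, if_neg (by omega), r2, k3, or_assoc]
        refine or_congr_right ⟨?_, ?_⟩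
        · rintro (⟨a', b1, b2, b3⟩ | ⟨a', b1, b2⟩)
          · exact ⟨a', b1, by omega, b3⟩
          · refine ⟨a', fun i hi => ?_, ?_, b2⟩
            · rw [b1 i (by omega), Function.update_of_ne]
              rintro rfl
              simp at hi
            · rw [b1 ⟨j, hj⟩ le_rfl]
              simp
        · rintro ⟨a', b1, b2, b3⟩
          rcases Nat.lt_succ_iff_lt_or_eq.1 b2 with b2 | b2
          · exact Or.inl ⟨a', b1, b2, b3⟩
          · refine Or.inr ⟨a', fun i hi => ?_, b3⟩
            by_cases hij : i = ⟨j, hj⟩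
            · subst hij
              rw [Function.update_self]
              exact Fin.ext b2
            · have : (i : ℕ) ≠ j := fun e => hij (Fin.ext e)
              rw [Function.update_of_ne hij, b1 i (by omega)]

/-- The program that tries a list of schemes. -/
def schemesStmt {c : ℕ} : List (Scheme c) → Stmt
  | [] => .skip
  | L :: Λ => .seq (nestStmt L.testStmt c) (schemesStmt Λ)

theorem schemesStmt_avoids {c x : ℕ} (hx : x < 4) : ∀ Λ : List (Scheme c),
    (schemesStmt Λ).Avoids x
  | [] => Stmt.skip_avoids (by omega)
  | L :: Λ => ⟨nestStmt_avoids (L.testStmt_avoids (Or.inl hx)) (Or.inl (by omega)),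
      schemesStmt_avoids hx Λ⟩

theorem schemesStmt_loopsOk {c : ℕ} : ∀ Λ : List (Scheme c), (schemesStmt Λ).LoopsOk
  | [] => trivial
  | L :: Λ => ⟨nestStmt_loopsOk L.testStmt_loopsOk (fun _ hx => L.testStmt_avoids (Or.inr hx)) c,
      schemesStmt_loopsOk Λ⟩

theorem run_schemesStmt {c : ℕ} {I : WSOCTInstance R} (hpos : 0 < I.n) :
    ∀ (Λ : List (Scheme c)) (s : Memory R), I.Stored s →
      I.Stored ((schemesStmt Λ).run s) ∧ (((schemesStmt Λ).run s).num 4 = 1 ↔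
        s.num 4 = 1 ∨ ∃ L ∈ Λ, ∃ a, L.Succeeds I a)
  | [], s, hs => ⟨hs.frame (Stmt.skip_local.frame s), by
      rw [schemesStmt, (Stmt.skip_local.frame s).num 4 (by omega)]
      simp⟩
  | L :: Λ, s, hs => by
      obtain ⟨h1, h2⟩ := run_nestStmt hpos (S := L.testStmt) (Q := L.Succeeds I)
        (fun _ hx => L.testStmt_avoids (Or.inr hx)) (fun a s h => run_testStmt L h) c le_rfl
        (fun _ => ⟨0, hpos⟩) s hs (fun i hi => absurd i.2 (by omega))
      obtain ⟨h3, h4⟩ := run_schemesStmt hpos Λ _ h1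
      rw [schemesStmt, Stmt.run_seq]
      refine ⟨h3, ?_⟩
      rw [h4, h2, or_assoc]
      refine or_congr_right ?_
      simp only [List.mem_cons, exists_eq_or_imp]
      refine or_congr_left (exists_congr fun a' => ?_)
      exact ⟨fun hh => hh.2, fun hh => ⟨fun i hi => absurd i.2 (by omega), hh⟩⟩

/-! ### The complete program -/

/-- The program that stores the multiples of `n` and of `2n + 1`. -/
def rowStmt : Stmt :=
  .for_ 10 2 <| .seq (.instr (.store 2 10 6)) <| .seq (.instr (.add 6 6 0)) <|
    .seq (.instr (.store 3 10 7)) <| .seq (.instr (.add 7 7 2)) (.instr (.add 7 7 3))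

/-- The program that computes the total weight. -/
def totalStmt : Stmt := .for_ 10 1 <| .seq (.instr (.wload 4 0 10)) (.instr (.wadd 2 2 4))

/-- The main part of the program. -/
def mainStmt {c : ℕ} (Λ : List (Scheme c)) : Stmt :=
  .seq rowStmt <| .seq totalStmt <| .seq (schemesStmt Λ) <| .seq (.instr (.set 5 0))
    (.instr (.add 0 4 5))

theorem mainStmt_avoids {c x : ℕ} (Λ : List (Scheme c)) (h0 : x ≠ 0) (hx : x < 4) :
    (mainStmt Λ).Avoids x := by
  refine ⟨?_, ?_, schemesStmt_avoids hx Λ, ?_⟩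
  all_goals
    simp only [rowStmt, totalStmt, Stmt.Avoids, Instr.Avoids, true_and, and_true]
    omega

theorem mainStmt_loopsOk {c : ℕ} (Λ : List (Scheme c)) : (mainStmt Λ).LoopsOk := by
  refine ⟨?_, ?_, schemesStmt_loopsOk Λ, ?_⟩
  · simp [rowStmt, Stmt.LoopsOk, Stmt.Avoids, Instr.Avoids]
  · simp [totalStmt, Stmt.LoopsOk, Stmt.Avoids, Instr.Avoids]
  · simp [Stmt.LoopsOk]

/-- The complete program. -/
def mainProgram {c : ℕ} (Λ : List (Scheme c)) : Program :=
  .seq (.instr (.set 3 1)) <| .ite (.le 3 0)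
    (.seq (.instr (.sub 1 0 3)) <| .seq (.instr (.add 2 0 0)) (mainStmt Λ).toProgram)
    (.instr (.set 0 1))

/-- The memory after the constants have been computed. -/
noncomputable def WSOCTInstance.start (I : WSOCTInstance R) : Memory R :=
  (Instr.add 2 0 0).exec ((Instr.sub 1 0 3).exec ((Instr.set 3 1).exec I.input))

theorem run_mainStmt {c : ℕ} {I : WSOCTInstance R} (hpos : 0 < I.n) (Λ : List (Scheme c)) :
    ((mainStmt Λ).run I.start).num 0 = 1 ↔ ∃ L ∈ Λ, ∃ a, L.Succeeds I a := by
  classical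
  set s₀ := I.start with hs₀
  have n0 : s₀.num 0 = I.n := by
    simp [hs₀, WSOCTInstance.start, Instr.exec, WSOCTInstance.input]
  have n1 : s₀.num 1 = I.n - 1 := by
    simp [hs₀, WSOCTInstance.start, Instr.exec, WSOCTInstance.input]
  have n2 : s₀.num 2 = 2 * I.n := by
    simp [hs₀, WSOCTInstance.start, Instr.exec, WSOCTInstance.input, two_mul]
  have n3 : s₀.num 3 = 1 := by
    simp [hs₀, WSOCTInstance.start, Instr.exec, WSOCTInstance.input]
  have n4 : s₀.num 4 = 0 := by
    simp [hs₀, WSOCTInstance.start, Instr.exec, WSOCTInstance.input]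
  have n6 : s₀.num 6 = 0 := by
    simp [hs₀, WSOCTInstance.start, Instr.exec, WSOCTInstance.input]
  have n7 : s₀.num 7 = 0 := by
    simp [hs₀, WSOCTInstance.start, Instr.exec, WSOCTInstance.input]
  -- The machine cannot multiply, so the row offsets of the adjacency and capacity matrices are
  -- tabulated by repeated addition in the variables `6` and `7`, which are initially zero.
  have hrow := Stmt.for_rule (i := 10) (m := 2 * I.n) (s := s₀) (b := 2)
    (S := .seq (.instr (.store 2 10 6)) <| .seq (.instr (.add 6 6 0)) <|
    .seq (.instr (.store 3 10 7)) <| .seq (.instr (.add 7 7 2)) (.instr (.add 7 7 3))) n2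
    (by simp [Stmt.Avoids, Instr.Avoids])
    (fun k s' => (s'.num 0 = I.n ∧ s'.num 1 = I.n - 1 ∧ s'.num 2 = 2 * I.n ∧ s'.num 3 = 1 ∧
      s'.num 4 = 0 ∧ s'.num 6 = k * I.n ∧ s'.num 7 = k * (2 * I.n + 1)) ∧
      s'.wt = I.input.wt ∧ s'.warr = I.input.warr ∧ s'.arr 0 = I.input.arr 0 ∧
      s'.arr 1 = I.input.arr 1 ∧ (∀ u < k, s'.arr 2 u = u * I.n ∧
        s'.arr 3 u = u * (2 * I.n + 1)))
    (by simp [Memory.setNum_num, n0, n1, n2, n3, n4, n6, n7]; exact ⟨rfl, rfl, rfl, rfl⟩) ?_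
  swap
  · rintro k hk s' h10 ⟨⟨a0, a1, a2, a3, a4, a6, a7⟩, b1, b2, b3, b4, b5⟩
    refine ⟨?_, b1, b2, ?_, ?_, fun u hu => ?_⟩
    · simp [Stmt.run, Instr.exec, Memory.setNum, a0, a1, a2, a3, a4, a6, a7, h10]
      constructor <;> ring
    · simpa [Stmt.run, Instr.exec, Memory.setNum, Function.update_apply] using b3
    · simpa [Stmt.run, Instr.exec, Memory.setNum, Function.update_apply] using b4
    · simp only [Stmt.run, Instr.exec, Memory.setNum, Function.update_apply, h10, a6, a7]
      rcases Nat.lt_succ_iff_lt_or_eq.1 hu with hu | rfl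
      · simp [hu.ne, b5 u hu]
      · simp
  rw [mainStmt, Stmt.run_seq, Stmt.run_seq, Stmt.run_seq, rowStmt]
  generalize Stmt.run (Stmt.for_ 10 2 _) s₀ = s₁ at *
  obtain ⟨⟨a0, a1, a2, a3, a4, -, -⟩, b1, b2, b3, b4, b5⟩ := hrow
  set g : ℕ → R := fun v => if hv : v < I.n then I.w ⟨v, hv⟩ else 0 with hg
  have htot := Stmt.for_rule (i := 10) (m := I.n - 1) (s := s₁) (b := 1)
    (S := .seq (.instr (.wload 4 0 10)) (.instr (.wadd 2 2 4))) a1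
    (by simp [Stmt.Avoids, Instr.Avoids])
    (fun k s' => (s'.num 0 = I.n ∧ s'.num 1 = I.n - 1 ∧ s'.num 2 = 2 * I.n ∧ s'.num 3 = 1 ∧
      s'.num 4 = 0) ∧ s'.arr = s₁.arr ∧ s'.warr = s₁.warr ∧ s'.wt 0 = I.k ∧ s'.wt 1 = 0 ∧
      s'.wt 2 = ∑ v ∈ Finset.range k, g v)
    (by
      simp [Memory.setNum_num, a0, a1, a2, a3, a4]
      simp [Memory.setNum, b1, WSOCTInstance.input]) ?_
  swap
  · rintro k hk s' h10 ⟨⟨c0, c1, c2, c3, c4⟩, d1, d2, d3, d4, d5⟩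
    have hkn : k < I.n := by omega
    have hw := I.input_weight ⟨k, hkn⟩
    have hgk : g k = I.w ⟨k, hkn⟩ := by simp [hg, hkn]
    refine ⟨?_, d1, d2, ?_, ?_, ?_⟩
    · simp [Stmt.run, Instr.exec, Memory.setNum, c0, c1, c2, c3, c4]
    · simpa [Stmt.run, Instr.exec, Memory.setNum] using d3
    · simpa [Stmt.run, Instr.exec, Memory.setNum] using d4
    · rw [Finset.sum_range_succ, hgk]
      simp only [] at hw
      simp [Stmt.run, Instr.exec, Memory.setNum, d5, d2, b2, h10, hw]
  rw [totalStmt]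
  generalize Stmt.run (Stmt.for_ 10 1 _) s₁ = s₂ at *
  obtain ⟨⟨c0, c1, c2, c3, c4⟩, d1, d2, d3, d4, d5⟩ := htot
  have hst : I.Stored s₂ := by
    refine ⟨c0, c1, c2, c3, by rw [d1, b3], by rw [d1, b4],
      fun u hu => by rw [d1]; exact (b5 u (by omega)).1,
      fun u hu => by rw [d1]; exact (b5 u (by omega)).2, d3, d4, ?_, by rw [d2, b2]⟩
    rw [d5, Nat.sub_add_cancel hpos, Finset.sum_range]
    exact Finset.sum_congr rfl fun v _ => by simp [hg]
  obtain ⟨-, e1⟩ := run_schemesStmt hpos Λ s₂ hst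
  have : ((Stmt.seq (.instr (.set 5 0)) (.instr (.add 0 4 5))).run ((schemesStmt Λ).run s₂)).num 0 =
      ((schemesStmt Λ).run s₂).num 4 := by
    simp [Stmt.run, Instr.exec]
  rw [this, e1, c4]
  simp

/-- The program decides in polynomial time whether one of the schemes succeeds. -/
theorem mainProgram_runs {c : ℕ} (Λ : List (Scheme c)) :
    ∃ p : Polynomial ℕ, ∀ I : WSOCTInstance R, ∃ (t : ℕ) (s : Memory R),
      Runs (CostModel.uniform R) (mainProgram Λ) I.input t s ∧ t ≤ p.eval I.n ∧
        (s.num 0 = 1 ↔ I.n = 0 ∨ ∃ L ∈ Λ, ∃ a, L.Succeeds I a) := by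
  open Polynomial in
  refine ⟨4 + (mainStmt Λ).time.comp (2 * X + 1), fun I => ?_⟩
  have hlen : (Polynomial.eval I.n ((4 : Polynomial ℕ) +
      (mainStmt Λ).time.comp (2 * Polynomial.X + 1))) =
      4 + (mainStmt Λ).time.eval (2 * I.n + 1) := by
    simp [Polynomial.eval_comp]
  rw [hlen]
  have h0 : ((Instr.set 3 1).exec I.input).num 0 = I.n := by
    simp [Instr.exec, WSOCTInstance.input]
  have h3 : ((Instr.set 3 1).exec I.input).num 3 = 1 := by
    simp [Instr.exec]
  -- The empty graph is treated apart: the vertex loops always run at least once, so they need a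
  -- vertex.
  rcases Nat.eq_zero_or_pos I.n with hn | hn
  · refine ⟨_, _, Runs.seq (Runs.instr _ _) (Runs.ite_false ?_ (Runs.instr _ _)), ?_, ?_⟩
    · simp only [Test.Holds]
      omega
    · rw [Instr.cost_uniform, Instr.cost_uniform, Test.cost_uniform]
      omega
    · simp [Instr.exec, hn]
  · have n1 : I.start.num 1 = I.n - 1 := by
      simp [WSOCTInstance.start, Instr.exec, WSOCTInstance.input]
    have n2 : I.start.num 2 = 2 * I.n := by
      simp [WSOCTInstance.start, Instr.exec, WSOCTInstance.input, two_mul]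
    have n3 : I.start.num 3 = 1 := by
      simp [WSOCTInstance.start, Instr.exec, WSOCTInstance.input]
    obtain ⟨t, ht, hb⟩ := Stmt.exists_runs (2 * I.n + 1) (mainStmt Λ) (mainStmt_loopsOk Λ)
      (mainStmt_avoids Λ (by omega) (by omega)) (mainStmt_avoids Λ (by omega) (by omega))
      (mainStmt_avoids Λ (by omega) (by omega)) I.start n3 (by omega) (by omega)
    refine ⟨_, _, Runs.seq (Runs.instr _ _) (Runs.ite_true ?_ (Runs.seq (Runs.instr _ _)
      (Runs.seq (Runs.instr _ _) ht))), ?_, ?_⟩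
    · simp only [Test.Holds]
      omega
    · rw [Instr.cost_uniform, Instr.cost_uniform, Instr.cost_uniform, Test.cost_uniform]
      omega
    · rw [run_mainStmt hn]
      simp [hn.ne']

end

/-! ### Paths and their parities -/

namespace SimpleGraph

variable {V W : Type*} {G : SimpleGraph V}

/-- `G.PathOn A e a b`: the set `A` is the vertex set of a path from `a` to `b` in `G` whose length
has the parity `e`. -/
inductive PathOn (G : SimpleGraph V) : Set V → ZMod 2 → V → V → Prop
  | nil (a : V) : PathOn G {a} 0 a a
  | cons {A : Set V} {e : ZMod 2} {a b c : V} (h : G.Adj a b) (ha : a ∉ A)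
      (p : PathOn G A e b c) : PathOn G (insert a A) (e + 1) a c

namespace PathOn

variable {A B : Set V} {e e' : ZMod 2} {a b c d : V}

theorem left_mem (h : G.PathOn A e a b) : a ∈ A := by
  cases h <;> simp

theorem right_mem (h : G.PathOn A e a b) : b ∈ A := by
  induction h with
  | nil => simp
  | cons _ _ _ ih => exact Or.inr ih

theorem eq_singleton (h : G.PathOn A e a a) : A = {a} ∧ e = 0 := by
  cases h with
  | nil => exact ⟨rfl, rfl⟩
  | cons _ ha p => exact absurd p.right_mem ha

theorem append (h : G.PathOn A e a b) (h' : G.PathOn B e' b c) (hAB : A ∩ B ⊆ {b}) :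
    G.PathOn (A ∪ B) (e + e') a c := by
  induction h with
  | nil a =>
    rw [zero_add, Set.union_eq_self_of_subset_left (Set.singleton_subset_iff.2 h'.left_mem)]
    exact h'
  | @cons A e a x b hax ha p ih =>
    rw [Set.insert_union, add_right_comm]
    refine .cons hax ?_ (ih h' fun y hy => hAB ⟨Or.inr hy.1, hy.2⟩)
    rintro (haA | haB)
    · exact ha haA
    · have := hAB ⟨Set.mem_insert _ _, haB⟩
      rw [Set.mem_singleton_iff] at this
      exact ha (this ▸ p.right_mem)

theorem ofAdj (h : G.Adj a b) : G.PathOn {a, b} 1 a b := by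
  simpa using PathOn.cons h (by simpa using h.ne) (.nil b)

theorem symm (h : G.PathOn A e a b) : G.PathOn A e b a := by
  induction h with
  | nil a => exact .nil a
  | @cons A e a x b hax ha p ih =>
    have := ih.append (ofAdj hax.symm) ?_
    · convert this using 1
      ext y
      simp only [Set.mem_insert_iff, Set.mem_union, Set.mem_singleton_iff]
      have := p.left_mem
      constructor
      · rintro (rfl | hy)
        · exact Or.inr (Or.inr rfl)
        · exact Or.inl hy
      · rintro (hy | rfl | rfl)
        · exact Or.inr hy
        · exact Or.inr this
        · exact Or.inl rfl
    · rintro y ⟨hy, rfl | rfl⟩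
      · rfl
      · exact absurd hy ha

/-- Two disjoint paths are joined by an edge. -/
theorem join (h : G.PathOn A e a b) (hbc : G.Adj b c) (h' : G.PathOn B e' c d)
    (hAB : Disjoint A B) : G.PathOn (A ∪ B) (e + e' + 1) a d := by
  have hb : b ∉ B := Set.disjoint_left.1 hAB h.right_mem
  have := h.append (.cons hbc hb h') ?_
  · rw [add_assoc]
    convert this using 1
    ext y
    simp only [Set.mem_insert_iff, Set.mem_union]
    have := h.right_mem
    constructor
    · rintro (hy | hy)
      · exact Or.inl hy
      · exact Or.inr (Or.inr hy)
    · rintro (hy | rfl | hy)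
      · exact Or.inl hy
      · exact Or.inl this
      · exact Or.inr hy
  · rintro y ⟨hy, rfl | hy'⟩
    · rfl
    · exact absurd hy' (Set.disjoint_left.1 hAB hy)

/-- A path is cut at the first vertex that lies in `S`. -/
theorem split (h : G.PathOn A e a b) (S : Set V) (hS : (A ∩ S).Nonempty) :
    ∃ z A₁ A₂ e₁ e₂, G.PathOn A₁ e₁ a z ∧ G.PathOn A₂ e₂ z b ∧ A₁ ∪ A₂ = A ∧ A₁ ∩ A₂ = {z} ∧
      A₁ ∩ S = {z} ∧ e₁ + e₂ = e := by
  induction h with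
  | nil a =>
    obtain ⟨x, rfl, hx⟩ := hS
    exact ⟨x, {x}, {x}, 0, 0, .nil x, .nil x, by simp, by simp, by simpa using hx, by simp⟩
  | @cons A e a x b hax ha p ih =>
    by_cases haS : a ∈ S
    · exact ⟨a, {a}, insert a A, 0, e + 1, .nil a, .cons hax ha p, by simp, by simp,
        by simpa using haS, by simp⟩
    · obtain ⟨z, A₁, A₂, e₁, e₂, h₁, h₂, rfl, hI, hIS, rfl⟩ := ih (by
        obtain ⟨y, rfl | hy, hyS⟩ := hS
        · exact absurd hyS haS
        · exact ⟨y, hy, hyS⟩)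
      have ha' : a ∉ A₁ ∧ a ∉ A₂ := by simpa [not_or] using ha
      refine ⟨z, insert a A₁, A₂, e₁ + 1, e₂, .cons hax ha'.1 h₁, h₂, by rw [Set.insert_union],
        ?_, ?_, by ring⟩
      · rw [Set.insert_inter_of_notMem ha'.2, hI]
      · rw [Set.insert_inter_of_notMem haS, hIS]

theorem split_mem (h : G.PathOn A e a b) (hc : c ∈ A) :
    ∃ A₁ A₂ e₁ e₂, G.PathOn A₁ e₁ a c ∧ G.PathOn A₂ e₂ c b ∧ A₁ ∪ A₂ = A ∧ A₁ ∩ A₂ = {c} ∧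
      e₁ + e₂ = e := by
  obtain ⟨z, A₁, A₂, e₁, e₂, h₁, h₂, h3, h4, h5, h6⟩ := h.split {c} ⟨c, hc, rfl⟩
  have : z ∈ A₁ ∩ {c} := h5 ▸ Set.mem_singleton z
  obtain rfl : z = c := this.2
  exact ⟨A₁, A₂, e₁, e₂, h₁, h₂, h3, h4, h6⟩

/-- The last vertex of a path with at least one edge has a neighbor on the path. -/
theorem exists_adj (h : G.PathOn A e a b) (hab : a ≠ b) : ∃ x ∈ A, x ≠ b ∧ G.Adj x b := by
  cases h.symm with
  | nil => exact absurd rfl hab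
  | cons hbx hb p => exact ⟨_, Or.inr p.left_mem, fun hx => hb (hx ▸ p.left_mem), hbx.symm⟩

theorem map {G' : SimpleGraph W} {φ : V → W} (h : G.PathOn A e a b) (hφ : Set.InjOn φ A)
    (hadj : ∀ x ∈ A, ∀ y ∈ A, G.Adj x y → G'.Adj (φ x) (φ y)) :
    G'.PathOn (φ '' A) e (φ a) (φ b) := by
  induction h with
  | nil a =>
    rw [Set.image_singleton]
    exact .nil _
  | @cons A e a x b hax ha p ih =>
    rw [Set.image_insert_eq]
    refine .cons (hadj a (Or.inl rfl) x (Or.inr p.left_mem) hax) ?_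
      (ih (hφ.mono (Set.subset_insert _ _)) fun y hy z hz => hadj y (Or.inr hy) z (Or.inr hz))
    rintro ⟨y, hy, hya⟩
    exact ha (hφ (Or.inr hy) (Or.inl rfl) hya ▸ hy)

theorem exists_walk (h : G.PathOn A e a b) :
    ∃ p : G.Walk a b, p.IsPath ∧ {x | x ∈ p.support} = A ∧ (p.length : ZMod 2) = e := by
  induction h with
  | nil a => exact ⟨.nil, by simp, by simp, by simp⟩
  | @cons A e a x b hax ha p ih =>
    obtain ⟨q, hq, rfl, rfl⟩ := ih
    exact ⟨.cons hax q, hq.cons ha, by simp [Set.ext_iff], by simp⟩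

end PathOn

theorem Walk.IsPath.pathOn {a b : V} {p : G.Walk a b} (h : p.IsPath) :
    G.PathOn {x | x ∈ p.support} p.length a b := by
  induction p with
  | nil => simpa using PathOn.nil (G := G) _
  | @cons u v w huv p ih =>
    rw [Walk.cons_isPath_iff] at h
    have := PathOn.cons huv h.2 (ih h.1)
    convert this using 1
    · ext y
      simp
    · simp

/-- No cycle of odd length inside `B` contains a vertex of `T`. -/
def OddFree (G : SimpleGraph V) (T B : Set V) : Prop :=
  ∀ t ∈ T, ∀ u, G.Adj t u → ∀ A ⊆ B, ¬ G.PathOn A 0 u t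

theorem OddFree.mono {T B B' : Set V} (h : G.OddFree T B') (hB : B ⊆ B') : G.OddFree T B :=
  fun t ht u hu A hA => h t ht u hu A (hA.trans hB)

/-- An odd cycle rotated to start at a vertex `t` of `T` is an edge `tu` followed by an even path
back from `u` to `t`. Conversely, such a path does not use the edge `tu`, because it would then have
length one, so closing it gives a cycle. -/
theorem isOddCycleTransversal_iff {T S : Set V} :
    G.IsOddCycleTransversal T S ↔ G.OddFree T Sᶜ := by
  classical
  constructor
  · intro h t ht u htu A hA hp
    obtain ⟨p, hpp, rfl, hl⟩ := hp.exists_walk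
    have hl' : Even p.length := (ZMod.natCast_eq_zero_iff_even).1 hl
    have hc : (Walk.cons htu p).IsCycle := by
      rw [Walk.cons_isCycle_iff]
      refine ⟨hpp, fun he => ?_⟩
      rw [Sym2.eq_swap] at he
      rw [hpp.length_eq_one_of_mem_edges he] at hl'
      exact absurd hl' (by decide)
    obtain ⟨x, hxS, hx⟩ := h t _ hc (by simpa using hl'.add_one) ⟨t, ht, by simp⟩
    rw [Walk.support_cons, List.mem_cons] at hx
    rcases hx with rfl | hx
    · exact hA (show x ∈ p.support from p.end_mem_support) hxS
    · exact hA hx hxS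
  · rintro h v C hC hodd ⟨t, ht, htC⟩
    by_contra! hS
    set C' := C.rotate t htC with hC'
    have hcyc : C'.IsCycle := hC.rotate htC
    have hlen : C'.length = C.length := Walk.length_rotate ..
    have hsup : ∀ x ∈ C'.support, x ∉ S := fun x hx hxS =>
      hS x hxS ((Walk.mem_support_rotate_iff ..).1 hx)
    clear_value C'
    cases C' with
    | nil => simp at hcyc
    | cons htu p =>
      rw [Walk.cons_isCycle_iff] at hcyc
      have hev : Even p.length := by
        rw [← hlen, Walk.length_cons, Nat.odd_add_one, Nat.not_odd_iff_even] at hodd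
        exact hodd
      refine h t ht _ htu {x | x ∈ p.support} (fun x hx => hsup x ?_) ?_
      · rw [Walk.support_cons]
        exact List.mem_cons_of_mem _ hx
      · rw [← hev.natCast_zmod_two]
        exact hcyc.1.pathOn

end SimpleGraph

/-! ### Sets whose vertices are joined by paths of both parities -/

namespace SimpleGraph

variable {V W : Type*} {G : SimpleGraph V} {B D D' : Set V} {e : ZMod 2} {a b : V}

/-- Some path from `a` to `b` inside `B` has the parity `e`. -/
def PathIn (G : SimpleGraph V) (B : Set V) (e : ZMod 2) (a b : V) : Prop :=
  ∃ A ⊆ B, G.PathOn A e a b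

theorem PathIn.mono {B'} (h : G.PathIn B e a b) (hB : B ⊆ B') : G.PathIn B' e a b :=
  let ⟨A, hA, p⟩ := h
  ⟨A, hA.trans hB, p⟩

theorem PathIn.symm (h : G.PathIn B e a b) : G.PathIn B e b a :=
  let ⟨A, hA, p⟩ := h
  ⟨A, hA, p.symm⟩

/-- Any two vertices of `D` are joined inside `D` by paths of both parities. -/
def Biparity (G : SimpleGraph V) (D : Set V) : Prop :=
  ∀ a ∈ D, ∀ b ∈ D, a ≠ b → ∀ e, G.PathIn D e a b

theorem Biparity.exists_pathIn (h : G.Biparity D) (ha : a ∈ D) (hb : b ∈ D) :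
    ∃ e, G.PathIn D e a b := by
  by_cases hab : a = b
  · subst hab
    exact ⟨0, {a}, by simpa using ha, .nil a⟩
  · exact ⟨0, h a ha b hb hab 0⟩

/-- The vertices of an odd cycle are joined by paths of both parities. -/
theorem PathOn.biparity {A : Set V} {t u : V} (h : G.PathOn A 0 u t) (htu : G.Adj t u) :
    G.Biparity A := by
  -- The cycle splits into two arcs between `a` and `b`: the piece `M`, and the rest, which passes
  -- through the edge `tu`. Their lengths add up to an odd number, so their parities differ.
  have key : ∀ {A₁ M Z : Set V} {e₁ e₂ e₃ : ZMod 2} {a b : V}, G.PathOn A₁ e₁ u a →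
      G.PathOn M e₂ a b → G.PathOn Z e₃ b t → e₁ + e₂ + e₃ = 0 → Disjoint A₁ Z →
      A₁ ⊆ A → M ⊆ A → Z ⊆ A → ∀ e, G.PathIn A e a b := by
    intro A₁ M Z e₁ e₂ e₃ a b h₁ h₂ h₃ he hd i₁ i₂ i₃ e
    by_cases hee : e = e₂
    · exact ⟨M, i₂, hee ▸ h₂⟩
    · refine ⟨A₁ ∪ Z, Set.union_subset i₁ i₃, ?_⟩
      have : e = e₁ + e₃ + 1 := by
        clear h₁ h₂ h₃
        revert e e₁ e₂ e₃
        decide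
      rw [this]
      exact h₁.symm.join htu.symm h₃.symm hd
  intro a ha b hb hab e
  obtain ⟨A₁, A₂, e₁, e₂, h₁, h₂, rfl, hI, he⟩ := h.split_mem ha
  rcases hb with hb | hb
  · obtain ⟨B₁, B₂, f₁, f₂, g₁, g₂, rfl, hJ, rfl⟩ := h₁.split_mem hb
    refine (key g₁ g₂ h₂ he ?_ ?_ ?_ ?_ e).symm
    · rw [Set.disjoint_left]
      intro x hx hx'
      have hxa : x ∈ ({a} : Set V) := hI ▸ ⟨Or.inl hx, hx'⟩
      obtain rfl : x = a := hxa
      have : x ∈ ({b} : Set V) := hJ ▸ ⟨hx, g₂.right_mem⟩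
      exact hab this
    · exact fun x hx => Or.inl (Or.inl hx)
    · exact fun x hx => Or.inl (Or.inr hx)
    · exact fun x hx => Or.inr hx
  · obtain ⟨B₁, B₂, f₁, f₂, g₁, g₂, rfl, hJ, rfl⟩ := h₂.split_mem hb
    refine key h₁ g₁ g₂ (by rw [add_assoc, he]) ?_ ?_ ?_ ?_ e
    · rw [Set.disjoint_left]
      intro x hx hx'
      have hxa : x ∈ ({a} : Set V) := hI ▸ ⟨hx, Or.inr hx'⟩
      obtain rfl : x = a := hxa
      have : x ∈ ({b} : Set V) := hJ ▸ ⟨g₁.left_mem, hx'⟩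
      exact hab this
    · exact fun x hx => Or.inl hx
    · exact fun x hx => Or.inr (Or.inl hx)
    · exact fun x hx => Or.inr (Or.inr hx)

/-- Any path from `t` to another vertex of `D` supplies a neighbor `u` of `t` in `D`, and the
biparity of `D` supplies an even way back. So every vertex of `D` lies on an odd cycle inside `D`.
-/
theorem Biparity.exists_odd (h : G.Biparity D) (hD : D.Nontrivial) {t : V} (ht : t ∈ D) :
    ∃ u, G.Adj t u ∧ G.PathIn D 0 u t := by
  obtain ⟨y, hy, hyt⟩ := hD.exists_ne t
  obtain ⟨e, A, hA, p⟩ := h.exists_pathIn ht hy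
  cases p with
  | nil => exact absurd rfl hyt
  | cons htu htA q =>
    have hu := hA (Or.inr q.left_mem)
    exact ⟨_, htu, h _ hu t ht (fun hh => htA (hh ▸ q.left_mem)) 0⟩

theorem OddFree.disjoint {T : Set V} (hB : G.OddFree T B) (h : G.Biparity D)
    (hD : D.Nontrivial) (hDB : D ⊆ B) : Disjoint T D := by
  rw [Set.disjoint_left]
  intro t ht htD
  obtain ⟨u, htu, A, hA, p⟩ := h.exists_odd hD htD
  exact hB t ht u htu A (hA.trans hDB) p

/-- There are three edges without a common vertex. -/
theorem Biparity.exists_edges (h : G.Biparity D) (hD : D.Nontrivial) :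
    ∃ t ∈ D, ∃ u ∈ D, ∃ c ∈ D, ∃ d ∈ D, G.Adj t u ∧ G.Adj u c ∧ G.Adj c d ∧ t ≠ c ∧ u ≠ d := by
  obtain ⟨t, ht⟩ := hD.nonempty
  obtain ⟨u, htu, A, hA, p⟩ := h.exists_odd hD ht
  generalize he : (0 : ZMod 2) = e at p
  cases p with
  | nil => exact absurd rfl htu.ne
  | @cons A e _ c _ huc hu q =>
    have hA' : A ⊆ D := fun x hx => hA (Or.inr hx)
    cases q with
    | nil =>
      rw [zero_add] at he
      exact absurd he (by decide)
    | @cons A f _ d _ hcd hc r =>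
      -- The edges `tu`, `uc`, `cd` are consecutive on an odd cycle; for a triangle `d` is `t`.
      refine ⟨t, ht, u, hA (Or.inl rfl), c, hA' (Or.inl rfl), d, hA' (Or.inr r.left_mem), htu, huc,
        hcd, ?_, ?_⟩
      · rintro rfl
        exact hc r.right_mem
      · rintro rfl
        exact hu (Or.inr r.left_mem)

theorem Biparity.exists_ne_ne (h : G.Biparity D) (hD : D.Nontrivial) (p q : V) :
    ∃ d ∈ D, d ≠ p ∧ d ≠ q := by
  obtain ⟨t, ht, u, hu, c, hc, -, -, htu, huc, -, htc, -⟩ := h.exists_edges hD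
  by_contra! hh
  have h1 := hh t ht
  have h2 := hh u hu
  have h3 := hh c hc
  have := htu.ne
  have := huc.ne
  by_cases htp : t = p <;> by_cases hup : u = p <;> by_cases hcp : c = p <;> simp_all

/-- To reach `a` from `v`, step to whichever of `x` and `y` differs from `a`, and continue inside
`D` with the opposite parity. -/
theorem Biparity.insert (h : G.Biparity D) {v x y : V} (hv : v ∉ D) (hx : x ∈ D) (hy : y ∈ D)
    (hxy : x ≠ y) (hvx : G.Adj v x) (hvy : G.Adj v y) : G.Biparity (insert v D) := by
  have key : ∀ a ∈ D, ∀ e, G.PathIn (Insert.insert v D) e v a := by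
    intro a ha e
    obtain ⟨z, hz, hza, hvz⟩ : ∃ z ∈ D, z ≠ a ∧ G.Adj v z := by
      by_cases hxa : x = a
      · exact ⟨y, hy, hxa ▸ hxy.symm, hvy⟩
      · exact ⟨x, hx, hxa, hvx⟩
    obtain ⟨A, hA, p⟩ := h z hz a ha hza (e + 1)
    refine ⟨_, Set.insert_subset_insert hA, ?_⟩
    have := PathOn.cons hvz (fun hh => hv (hA hh)) p
    rwa [add_assoc, CharTwo.add_self_eq_zero, add_zero] at this
  rintro a (rfl | ha) b (rfl | hb) hab e
  · exact absurd rfl hab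
  · exact key b hb e
  · exact (key a ha e).symm
  · exact (h a ha b hb hab e).mono (Set.subset_insert _ _)

/-- From `a` follow a path in `D` up to its first vertex in `D'`, then correct the parity on the way
to `b` inside `D'`. That first vertex differs from `b`, which is not in `D`. -/
theorem Biparity.union (h : G.Biparity D) (h' : G.Biparity D') (hi : (D ∩ D').Nonempty) :
    G.Biparity (D ∪ D') := by
  have key : ∀ a ∈ D, ∀ b ∈ D', a ∉ D' → b ∉ D → ∀ e, G.PathIn (D ∪ D') e a b := by
    intro a ha b hb ha' hb' e
    obtain ⟨w, hw, hw'⟩ := hi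
    obtain ⟨f, A, hA, p⟩ := h.exists_pathIn ha hw
    obtain ⟨z, A₁, A₂, e₁, e₂, p₁, -, rfl, -, hz, -⟩ := p.split D' ⟨w, p.right_mem, hw'⟩
    have hzD : z ∈ D' := (hz ▸ Set.mem_singleton z : z ∈ A₁ ∩ D').2
    have hzb : z ≠ b := fun hh => hb' (hh ▸ hA (Or.inl p₁.right_mem))
    obtain ⟨C, hC, q⟩ := h' z hzD b hb hzb (e - e₁)
    refine ⟨A₁ ∪ C, Set.union_subset_union (Set.subset_union_left.trans hA) hC, ?_⟩
    have := p₁.append q (fun x hx => hz ▸ ⟨hx.1, hC hx.2⟩)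
    rwa [add_sub_cancel] at this
  intro a ha b hb hab e
  by_cases h1 : a ∈ D ∧ b ∈ D
  · exact (h a h1.1 b h1.2 hab e).mono Set.subset_union_left
  by_cases h2 : a ∈ D' ∧ b ∈ D'
  · exact (h' a h2.1 b h2.2 hab e).mono Set.subset_union_right
  rcases ha with ha | ha
  · have hb1 : b ∉ D := fun hh => h1 ⟨ha, hh⟩
    have hb2 : b ∈ D' := hb.resolve_left hb1
    exact key a ha b hb2 (fun hh => h2 ⟨hh, hb2⟩) hb1 e
  · have hb1 : b ∉ D' := fun hh => h2 ⟨ha, hh⟩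
    have hb2 : b ∈ D := hb.resolve_right hb1
    exact (key b hb2 a ha hb1 (fun hh => h1 ⟨hh, hb2⟩) e).symm

/-- With two different edges between the sets, one of them does not join `a` directly to `b`. On at
least one side of this edge there is then a nontrivial stretch on which the parity can be chosen. -/
theorem Biparity.union_of_adj (h : G.Biparity D) (h' : G.Biparity D') (hd : Disjoint D D')
    {x y x' y' : V} (hx : x ∈ D) (hy : y ∈ D) (hx' : x' ∈ D') (hy' : y' ∈ D')
    (hxx : G.Adj x x') (hyy : G.Adj y y') (hne : ¬ (x = y ∧ x' = y')) :
    G.Biparity (D ∪ D') := by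
  have key : ∀ a ∈ D, ∀ b ∈ D', ∀ e, G.PathIn (D ∪ D') e a b := by
    intro a ha b hb e
    obtain ⟨z, hz, z', hz', hzz, hab⟩ : ∃ z ∈ D, ∃ z' ∈ D', G.Adj z z' ∧ ¬ (a = z ∧ z' = b) := by
      by_cases hh : a = x ∧ x' = b
      · exact ⟨y, hy, y', hy', hyy, fun h2 => hne ⟨hh.1.symm.trans h2.1, hh.2.trans h2.2.symm⟩⟩
      · exact ⟨x, hx, x', hx', hxx, hh⟩
    obtain ⟨f, f', p, q, hf⟩ : ∃ f f', G.PathIn D f a z ∧ G.PathIn D' f' z' b ∧ f + f' + 1 = e := by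
      by_cases haz : a = z
      · obtain ⟨f, hf⟩ := h.exists_pathIn ha hz
        exact ⟨f, e - 1 - f, hf, h' z' hz' b hb (fun hh => hab ⟨haz, hh⟩) _, by ring⟩
      · obtain ⟨f, hf⟩ := h'.exists_pathIn hz' hb
        exact ⟨e - 1 - f, f, h a ha z hz haz _, hf, by ring⟩
    obtain ⟨A, hA, p⟩ := p
    obtain ⟨C, hC, q⟩ := q
    exact ⟨A ∪ C, Set.union_subset_union hA hC, hf ▸ p.join hzz q (hd.mono hA hC)⟩
  rintro a (ha | ha) b (hb | hb) hab e
  · exact (h a ha b hb hab e).mono Set.subset_union_left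
  · exact key a ha b hb e
  · exact (key b hb a ha e).symm
  · exact (h' a ha b hb hab e).mono Set.subset_union_right

/-! ### Bipartite sets -/

/-- `B` contains no odd cycle. -/
def NoOdd (G : SimpleGraph V) (B : Set V) : Prop :=
  G.OddFree Set.univ B

/-- A walk is shortened to a path of the same parity: when a new first vertex `u` already lies on
the path, the closed part that is cut off has even length because there is no odd cycle. -/
theorem NoOdd.exists_pathIn (h : G.NoOdd B) {u v : B} (p : (G.induce B).Walk u v) :
    G.PathIn B p.length u v := by
  induction p with
  | @nil u => exact ⟨{(u : V)}, by simp, by simpa using PathOn.nil (G := G) (u : V)⟩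
  | @cons u x v hux p ih =>
    obtain ⟨A, hA, q⟩ := ih
    have hadj : G.Adj u x := hux
    by_cases hu : (u : V) ∈ A
    · obtain ⟨A₁, A₂, e₁, e₂, q₁, q₂, rfl, -, he⟩ := q.split_mem hu
      have he₁ : e₁ ≠ 0 := by
        rintro rfl
        exact h u trivial x hadj A₁ (Set.subset_union_left.trans hA) q₁
      refine ⟨A₂, Set.subset_union_right.trans hA, ?_⟩
      have : ((Walk.cons hux p).length : ZMod 2) = e₂ := by
        rw [Walk.length_cons, Nat.cast_add, ← he]
        clear q₁ q₂ he
        push_cast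
        revert e₁ e₂
        decide
      rw [this]
      exact q₂
    · refine ⟨_, Set.insert_subset u.2 hA, ?_⟩
      simpa using PathOn.cons hadj hu q

/-- A set without odd cycles is the union of two independent sets. -/
theorem NoOdd.exists_bipartition (h : G.NoOdd B) :
    ∃ X Y : Set V, X ∪ Y = B ∧ Disjoint X Y ∧ (∀ x ∈ X, ∀ y ∈ X, ¬ G.Adj x y) ∧
      ∀ x ∈ Y, ∀ y ∈ Y, ¬ G.Adj x y := by
  -- A closed walk has the parity of a path from a vertex to itself, which is trivial; so all closed
  -- walks are even.
  have h2 : (G.induce B).Colorable 2 := by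
    rw [two_colorable_iff_forall_loop_even]
    intro u w
    obtain ⟨A, -, p⟩ := h.exists_pathIn w
    exact ZMod.natCast_eq_zero_iff_even.1 p.eq_singleton.2
  obtain ⟨f⟩ := h2
  refine ⟨{x | ∃ hx : x ∈ B, f ⟨x, hx⟩ = 0}, {x | ∃ hx : x ∈ B, f ⟨x, hx⟩ = 1}, ?_, ?_, ?_, ?_⟩
  · ext x
    constructor
    · rintro (⟨hx, -⟩ | ⟨hx, -⟩) <;> exact hx
    · intro hx
      rcases Fin.exists_fin_two.1 ⟨f ⟨x, hx⟩, rfl⟩ with h0 | h1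
      · exact Or.inl ⟨hx, h0⟩
      · exact Or.inr ⟨hx, h1⟩
  · rw [Set.disjoint_left]
    rintro x ⟨hx, h0⟩ ⟨_, h1⟩
    rw [h0] at h1
    exact absurd h1 (by decide)
  · rintro x ⟨hx, h0⟩ y ⟨hy, h1⟩ hxy
    exact f.valid (v := ⟨x, hx⟩) (w := ⟨y, hy⟩) hxy (h0.trans h1.symm)
  · rintro x ⟨hx, h0⟩ y ⟨hy, h1⟩ hxy
    exact f.valid (v := ⟨x, hx⟩) (w := ⟨y, hy⟩) hxy (h0.trans h1.symm)

theorem noOdd_of_bipartition {X Y : Set V} (hX : ∀ x ∈ X, ∀ y ∈ X, ¬ G.Adj x y)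
    (hY : ∀ x ∈ Y, ∀ y ∈ Y, ¬ G.Adj x y) : G.NoOdd (X ∪ Y) := by
  have key : ∀ {A e a b}, G.PathOn A e a b → A ⊆ X ∪ Y → (e = 0 ↔ (a ∈ X ↔ b ∈ X)) := by
    intro A e a b p
    induction p with
    | nil => simp
    | @cons A e a x b hax _ p ih =>
      intro hA
      have h1 := ih ((Set.subset_insert _ _).trans hA)
      have ha := hA (Or.inl rfl)
      have hx := hA (Or.inr p.left_mem)
      have h2 : a ∈ X ↔ x ∉ X := by
        constructor
        · exact fun h3 h4 => hX a h3 x h4 hax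
        · intro h3
          by_contra h4
          exact hY a (ha.resolve_left h4) x (hx.resolve_left h3) hax
      have h3 : e + 1 = 0 ↔ ¬ e = 0 := by
        clear p ih h1
        revert e
        decide
      rw [h3, h1, h2]
      tauto
  intro t _ u htu A hA p
  have h1 := (key p hA).1 rfl
  have hu := hA p.left_mem
  have ht := hA p.right_mem
  by_cases h2 : t ∈ X
  · exact hX t h2 u (h1.2 h2) htu
  · exact hY t (ht.resolve_left h2) u (hu.resolve_left fun h3 => h2 (h1.1 h3)) htu

theorem exists_biparity (h : ¬ G.NoOdd B) : ∃ D ⊆ B, D.Nontrivial ∧ G.Biparity D := by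
  simp only [NoOdd, OddFree, not_forall, not_not] at h
  obtain ⟨t, -, u, htu, A, hA, p⟩ := h
  exact ⟨A, hA, ⟨t, p.right_mem, u, p.left_mem, htu.ne⟩, p.biparity htu⟩

end SimpleGraph

/-! ### The structure of graphs without odd `T`-cycles -/

namespace SimpleGraph

variable {V : Type*} {G : SimpleGraph V} {B D D₁ D₂ D₃ D₄ T : Set V}

/-- Three elements of `s` together with the edge `xy` would induce `3P₁ + P₂`. The absence of this
subgraph is used only in this form. -/
theorem IsInducedFree.card_le_two (hG : G.IsInducedFree threeP1AddP2) {x y : V} (hxy : G.Adj x y)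
    {s : Finset V} (hs : ∀ a ∈ s, ∀ b ∈ s, ¬ G.Adj a b)
    (hsxy : ∀ a ∈ s, ¬ G.Adj a x ∧ ¬ G.Adj a y) : s.card ≤ 2 := by
  by_contra! hc
  obtain ⟨a, ha, b, hb, c, hc, hab, hac, hbc⟩ := Finset.two_lt_card.1 hc
  have hne : ∀ {a}, a ∈ s → a ≠ x ∧ a ≠ y := fun {a} ha =>
    ⟨fun h => (hsxy a ha).2 (h ▸ hxy), fun h => (hsxy a ha).1 (h ▸ hxy.symm)⟩
  have h1 := hne ha
  have h2 := hne hb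
  have h3 := hne hc
  have h4 := hxy.ne
  have a1 := hsxy a ha
  have a2 := hsxy b hb
  have a3 := hsxy c hc
  have b1 := hs a ha b hb
  have b2 := hs a ha c hc
  have b3 := hs b hb c hc
  have ns : ∀ {p q}, ¬ G.Adj p q → ¬ G.Adj q p := fun h h' => h h'.symm
  obtain ⟨f, hf⟩ : ∃ f, f = Sum.elim (Sum.elim (Sum.elim (fun _ : Fin 1 => a) (fun _ : Fin 1 => b))
    (fun _ : Fin 1 => c)) ![x, y] := ⟨_, rfl⟩
  have hinj : f.Injective := by
    rintro (((u | u) | u) | u) (((v | v) | v) | v) huv <;> fin_cases u <;> fin_cases v <;>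
      simp [hf, h1, h2, h3, h4, hab, hac, hbc, h1.1.symm, h1.2.symm, h2.1.symm, h2.2.symm,
        h3.1.symm, h3.2.symm, h4.symm, hab.symm, hac.symm, hbc.symm] at huv ⊢
  have hadj : ∀ u v, G.Adj (f u) (f v) ↔ threeP1AddP2.Adj u v := by
    rintro (((u | u) | u) | u) (((v | v) | v) | v) <;> fin_cases u <;> fin_cases v <;>
      simp [hf, a1, a2, a3, b1, b2, b3, hxy, hxy.symm, ns a1.1, ns a1.2, ns a2.1,
        ns a2.2, ns a3.1, ns a3.2, ns b1, ns b2, ns b3, pathGraph_adj]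
  exact hG ⟨⟨⟨f, hinj⟩, hadj _ _⟩⟩

/-- Take three edges of `D` without a common vertex. A vertex of `s` has at most one neighbor in
`D`, so it misses both ends of one of these edges; and each edge is missed by at most two vertices
of an independent set. -/
theorem Biparity.ncard_le_six [Finite V] (hG : G.IsInducedFree threeP1AddP2) (h : G.Biparity D)
    (hD : D.Nontrivial) {s : Set V} (hs : ∀ a ∈ s, ∀ b ∈ s, ¬ G.Adj a b)
    (hsD : ∀ v ∈ s, ∀ x ∈ D, ∀ y ∈ D, G.Adj v x → G.Adj v y → x = y) : s.ncard ≤ 6 := by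
  classical
  have := Fintype.ofFinite V
  obtain ⟨t, ht, u, hu, c, hc, d, hd, htu, huc, hcd, htc, hud⟩ := h.exists_edges hD
  set f : V → V → Finset V := fun x y => {a ∈ s.toFinset | ¬ G.Adj a x ∧ ¬ G.Adj a y} with hf
  have hcard : ∀ x y, G.Adj x y → (f x y).card ≤ 2 := by
    intro x y hxy
    refine hG.card_le_two hxy (fun a ha b hb => ?_) fun a ha => (Finset.mem_filter.1 ha).2
    exact hs a (by simpa using (Finset.mem_filter.1 ha).1) b
      (by simpa using (Finset.mem_filter.1 hb).1)
  have hsub : s.toFinset ⊆ f t u ∪ f u c ∪ f c d := by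
    intro a ha
    have has : a ∈ s := by simpa using ha
    have key := hsD a has
    by_contra hcon
    simp only [hf, Finset.mem_union, Finset.mem_filter, ha, true_and, not_or, not_and_or,
      not_not] at hcon
    obtain ⟨⟨h1, h2⟩, h3⟩ := hcon
    rcases h2 with h2 | h2
    · rcases h3 with h3 | h3
      · exact huc.ne (key u hu c hc h2 h3)
      · exact hud (key u hu d hd h2 h3)
    · rcases h1 with h1 | h1
      · exact htc (key t ht c hc h1 h2)
      · exact huc.ne (key u hu c hc h1 h2)
  rw [Set.ncard_eq_toFinset_card']
  have := Finset.card_le_card hsub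
  have h1 := Finset.card_union_le (f t u ∪ f u c) (f c d)
  have h2 := Finset.card_union_le (f t u) (f u c)
  have := hcard t u htu
  have := hcard u c huc
  have := hcard c d hcd
  omega

/-- An inclusion-maximal subset of `B` whose vertices are joined by paths of both parities. -/
def Core (G : SimpleGraph V) (B D : Set V) : Prop :=
  Maximal (fun D => D ⊆ B ∧ D.Nontrivial ∧ G.Biparity D) D

theorem Core.subset (h : G.Core B D) : D ⊆ B := h.prop.1

theorem Core.nontrivial (h : G.Core B D) : D.Nontrivial := h.prop.2.1

theorem Core.biparity (h : G.Core B D) : G.Biparity D := h.prop.2.2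

/-- A vertex outside the core with two neighbors in it could be added to the core, contrary to
maximality. -/
theorem Core.eq_of_adj (h : G.Core B D) {v : V} (hv : v ∈ B) (hvD : v ∉ D) :
    ∀ x ∈ D, ∀ y ∈ D, G.Adj v x → G.Adj v y → x = y := by
  intro x hx y hy hvx hvy
  by_contra hxy
  exact hvD (h.le_of_ge ⟨Set.insert_subset hv h.subset, h.nontrivial.mono (Set.subset_insert _ _),
    h.biparity.insert hvD hx hy hxy hvx hvy⟩ (Set.subset_insert _ _) (Set.mem_insert _ _))

theorem Core.eq_of_adj_adj (h₁ : G.Core B D₁) (h₂ : G.Core B D₂) (hd : Disjoint D₁ D₂)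
    {x y x' y' : V} (hx : x ∈ D₁) (hy : y ∈ D₁) (hx' : x' ∈ D₂) (hy' : y' ∈ D₂)
    (hxx : G.Adj x x') (hyy : G.Adj y y') : x = y ∧ x' = y' := by
  by_contra hne
  have := h₁.le_of_ge ⟨Set.union_subset h₁.subset h₂.subset,
    h₁.nontrivial.mono Set.subset_union_left,
    h₁.biparity.union_of_adj h₂.biparity hd hx hy hx' hy' hxx hyy hne⟩ Set.subset_union_left
  exact Set.disjoint_left.1 hd (this (Or.inr hx')) hx'

/-- Packages "at most one" as a vertex to be avoided; `v` is a default value for the case that there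
is none. -/
theorem exists_forall_eq (v : V) {R : V → Prop} (h : ∀ x ∈ D, ∀ y ∈ D, R x → R y → x = y) :
    ∃ p, ∀ x ∈ D, R x → x = p := by
  by_cases hx : ∃ x ∈ D, R x
  · obtain ⟨p, hp, hR⟩ := hx
    exact ⟨p, fun x hx hRx => h x hx p hp hRx hR⟩
  · exact ⟨v, fun x hxD hRx => absurd ⟨x, hxD, hRx⟩ hx⟩

theorem Core.exists_forall_eq (h : G.Core B D) {v : V} (hv : v ∈ B) (hvD : v ∉ D) :
    ∃ p, ∀ x ∈ D, G.Adj v x → x = p :=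
  SimpleGraph.exists_forall_eq v (h.eq_of_adj hv hvD)

theorem Core.exists_forall_adj_eq (h₁ : G.Core B D₁) (h₂ : G.Core B D₂) (hd : Disjoint D₁ D₂) :
    ∃ p, ∀ x ∈ D₁, (∃ y ∈ D₂, G.Adj x y) → x = p := by
  obtain ⟨v, -⟩ := h₁.nontrivial.nonempty
  refine SimpleGraph.exists_forall_eq v ?_
  rintro x hx y hy ⟨x', hx', hxx⟩ ⟨y', hy', hyy⟩
  exact (h₁.eq_of_adj_adj h₂ hd hx hy hx' hy' hxx hyy).1

/-- The core grows from an odd cycle inside `S`. A core that misses `S` but meets the new one would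
absorb it by maximality, and with it the cycle. -/
theorem exists_core [Finite V] {S : Set V} (hS : ¬ G.NoOdd S) (hSB : S ⊆ B) :
    ∃ D, G.Core B D ∧ ∀ D', G.Core B D' → Disjoint D' S → Disjoint D' D := by
  obtain ⟨A, hA, hnt, hbp⟩ := exists_biparity hS
  obtain ⟨D, hAD, hD⟩ := Finite.exists_le_maximal
    (p := fun D => D ⊆ B ∧ D.Nontrivial ∧ G.Biparity D) ⟨hA.trans hSB, hnt, hbp⟩
  refine ⟨D, hD, fun D' hD' hd => ?_⟩
  by_contra hn
  rw [Set.not_disjoint_iff_nonempty_inter] at hn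
  have := hD'.le_of_ge ⟨Set.union_subset hD'.subset (Core.subset hD),
    hD'.nontrivial.mono Set.subset_union_left, hD'.biparity.union (Core.biparity hD) hn⟩
    Set.subset_union_left
  obtain ⟨x, hx⟩ := hnt.nonempty
  exact Set.disjoint_left.1 hd (this (Or.inr (hAD hx))) (hA hx)

/-- A core has at least three vertices and joins each other core by at most one edge. So each of
`D₂`, `D₃`, `D₄` has a vertex without neighbors in `D₁` and in the cyclically next one of the three.
These three vertices and an edge of `D₁` induce `3P₁ + P₂`. -/
theorem Core.false_of_four (hG : G.IsInducedFree threeP1AddP2) (h₁ : G.Core B D₁)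
    (h₂ : G.Core B D₂) (h₃ : G.Core B D₃) (h₄ : G.Core B D₄) (d12 : Disjoint D₁ D₂)
    (d13 : Disjoint D₁ D₃) (d14 : Disjoint D₁ D₄) (d23 : Disjoint D₂ D₃) (d24 : Disjoint D₂ D₄)
    (d34 : Disjoint D₃ D₄) : False := by
  classical
  have pick : ∀ {D D' D''}, G.Core B D → G.Core B D' → G.Core B D'' → Disjoint D D' →
      Disjoint D D'' → ∃ d ∈ D, (∀ y ∈ D', ¬ G.Adj d y) ∧ ∀ y ∈ D'', ¬ G.Adj d y := by
    intro D D' D'' h h' h'' hd hd'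
    obtain ⟨p, hp⟩ := h.exists_forall_adj_eq h' hd
    obtain ⟨q, hq⟩ := h.exists_forall_adj_eq h'' hd'
    obtain ⟨d, hdD, hdp, hdq⟩ := h.biparity.exists_ne_ne h.nontrivial p q
    exact ⟨d, hdD, fun y hy hdy => hdp (hp d hdD ⟨y, hy, hdy⟩),
      fun y hy hdy => hdq (hq d hdD ⟨y, hy, hdy⟩)⟩
  obtain ⟨a, ha, ha1, ha3⟩ := pick h₂ h₁ h₃ d12.symm d23
  obtain ⟨b, hb, hb1, hb4⟩ := pick h₃ h₁ h₄ d13.symm d34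
  obtain ⟨c, hc, hc1, hc2⟩ := pick h₄ h₁ h₂ d14.symm d24.symm
  obtain ⟨x, hx, y, hy, -, -, -, -, hxy, -⟩ := h₁.biparity.exists_edges h₁.nontrivial
  have hab : a ≠ b := fun h => Set.disjoint_left.1 d23 ha (h ▸ hb)
  have hac : a ≠ c := fun h => Set.disjoint_left.1 d24 ha (h ▸ hc)
  have hbc : b ≠ c := fun h => Set.disjoint_left.1 d34 hb (h ▸ hc)
  have := ha3 b hb
  have := hb4 c hc
  have := hc2 a ha
  have h3 := hG.card_le_two hxy (s := {a, b, c})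
    (by simp [*, G.adj_comm b a, G.adj_comm c b, G.adj_comm a c])
    (by simp [ha1 x hx, ha1 y hy, hb1 x hx, hb1 y hy, hc1 x hx, hc1 y hy])
  rw [Finset.card_eq_three.2 ⟨a, b, c, hab, hac, hbc, rfl⟩] at h3
  omega

/-- There are `a` in `D₂` and `b` in `D₃` such that `t`, `a`, `b` are independent. Each has at most
one neighbor in `D₁`; without these at most three vertices `D₁` is independent, as an edge would
complete `3P₁ + P₂`. An independent set outside the core `D₂` has at most six vertices. -/
theorem Core.ncard_le_nine [Finite V] (hG : G.IsInducedFree threeP1AddP2) (h₁ : G.Core B D₁)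
    (h₂ : G.Core B D₂) (h₃ : G.Core B D₃) (d12 : Disjoint D₁ D₂) (d13 : Disjoint D₁ D₃)
    (d23 : Disjoint D₂ D₃) {t : V} (ht : t ∈ B) (t1 : t ∉ D₁) (t2 : t ∉ D₂) (t3 : t ∉ D₃) :
    D₁.ncard ≤ 9 := by
  classical
  obtain ⟨p₂, hp₂⟩ := h₂.exists_forall_eq ht t2
  obtain ⟨q₂, hq₂⟩ := h₂.exists_forall_adj_eq h₃ d23
  obtain ⟨p₃, hp₃⟩ := h₃.exists_forall_eq ht t3
  obtain ⟨a, ha, hap, haq⟩ := h₂.biparity.exists_ne_ne h₂.nontrivial p₂ q₂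
  obtain ⟨b, hb, hbp, -⟩ := h₃.biparity.exists_ne_ne h₃.nontrivial p₃ p₃
  have hta : ¬ G.Adj t a := fun h => hap (hp₂ a ha h)
  have htb : ¬ G.Adj t b := fun h => hbp (hp₃ b hb h)
  have hab : ¬ G.Adj a b := fun h => haq (hq₂ a ha ⟨b, hb, h⟩)
  obtain ⟨p, hp⟩ := h₁.exists_forall_eq ht t1
  obtain ⟨q, hq⟩ := h₁.exists_forall_eq (h₂.subset ha) (Set.disjoint_right.1 d12 ha)
  obtain ⟨r, hr⟩ := h₁.exists_forall_eq (h₃.subset hb) (Set.disjoint_right.1 d13 hb)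
  have hne : t ≠ a := fun h => t2 (h ▸ ha)
  have hne' : t ≠ b := fun h => t3 (h ▸ hb)
  have hne'' : a ≠ b := fun h => Set.disjoint_left.1 d23 ha (h ▸ hb)
  have key : (D₁ \ {p, q, r}).ncard ≤ 6 := by
    refine h₂.biparity.ncard_le_six hG h₂.nontrivial ?_ fun v hv =>
      h₂.eq_of_adj (h₁.subset hv.1) (Set.disjoint_left.1 d12 hv.1)
    rintro x ⟨hx, hx'⟩ y ⟨hy, hy'⟩ hxy
    simp only [Set.mem_insert_iff, Set.mem_singleton_iff, not_or] at hx' hy'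
    have h3 := hG.card_le_two hxy (s := {t, a, b})
      (by simp [*, G.adj_comm a t, G.adj_comm b t, G.adj_comm b a])
      (by
        simp only [Finset.mem_insert, Finset.mem_singleton, forall_eq_or_imp, forall_eq]
        exact ⟨⟨fun h => hx'.1 (hp x hx h), fun h => hy'.1 (hp y hy h)⟩,
          ⟨fun h => hx'.2.1 (hq x hx h), fun h => hy'.2.1 (hq y hy h)⟩,
          ⟨fun h => hx'.2.2 (hr x hx h), fun h => hy'.2.2 (hr y hy h)⟩⟩)
    rw [Finset.card_eq_three.2 ⟨t, a, b, hne, hne', hne'', rfl⟩] at h3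
    omega
  have h3 : ({p, q, r} : Set V).ncard ≤ 3 := by
    have h1 := Set.ncard_insert_le p {q, r}
    have h2 := Set.ncard_insert_le q {r}
    rw [Set.ncard_singleton] at h2
    omega
  have := Set.ncard_le_ncard_sdiff_add_ncard D₁ {p, q, r}
  omega

/-- Both sides of a bipartition of `S` are independent sets outside the core, with at most six
vertices each. -/
theorem Core.ncard_le_twelve [Finite V] (hG : G.IsInducedFree threeP1AddP2) (h : G.Core B D)
    {S : Set V} (hS : G.NoOdd S) (hSB : S ⊆ B) (hd : Disjoint D S) : S.ncard ≤ 12 := by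
  obtain ⟨X, Y, rfl, -, hX, hY⟩ := hS.exists_bipartition
  have key : ∀ Z ⊆ X ∪ Y, (∀ x ∈ Z, ∀ y ∈ Z, ¬ G.Adj x y) → Z.ncard ≤ 6 := fun Z hZ hZ' =>
    h.biparity.ncard_le_six hG h.nontrivial hZ' fun v hv =>
      h.eq_of_adj (hSB (hZ hv)) (Set.disjoint_right.1 hd (hZ hv))
  have h1 := key X Set.subset_union_left hX
  have h2 := key Y Set.subset_union_right hY
  have := Set.ncard_union_le X Y
  omega

/-- The vertices of `D` with a neighbor in `B \ D`. -/
def frontier (G : SimpleGraph V) (B D : Set V) : Set V :=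
  {v ∈ D | ∃ u ∈ B \ D, G.Adj v u}

/-- Each vertex of `X` accounts for at most one vertex of the frontier, and all edges to `D'`
together account for one more. -/
theorem Core.ncard_frontier_le [Finite V] (h : G.Core B D) {X D' : Set V}
    (hB : B ⊆ X ∪ D ∪ D') (hX : X ⊆ B) (hXD : Disjoint X D)
    (hD' : ∃ p, ∀ x ∈ D, (∃ y ∈ D', G.Adj x y) → x = p) :
    (G.frontier B D).ncard ≤ X.ncard + 1 := by
  obtain ⟨p, hp⟩ := hD'
  have hg : ∀ u, ∃ q, u ∈ X → ∀ x ∈ D, G.Adj u x → x = q := by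
    intro u
    by_cases hu : u ∈ X
    · obtain ⟨q, hq⟩ := h.exists_forall_eq (hX hu) (Set.disjoint_left.1 hXD hu)
      exact ⟨q, fun _ => hq⟩
    · exact ⟨u, fun h => absurd h hu⟩
  choose g hg using hg
  have hsub : G.frontier B D ⊆ g '' X ∪ {p} := by
    rintro v ⟨hv, u, ⟨huB, huD⟩, hvu⟩
    rcases hB huB with (hu | hu) | hu
    · exact Or.inl ⟨u, hu, (hg u hu v hv hvu.symm).symm⟩
    · exact absurd hu huD
    · exact Or.inr (hp v hv ⟨u, hu, hvu⟩)
  have h1 := Set.ncard_le_ncard hsub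
  have h2 := Set.ncard_union_le (g '' X) {p}
  have h3 := Set.ncard_image_le (f := g) X.toFinite
  rw [Set.ncard_singleton] at h2
  omega

/-- Disjoint cores are removed until the rest is bipartite, so that the rest has at most 12
vertices. One core gives `12 + 13` vertices and two cores give `12 + 13 + 13`. Three cores have at
most nine vertices each, so `B` itself has at most `27 + 12 = 39`. Four are impossible. -/
theorem exists_decomposition [Finite V] (hG : G.IsInducedFree threeP1AddP2)
    (hT : G.OddFree T B) (hno : ¬ G.NoOdd B) {t : V} (ht : t ∈ T) (htB : t ∈ B) :
    ∃ X D₁ D₂ : Set V, X ∪ D₁ ∪ D₂ = B ∧ Disjoint X D₁ ∧ Disjoint X D₂ ∧ Disjoint D₁ D₂ ∧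
      G.Biparity D₁ ∧ G.Biparity D₂ ∧ Disjoint T D₁ ∧ Disjoint T D₂ ∧
      (X ∪ G.frontier B D₁ ∪ G.frontier B D₂).ncard ≤ 39 := by
  have hTD : ∀ {D}, G.Core B D → Disjoint T D := fun h =>
    hT.disjoint h.biparity h.nontrivial h.subset
  have hempty : ∀ B', G.frontier B' ∅ = ∅ := fun B' => by simp [frontier]
  have hbe : G.Biparity ∅ := fun a ha => absurd ha (Set.notMem_empty a)
  obtain ⟨D₁, h₁, -⟩ := exists_core hno le_rfl
  by_cases hn₁ : G.NoOdd (B \ D₁)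
  · refine ⟨B \ D₁, D₁, ∅, by simp [h₁.subset], Set.disjoint_sdiff_left, by simp, by simp,
      h₁.biparity, hbe, hTD h₁, by simp, ?_⟩
    have e1 := h₁.ncard_le_twelve hG hn₁ Set.sdiff_subset Set.disjoint_sdiff_right
    have e2 := h₁.ncard_frontier_le (X := B \ D₁) (D' := ∅) (by simp) Set.sdiff_subset
      Set.disjoint_sdiff_left ⟨t, by simp⟩
    have e3 := Set.ncard_union_le (B \ D₁) (G.frontier B D₁)
    rw [hempty, Set.union_empty]
    omega
  obtain ⟨D₂, h₂, hd₂⟩ := exists_core hn₁ Set.sdiff_subset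
  have d12 := hd₂ D₁ h₁ Set.disjoint_sdiff_right
  by_cases hn₂ : G.NoOdd (B \ (D₁ ∪ D₂))
  · have hX1 : Disjoint (B \ (D₁ ∪ D₂)) D₁ :=
      Set.disjoint_left.2 fun x hx hx' => hx.2 (Or.inl hx')
    have hX2 : Disjoint (B \ (D₁ ∪ D₂)) D₂ :=
      Set.disjoint_left.2 fun x hx hx' => hx.2 (Or.inr hx')
    have hu : B \ (D₁ ∪ D₂) ∪ D₁ ∪ D₂ = B := by
      rw [Set.union_assoc, Set.sdiff_union_of_subset (Set.union_subset h₁.subset h₂.subset)]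
    refine ⟨B \ (D₁ ∪ D₂), D₁, D₂, hu, hX1, hX2, d12, h₁.biparity, h₂.biparity, hTD h₁, hTD h₂,
      ?_⟩
    have e1 := h₁.ncard_le_twelve hG hn₂ Set.sdiff_subset hX1.symm
    have e2 := h₁.ncard_frontier_le (X := B \ (D₁ ∪ D₂)) (D' := D₂) hu.ge Set.sdiff_subset hX1
      (h₁.exists_forall_adj_eq h₂ d12)
    have e3 := h₂.ncard_frontier_le (X := B \ (D₁ ∪ D₂)) (D' := D₁)
      (by rw [Set.union_right_comm]; exact hu.ge) Set.sdiff_subset hX2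
      (h₂.exists_forall_adj_eq h₁ d12.symm)
    have e4 := Set.ncard_union_le (B \ (D₁ ∪ D₂) ∪ G.frontier B D₁) (G.frontier B D₂)
    have e5 := Set.ncard_union_le (B \ (D₁ ∪ D₂)) (G.frontier B D₁)
    omega
  obtain ⟨D₃, h₃, hd₃⟩ := exists_core hn₂ Set.sdiff_subset
  have d13 := hd₃ D₁ h₁ (Set.disjoint_left.2 fun x hx hx' => hx'.2 (Or.inl hx))
  have d23 := hd₃ D₂ h₂ (Set.disjoint_left.2 fun x hx hx' => hx'.2 (Or.inr hx))
  by_cases hn₃ : G.NoOdd (B \ (D₁ ∪ D₂ ∪ D₃))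
  -- All of `B` is small, so it is taken as `X`, with empty sets in place of the cores. The vertex
  -- `t` lies outside the three cores because they avoid `T`.
  · refine ⟨B, ∅, ∅, by simp, by simp, by simp, by simp, hbe, hbe, by simp, by simp, ?_⟩
    rw [hempty, Set.union_empty, Set.union_empty]
    have t1 := Set.disjoint_left.1 (hTD h₁) ht
    have t2 := Set.disjoint_left.1 (hTD h₂) ht
    have t3 := Set.disjoint_left.1 (hTD h₃) ht
    have e1 := h₁.ncard_le_nine hG h₂ h₃ d12 d13 d23 htB t1 t2 t3
    have e2 := h₂.ncard_le_nine hG h₁ h₃ d12.symm d23 d13 htB t2 t1 t3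
    have e3 := h₃.ncard_le_nine hG h₁ h₂ d13.symm d23.symm d12 htB t3 t1 t2
    have e4 := h₁.ncard_le_twelve hG hn₃ Set.sdiff_subset
      (Set.disjoint_left.2 fun x hx hx' => hx'.2 (Or.inl (Or.inl hx)))
    have e5 := Set.ncard_union_le (D₁ ∪ D₂) D₃
    have e6 := Set.ncard_union_le D₁ D₂
    have e7 := Set.ncard_le_ncard_sdiff_add_ncard B (D₁ ∪ D₂ ∪ D₃)
    omega
  obtain ⟨D₄, h₄, hd₄⟩ := exists_core hn₃ Set.sdiff_subset
  have d14 := hd₄ D₁ h₁ (Set.disjoint_left.2 fun x hx hx' => hx'.2 (Or.inl (Or.inl hx)))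
  have d24 := hd₄ D₂ h₂ (Set.disjoint_left.2 fun x hx hx' => hx'.2 (Or.inl (Or.inr hx)))
  have d34 := hd₄ D₃ h₃ (Set.disjoint_left.2 fun x hx hx' => hx'.2 (Or.inr hx))
  exact (h₁.false_of_four hG h₂ h₃ h₄ d12 d13 d14 d23 d24 d34).elim

end SimpleGraph

/-! ### Transfer of odd-`T`-cycle-freeness -/

namespace SimpleGraph

variable {V W : Type*} {G : SimpleGraph V} {G' : SimpleGraph W} {B D E T X : Set V}

/-- The sets `F'`, `K₁'`, `K₂'` in `G'` look like the sets `F`, `K₁`, `K₂` in `G`: the vertices of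
`F'` correspond to those of `F`, and each vertex of `Kᵢ'` is attached to `F'` like some vertex of
`Kᵢ` to `F`. -/
structure Resembles (G : SimpleGraph V) (T F K₁ K₂ : Set V) (G' : SimpleGraph W)
    (T' F' K₁' K₂' : Set W) (cut : Prop) (φ : W → V) : Prop where
  injOn : Set.InjOn φ F'
  image : φ '' F' = F
  adj : ∀ x ∈ F', ∀ y ∈ F', G'.Adj x y ↔ G.Adj (φ x) (φ y)
  mem : ∀ x ∈ F', x ∈ T' ↔ φ x ∈ T
  disj₁ : Disjoint K₁' F'
  disj₂ : Disjoint K₂' F'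
  disj : Disjoint K₁' K₂'
  type₁ : ∀ v ∈ K₁', ∃ u ∈ K₁, (v ∈ T' ↔ u ∈ T) ∧ ∀ x ∈ F', G'.Adj v x ↔ G.Adj u (φ x)
  type₂ : ∀ v ∈ K₂', ∃ u ∈ K₂, (v ∈ T' ↔ u ∈ T) ∧ ∀ x ∈ F', G'.Adj v x ↔ G.Adj u (φ x)
  cut : cut → ∀ u ∈ K₁', ∀ v ∈ K₂', ¬ G'.Adj u v

theorem OddFree.false_of_paths (hB : G.OddFree T B) {t u x y : V} (ht : t ∈ T) (htu : G.Adj t u)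
    {Q₁ P Q₂ : Set V} {e₁ e e₂ : ZMod 2} (h₁ : G.PathOn Q₁ e₁ u x) (h : G.PathOn P e x y)
    (h₂ : G.PathOn Q₂ e₂ t y) (hd : Disjoint Q₁ Q₂) (hP₁ : P ∩ Q₁ ⊆ {x}) (hP₂ : P ∩ Q₂ ⊆ {y})
    (i₁ : Q₁ ⊆ B) (i : P ⊆ B) (i₂ : Q₂ ⊆ B) (he : e₁ + e + e₂ = 0) : False := by
  have h3 := (h₁.append h (by rwa [Set.inter_comm])).append h₂.symm (by
    rintro z ⟨hz | hz, hz'⟩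
    · exact absurd hz' (Set.disjoint_left.1 hd hz)
    · exact hP₂ ⟨hz, hz'⟩)
  rw [he] at h3
  exact hB t ht u htu _ (Set.union_subset (Set.union_subset i₁ i) i₂) h3

/-- Go from `x` to `z` in `D`, along the link, and from `v` to `y` in `E`. One of the two outer
stretches is nontrivial by `hne`, and its parity can be chosen freely. -/
theorem Biparity.exists_pathOn_of_link (hD : G.Biparity D) (hE : G.Biparity E)
    (hd : Disjoint D E) {L : Set V} {ℓ : ZMod 2} {x y z v : V} (hL : G.PathOn L ℓ z v)
    (hLD : L ∩ D ⊆ {z}) (hLE : L ∩ E ⊆ {v}) (hx : x ∈ D) (hy : y ∈ E) (hz : z ∈ D) (hv : v ∈ E)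
    (hne : z ≠ x ∨ v ≠ y) (e : ZMod 2) : ∃ P ⊆ D ∪ L ∪ E, G.PathOn P e x y := by
  obtain ⟨f, f', p, q, hf⟩ : ∃ f f', G.PathIn D f x z ∧ G.PathIn E f' v y ∧ f + ℓ + f' = e := by
    by_cases hxz : z = x
    · obtain ⟨f, hf⟩ := hD.exists_pathIn hx hz
      exact ⟨f, e - (f + ℓ), hf, hE v hv y hy (hne.resolve_left (not_not.2 hxz)) _, by ring⟩
    · obtain ⟨f, hf⟩ := hE.exists_pathIn hv hy
      exact ⟨e - f - ℓ, f, hD x hx z hz (Ne.symm hxz) _, hf, by ring⟩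
  obtain ⟨A, hA, p⟩ := p
  obtain ⟨C, hC, q⟩ := q
  refine ⟨A ∪ L ∪ C, Set.union_subset_union (Set.union_subset_union_left _ hA) hC, hf ▸
    (p.append hL fun w hw => hLD ⟨hw.2, hA hw.1⟩).append q ?_⟩
  rintro w ⟨hw | hw, hw'⟩
  · exact absurd (hC hw') (Set.disjoint_left.1 hd (hA hw))
  · exact hLE ⟨hw, hC hw'⟩

/-- A path between two separated sets contains a link between them. -/
theorem PathOn.exists_link {M F P Q : Set V} {e : ZMod 2} {x y : V} (hM : G.PathOn M e y x)
    (hx : x ∈ P) (hy : y ∈ Q) (hd : Disjoint P Q) (hMF : M ⊆ F ∪ (P ∪ Q)) (hn : ¬ M ⊆ F)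
    (hP : ∀ k ∈ P, k ∉ F → ∀ w ∈ M, w ∉ P → ¬ G.Adj w k)
    (hQ : ∀ k ∈ Q, k ∉ F → ∀ w ∈ M, w ∉ Q → ¬ G.Adj w k) :
    ∃ L ℓ z v, G.PathOn L ℓ z v ∧ L ⊆ M ∧ L ⊆ F ∧ L ∩ P = {z} ∧ L ∩ Q = {v} ∧
      (z ≠ x ∨ v ≠ y) := by
  obtain ⟨z, N, R, _, _, hN, hR, rfl, -, hNP, -⟩ := hM.split P ⟨x, hM.right_mem, hx⟩
  have hzP : z ∈ P := (hNP ▸ Set.mem_singleton z : z ∈ N ∩ P).2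
  -- The vertex before `z` on the path lies outside `P`, and a vertex of `P` outside `F` has no such
  -- neighbor.
  have hzF : z ∈ F := by
    by_contra hzF
    obtain ⟨w, hw, hwz, hadj⟩ := hN.exists_adj fun h => Set.disjoint_left.1 hd hzP (h ▸ hy)
    refine hP z hzP hzF w (Or.inl hw) (fun hwP => hwz ?_) hadj
    exact (hNP ▸ ⟨hw, hwP⟩ : w ∈ ({z} : Set V))
  obtain ⟨v, L, O, ℓ, _, hL, hO, rfl, -, hLQ, -⟩ := hN.symm.split Q ⟨y, hN.left_mem, hy⟩
  have hvQ : v ∈ Q := (hLQ ▸ Set.mem_singleton v : v ∈ L ∩ Q).2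
  have hvF : v ∈ F := by
    by_contra hvF
    obtain ⟨w, hw, hwv, hadj⟩ := hL.exists_adj fun h => Set.disjoint_left.1 hd hzP (h ▸ hvQ)
    refine hQ v hvQ hvF w (Or.inl (Or.inl hw)) (fun hwQ => hwv ?_) hadj
    exact (hLQ ▸ ⟨hw, hwQ⟩ : w ∈ ({v} : Set V))
  have hLF : L ⊆ F := by
    intro l hl
    rcases hMF (Or.inl (Or.inl hl)) with h | h | h
    · exact h
    · obtain rfl : l = z := (hNP ▸ ⟨Or.inl hl, h⟩ : l ∈ ({z} : Set V))
      exact hzF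
    · obtain rfl : l = v := (hLQ ▸ ⟨hl, h⟩ : l ∈ ({v} : Set V))
      exact hvF
  refine ⟨L, ℓ, z, v, hL, fun l hl => Or.inl (Or.inl hl), hLF, ?_, hLQ, ?_⟩
  · refine Set.Subset.antisymm (fun l hl => hNP ▸ ⟨Or.inl hl.1, hl.2⟩) ?_
    exact Set.singleton_subset_iff.2 ⟨hL.left_mem, hzP⟩
  -- If the link started at `x` and ended at `y`, it would be the whole path, which would then stay
  -- inside `F`.
  · by_contra! hcon
    obtain ⟨rfl, rfl⟩ := hcon
    refine hn ?_
    rw [hR.eq_singleton.1, hO.eq_singleton.1]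
    rintro w ((hw | rfl) | rfl)
    exacts [hLF hw, hLF hL.right_mem, hLF hL.left_mem]

section

variable {D₁ D₂ : Set V} {T' F' K₁' K₂' : Set W} {φ : W → V}

/-- An odd `T'`-cycle in the copy is turned into an odd `T`-cycle in `B`. Its part near the vertex
of `T'` lies in `F'` and is mapped by `φ`. The middle part, which enters the copies of the cores, is
replaced by a path of the same parity through the original cores. Nothing needs to be known about
the edges inside `K₁'` or inside `K₂'`. -/
theorem Resembles.oddFree (hB : X ∪ D₁ ∪ D₂ = B)
    (hD : Disjoint D₁ D₂) (h₁ : G.Biparity D₁) (h₂ : G.Biparity D₂) (hT₁ : Disjoint T D₁)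
    (hT₂ : Disjoint T D₂) (hT : G.OddFree T B)
    (h : G.Resembles T (X ∪ G.frontier B D₁ ∪ G.frontier B D₂) (D₁ \ G.frontier B D₁)
      (D₂ \ G.frontier B D₂) G' T' F' K₁' K₂' True φ) :
    G'.OddFree T' (F' ∪ K₁' ∪ K₂') := by
  have hFB : ∀ w ∈ F', φ w ∈ B := by
    intro w hw
    have : φ w ∈ X ∪ G.frontier B D₁ ∪ G.frontier B D₂ := h.image ▸ Set.mem_image_of_mem φ hw
    rw [← hB]
    rcases this with (h | h) | h
    exacts [Or.inl (Or.inl h), Or.inl (Or.inr h.1), Or.inr h.1]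
  set P₁ : Set W := {w ∈ F' | φ w ∈ D₁} ∪ K₁' with hP₁
  set P₂ : Set W := {w ∈ F' | φ w ∈ D₂} ∪ K₂' with hP₂
  have hP : Disjoint P₁ P₂ := by
    rw [Set.disjoint_left]
    rintro w (⟨hw, hw1⟩ | hw) (⟨hw', hw2⟩ | hw')
    · exact Set.disjoint_left.1 hD hw1 hw2
    · exact Set.disjoint_left.1 h.disj₂ hw' hw
    · exact Set.disjoint_left.1 h.disj₁ hw hw'
    · exact Set.disjoint_left.1 h.disj hw hw'
  -- A vertex of `K₁'` is attached like a vertex outside the frontier of `D₁`, which has no neighbor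
  -- in `B` outside `D₁`; edges to `K₂'` are excluded by `cut`. So `P₁` can be left only from
  -- vertices of `F'`.
  have hK₁ : ∀ k ∈ P₁, k ∉ F' → ∀ w ∈ F' ∪ K₁' ∪ K₂', w ∉ P₁ → ¬ G'.Adj w k := by
    rintro k (hk | hk) hkF w hw hwP hadj
    · exact hkF hk.1
    rcases hw with (hw | hw) | hw
    · obtain ⟨u, ⟨hu, hu'⟩, -, huadj⟩ := h.type₁ k hk
      exact hu' ⟨hu, φ w, ⟨hFB w hw, fun hwD => hwP (Or.inl ⟨hw, hwD⟩)⟩,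
        (huadj w hw).1 hadj.symm⟩
    · exact hwP (Or.inr hw)
    · exact h.cut trivial k hk w hw hadj.symm
  have hK₂ : ∀ k ∈ P₂, k ∉ F' → ∀ w ∈ F' ∪ K₁' ∪ K₂', w ∉ P₂ → ¬ G'.Adj w k := by
    rintro k (hk | hk) hkF w hw hwP hadj
    · exact hkF hk.1
    rcases hw with (hw | hw) | hw
    · obtain ⟨u, ⟨hu, hu'⟩, -, huadj⟩ := h.type₂ k hk
      exact hu' ⟨hu, φ w, ⟨hFB w hw, fun hwD => hwP (Or.inl ⟨hw, hwD⟩)⟩,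
        (huadj w hw).1 hadj.symm⟩
    · exact h.cut trivial w hw k hk hadj
    · exact hwP (Or.inr hw)
  have hmap : ∀ {A e a b}, G'.PathOn A e a b → A ⊆ F' → G.PathOn (φ '' A) e (φ a) (φ b) :=
    fun p hA => p.map (h.injOn.mono hA) fun x hx y hy => (h.adj x (hA hx) y (hA hy)).1
  have himg : ∀ {A}, A ⊆ F' → φ '' A ⊆ B := fun hA => by
    rintro _ ⟨w, hw, rfl⟩
    exact hFB w (hA hw)
  intro t' ht' u' htu A hA p
  have htA := hA p.right_mem
  have htF : t' ∈ F' := by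
    rcases htA with (ht | ht) | ht
    · exact ht
    · obtain ⟨u, hu, huT, -⟩ := h.type₁ t' ht
      exact absurd hu.1 (Set.disjoint_left.1 hT₁ (huT.1 ht'))
    · obtain ⟨u, hu, huT, -⟩ := h.type₂ t' ht
      exact absurd hu.1 (Set.disjoint_left.1 hT₂ (huT.1 ht'))
  have htT : φ t' ∈ T := (h.mem t' htF).1 ht'
  have htP : t' ∉ P₁ ∪ P₂ := by
    rintro ((ht | ht) | (ht | ht))
    · exact Set.disjoint_left.1 hT₁ htT ht.2
    · exact Set.disjoint_left.1 h.disj₁ ht htF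
    · exact Set.disjoint_left.1 hT₂ htT ht.2
    · exact Set.disjoint_left.1 h.disj₂ ht htF
  have hAP : A ⊆ F' ∪ (P₁ ∪ P₂) := by
    intro w hw
    rcases hA hw with (hw | hw) | hw
    exacts [Or.inl hw, Or.inr (Or.inl (Or.inr hw)), Or.inr (Or.inr (Or.inr hw))]
  have hnF : ¬ A ⊆ F' := fun hAF =>
    hT _ htT (φ u') ((h.adj t' htF u' (hAF p.left_mem)).1 htu) _ (himg hAF) (hmap p hAF)
  have hS : ∀ k ∈ P₁ ∪ P₂, ∀ w ∈ A, w ∉ P₁ ∪ P₂ → G'.Adj w k → k ∈ F' := by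
    rintro k (hk | hk) w hw hwP hadj <;> by_contra hkF
    · exact hK₁ k hk hkF w (hA hw) (fun hh => hwP (Or.inl hh)) hadj
    · exact hK₂ k hk hkF w (hA hw) (fun hh => hwP (Or.inr hh)) hadj
  -- Following the cycle from `t'` in both directions, `x'` and `y'` are the first vertices in the
  -- copies of the cores. The initial pieces `A₁` and `A₂` lie in `F'`, so the middle piece `M` does
  -- not.
  obtain ⟨s, hsA, hsF⟩ := Set.not_subset.1 hnF
  obtain ⟨x', A₁, R, e₁, _, q₁, qR, rfl, hI₁, hx', he⟩ :=
    p.split (P₁ ∪ P₂) ⟨s, hsA, (hAP hsA).resolve_left hsF⟩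
  have hxP : x' ∈ P₁ ∪ P₂ := (hx' ▸ Set.mem_singleton x' : x' ∈ A₁ ∩ (P₁ ∪ P₂)).2
  obtain ⟨y', A₂, M, e₂, e₃, q₂, qM, rfl, hI₂, hy', rfl⟩ :=
    qR.symm.split (P₁ ∪ P₂) ⟨x', qR.left_mem, hxP⟩
  have hyP : y' ∈ P₁ ∪ P₂ := (hy' ▸ Set.mem_singleton y' : y' ∈ A₂ ∩ (P₁ ∪ P₂)).2
  have hxF : x' ∈ F' := by
    by_cases hux : u' = x'
    · exact hS x' hxP t' p.right_mem htP (hux ▸ htu)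
    · obtain ⟨w, hw, hwx, hadj⟩ := q₁.exists_adj hux
      refine hS x' hxP w (Or.inl hw) (fun hwP => hwx ?_) hadj
      exact (hx' ▸ ⟨hw, hwP⟩ : w ∈ ({x'} : Set W))
  have hyF : y' ∈ F' := by
    obtain ⟨w, hw, hwy, hadj⟩ := q₂.exists_adj (fun hty : t' = y' => htP (hty ▸ hyP))
    refine hS y' hyP w (Or.inr (Or.inl hw)) (fun hwP => hwy ?_) hadj
    exact (hy' ▸ ⟨hw, hwP⟩ : w ∈ ({y'} : Set W))
  have hA₁F : A₁ ⊆ F' := by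
    intro w hw
    rcases hAP (Or.inl hw) with h | h
    · exact h
    · obtain rfl : w = x' := (hx' ▸ ⟨hw, h⟩ : w ∈ ({x'} : Set W))
      exact hxF
  have hA₂F : A₂ ⊆ F' := by
    intro w hw
    rcases hAP (Or.inr (Or.inl hw)) with h | h
    · exact h
    · obtain rfl : w = y' := (hy' ▸ ⟨hw, h⟩ : w ∈ ({y'} : Set W))
      exact hyF
  have hMF : ¬ M ⊆ F' := fun hMF =>
    hnF (Set.union_subset hA₁F (Set.union_subset hA₂F hMF))
  have hxy : x' ≠ y' := by
    rintro rfl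
    rw [qM.eq_singleton.1] at hMF
    exact hMF (Set.singleton_subset_iff.2 hxF)
  have hA₁₂ : Disjoint A₁ A₂ := by
    rw [Set.disjoint_left]
    intro w hw hw'
    obtain rfl : w = x' := (hI₁ ▸ ⟨hw, Or.inl hw'⟩ : w ∈ ({x'} : Set W))
    exact hxy (hy' ▸ ⟨hw', hxP⟩ : w ∈ ({y'} : Set W))
  have hMA₁ : ∀ w ∈ M, w ∈ A₁ → w = x' := fun w hw hw' =>
    (hI₁ ▸ ⟨hw', Or.inr hw⟩ : w ∈ ({x'} : Set W))
  have hMA₂ : ∀ w ∈ M, w ∈ A₂ → w = y' := fun w hw hw' =>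
    (hI₂ ▸ ⟨hw', hw⟩ : w ∈ ({y'} : Set W))
  have hd : Disjoint (φ '' A₁) (φ '' A₂) := by
    rw [Set.disjoint_left]
    rintro _ ⟨w, hw, rfl⟩ ⟨w', hw', hww⟩
    exact Set.disjoint_left.1 hA₁₂ hw (h.injOn (hA₂F hw') (hA₁F hw) hww ▸ hw')
  have htu' : G.Adj (φ t') (φ u') := (h.adj t' htF u' (hA₁F q₁.left_mem)).1 htu
  have hPP : ∀ w ∈ F', φ w ∈ D₁ ∪ D₂ → w ∈ P₁ ∪ P₂ := by
    rintro w hw (hw' | hw')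
    exacts [Or.inl (Or.inl ⟨hw, hw'⟩), Or.inr (Or.inl ⟨hw, hw'⟩)]
  have hDB : D₁ ∪ D₂ ⊆ B := by
    rw [← hB, Set.union_assoc]
    exact Set.subset_union_right
  -- A substitute for `M` may use the cores and the image of a part `L` of `M` in `F'`. It meets the
  -- images of `A₁` and `A₂` only in their ends, so with parity `e₁ + e₂` it would close an odd
  -- cycle in `B`.
  have close : ∀ L ⊆ M, L ⊆ F' → ∀ P ⊆ D₁ ∪ D₂ ∪ φ '' L,
      ¬ G.PathOn P (e₁ + e₂) (φ x') (φ y') := by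
    intro L hLM hLF P hPL hpath
    refine hT.false_of_paths htT htu' (hmap q₁ hA₁F) hpath (hmap q₂ hA₂F) hd ?_ ?_ (himg hA₁F)
      (hPL.trans (Set.union_subset hDB (himg hLF))) (himg hA₂F) ?_
    · rintro _ ⟨hwP, w, hw, rfl⟩
      rcases hPL hwP with hwD | ⟨l, hl, hlw⟩
      · have := hPP w (hA₁F hw) hwD
        exact congrArg φ (hx' ▸ ⟨hw, this⟩ : w ∈ ({x'} : Set W))
      · obtain rfl := h.injOn (hLF hl) (hA₁F hw) hlw
        exact congrArg φ (hMA₁ l (hLM hl) hw)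
    · rintro _ ⟨hwP, w, hw, rfl⟩
      rcases hPL hwP with hwD | ⟨l, hl, hlw⟩
      · have := hPP w (hA₂F hw) hwD
        exact congrArg φ (hy' ▸ ⟨hw, this⟩ : w ∈ ({y'} : Set W))
      · obtain rfl := h.injOn (hLF hl) (hA₂F hw) hlw
        exact congrArg φ (hMA₂ l (hLM hl) hw)
    · have : ∀ a b : ZMod 2, a + (a + b) + b = 0 := by decide
      exact this e₁ e₂
  have hφ : φ x' ≠ φ y' := fun hh => hxy (h.injOn hxF hyF hh)
  -- If both ends lie in the same core, the substitute exists by the biparity of that core.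
  have same : ∀ {D}, D ⊆ D₁ ∪ D₂ → G.Biparity D → φ x' ∈ D → φ y' ∉ D := by
    intro D hD hbp hx hy
    obtain ⟨P, hP, hpath⟩ := hbp _ hx _ hy hφ (e₁ + e₂)
    exact close ∅ (Set.empty_subset _) (Set.empty_subset _) P
      (hP.trans (hD.trans Set.subset_union_left)) hpath
  have hmem₁ : ∀ w ∈ F', w ∈ P₁ → φ w ∈ D₁ := by
    rintro w hw (hw' | hw')
    exacts [hw'.2, absurd hw (Set.disjoint_left.1 h.disj₁ hw')]
  have hmem₂ : ∀ w ∈ F', w ∈ P₂ → φ w ∈ D₂ := by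
    rintro w hw (hw' | hw')
    exacts [hw'.2, absurd hw (Set.disjoint_left.1 h.disj₂ hw')]
  have hMA : M ⊆ F' ∪ (P₁ ∪ P₂) := fun w hw => hAP (Or.inr (Or.inr hw))
  have hMK : ∀ w ∈ M, w ∈ F' ∪ K₁' ∪ K₂' := fun w hw => hA (Or.inr (Or.inr hw))
  -- If the ends lie in different cores, `M` contains a link between their copies inside `F'`. Its
  -- image joins the original cores, and the parity is corrected inside one of them.
  have link : ∀ {L ℓ z v D E P Q}, G'.PathOn L ℓ z v → L ⊆ F' → L ∩ P = {z} → L ∩ Q = {v} →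
      (∀ w ∈ F', w ∈ P ↔ φ w ∈ D) → (∀ w ∈ F', w ∈ Q ↔ φ w ∈ E) → G.Biparity D →
      G.Biparity E → Disjoint D E → φ x' ∈ D → φ y' ∈ E → (z ≠ x' ∨ v ≠ y') →
      ∃ P ⊆ D ∪ φ '' L ∪ E, G.PathOn P (e₁ + e₂) (φ x') (φ y') := by
    intro L ℓ z v D E P Q hL hLF hLP hLQ hPD hQE hD hE hDE hx hy hne
    have hz : z ∈ P := (hLP ▸ Set.mem_singleton z : z ∈ L ∩ P).2
    have hv : v ∈ Q := (hLQ ▸ Set.mem_singleton v : v ∈ L ∩ Q).2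
    have hzF := hLF hL.left_mem
    have hvF := hLF hL.right_mem
    refine hD.exists_pathOn_of_link hE hDE (hmap hL hLF) ?_ ?_ hx hy ((hPD z hzF).1 hz)
      ((hQE v hvF).1 hv) (hne.imp (fun hh hh' => hh (h.injOn hzF hxF hh'))
        fun hh hh' => hh (h.injOn hvF hyF hh')) _
    · rintro _ ⟨⟨w, hw, rfl⟩, hwD⟩
      exact congrArg φ (hLP ▸ ⟨hw, (hPD w (hLF hw)).2 hwD⟩ : w ∈ ({z} : Set W))
    · rintro _ ⟨⟨w, hw, rfl⟩, hwE⟩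
      exact congrArg φ (hLQ ▸ ⟨hw, (hQE w (hLF hw)).2 hwE⟩ : w ∈ ({v} : Set W))
  have i₁ : ∀ w ∈ F', w ∈ P₁ ↔ φ w ∈ D₁ := fun w hw =>
    ⟨hmem₁ w hw, fun hw' => Or.inl ⟨hw, hw'⟩⟩
  have i₂ : ∀ w ∈ F', w ∈ P₂ ↔ φ w ∈ D₂ := fun w hw =>
    ⟨hmem₂ w hw, fun hw' => Or.inl ⟨hw, hw'⟩⟩
  rcases hxP with hx1 | hx1 <;> rcases hyP with hy1 | hy1
  · exact same Set.subset_union_left h₁ (hmem₁ _ hxF hx1) (hmem₁ _ hyF hy1)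
  · obtain ⟨L, ℓ, z, v, hL, hLM, hLF, hLP, hLQ, hne⟩ := qM.exists_link hx1 hy1 hP hMA hMF
      (fun k hk hkF w hw => hK₁ k hk hkF w (hMK w hw))
      (fun k hk hkF w hw => hK₂ k hk hkF w (hMK w hw))
    obtain ⟨P, hPsub, hpath⟩ := link hL hLF hLP hLQ i₁ i₂ h₁ h₂ hD (hmem₁ _ hxF hx1)
      (hmem₂ _ hyF hy1) hne
    exact close L hLM hLF P (by rwa [Set.union_right_comm] at hPsub) hpath
  · obtain ⟨L, ℓ, z, v, hL, hLM, hLF, hLP, hLQ, hne⟩ := qM.exists_link hx1 hy1 hP.symm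
      (by rwa [Set.union_comm P₂]) hMF
      (fun k hk hkF w hw => hK₂ k hk hkF w (hMK w hw))
      (fun k hk hkF w hw => hK₁ k hk hkF w (hMK w hw))
    obtain ⟨P, hPsub, hpath⟩ := link hL hLF hLP hLQ i₂ i₁ h₂ h₁ hD.symm (hmem₂ _ hxF hx1)
      (hmem₁ _ hyF hy1) hne
    exact close L hLM hLF P
      (by rwa [Set.union_right_comm, Set.union_comm D₂] at hPsub) hpath
  · exact same Set.subset_union_right h₂ (hmem₂ _ hxF hx1) (hmem₂ _ hyF hy1)

end

end SimpleGraph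

/-! ### Sets that avoid `T`, bipartite sets, and the choice of a model -/

namespace SimpleGraph

variable {V W : Type*} {G : SimpleGraph V} {G' : SimpleGraph W} {B F K₁ K₂ T X Y X₀ Y₀ : Set V}
  {T' F' K₁' K₂' : Set W} {cut : Prop} {φ : W → V}

theorem Resembles.oddFree_of_disjoint (h : G.Resembles T F K₁ K₂ G' T' F' K₁' K₂' cut φ)
    (hT : Disjoint T (F ∪ K₁ ∪ K₂)) : G'.OddFree T' (F' ∪ K₁' ∪ K₂') := by
  intro t ht u _ A hA p
  rw [Set.disjoint_left] at hT
  rcases hA p.right_mem with (hw | hw) | hw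
  · exact hT ((h.mem t hw).1 ht) (Or.inl (Or.inl (h.image ▸ Set.mem_image_of_mem φ hw)))
  · obtain ⟨v, hv, hvT, -⟩ := h.type₁ t hw
    exact hT (hvT.1 ht) (Or.inl (Or.inr hv))
  · obtain ⟨v, hv, hvT, -⟩ := h.type₂ t hw
    exact hT (hvT.1 ht) (Or.inr hv)

/-- The vertices of `K'` have no neighbors in `X₀'`, like the vertices they imitate. An edge inside
`K'` together with three vertices of `X₀'` would induce `3P₁ + P₂`. If `X₀` is all of `X`, there is
nothing to imitate and `K'` is empty. -/
theorem not_adj_of_types [Finite W] (hG' : G'.IsInducedFree threeP1AddP2) {X₀' K' : Set W}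
    (himg : φ '' X₀' = X₀) (hadj : ∀ x ∈ X₀', ∀ y ∈ X₀', G'.Adj x y ↔ G.Adj (φ x) (φ y))
    (hX : ∀ x ∈ X, ∀ y ∈ X, ¬ G.Adj x y) (hX₀ : X₀ ⊆ X) (hc : 3 ≤ X₀.ncard ∨ X₀ = X)
    (htype : ∀ v ∈ K', ∃ u ∈ X \ X₀, ∀ x ∈ X₀', G'.Adj v x ↔ G.Adj u (φ x)) :
    ∀ x ∈ X₀' ∪ K', ∀ y ∈ X₀' ∪ K', ¬ G'.Adj x y := by
  classical
  have := Fintype.ofFinite W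
  have hφ : ∀ x ∈ X₀', φ x ∈ X := fun x hx => hX₀ (himg ▸ Set.mem_image_of_mem φ hx)
  have h1 : ∀ v ∈ K', ∀ x ∈ X₀', ¬ G'.Adj v x := by
    intro v hv x hx h
    obtain ⟨u, hu, hut⟩ := htype v hv
    exact hX u hu.1 _ (hφ x hx) ((hut x hx).1 h)
  have h2 : ∀ x ∈ X₀', ∀ y ∈ X₀', ¬ G'.Adj x y := fun x hx y hy h =>
    hX _ (hφ x hx) _ (hφ y hy) ((hadj x hx y hy).1 h)
  rintro x (hx | hx) y (hy | hy) hxy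
  · exact h2 x hx y hy hxy
  · exact h1 y hy x hx hxy.symm
  · exact h1 x hx y hy hxy
  · rcases hc with hc | rfl
    · have h3 := hG'.card_le_two hxy (s := X₀'.toFinset)
        (fun a ha b hb => h2 a (by simpa using ha) b (by simpa using hb))
        (fun a ha => ⟨fun h => h1 x hx a (by simpa using ha) h.symm,
          fun h => h1 y hy a (by simpa using ha) h.symm⟩)
      rw [← Set.ncard_eq_toFinset_card'] at h3
      have h4 := Set.ncard_image_le (f := φ) X₀'.toFinite
      rw [himg] at h4
      omega
    · obtain ⟨u, hu, -⟩ := htype x hx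
      exact hu.2 hu.1

theorem Resembles.oddFree_of_bipartition [Finite W] (hG' : G'.IsInducedFree threeP1AddP2)
    (h : G.Resembles T (X₀ ∪ Y₀) (X \ X₀) (Y \ Y₀) G' T' F' K₁' K₂' cut φ)
    (hX : ∀ x ∈ X, ∀ y ∈ X, ¬ G.Adj x y) (hY : ∀ x ∈ Y, ∀ y ∈ Y, ¬ G.Adj x y)
    (hX₀ : X₀ ⊆ X) (hY₀ : Y₀ ⊆ Y) (hcX : 3 ≤ X₀.ncard ∨ X₀ = X) (hcY : 3 ≤ Y₀.ncard ∨ Y₀ = Y) :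
    G'.OddFree T' (F' ∪ K₁' ∪ K₂') := by
  have himg : ∀ Z ⊆ X₀ ∪ Y₀, φ '' {w ∈ F' | φ w ∈ Z} = Z := by
    intro Z hZ
    ext z
    constructor
    · rintro ⟨w, hw, rfl⟩
      exact hw.2
    · intro hz
      obtain ⟨w, hw, rfl⟩ : z ∈ φ '' F' := h.image ▸ hZ hz
      exact ⟨w, ⟨hw, hz⟩, rfl⟩
  have h1 := not_adj_of_types hG' (himg X₀ Set.subset_union_left)
    (fun x hx y hy => h.adj x hx.1 y hy.1) hX hX₀ hcX (K' := K₁') fun v hv => by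
      obtain ⟨u, hu, -, hut⟩ := h.type₁ v hv
      exact ⟨u, hu, fun x hx => hut x hx.1⟩
  have h2 := not_adj_of_types hG' (himg Y₀ Set.subset_union_right)
    (fun x hx y hy => h.adj x hx.1 y hy.1) hY hY₀ hcY (K' := K₂') fun v hv => by
      obtain ⟨u, hu, -, hut⟩ := h.type₂ v hv
      exact ⟨u, hu, fun x hx => hut x hx.1⟩
  have h3 := noOdd_of_bipartition h1 h2
  intro t _ u htu A hA
  refine h3 t trivial u htu A fun w hw => ?_
  rcases hA hw with (hw | hw) | hw
  · have : φ w ∈ X₀ ∪ Y₀ := h.image ▸ Set.mem_image_of_mem φ hw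
    exact this.imp (fun hh => Or.inl ⟨hw, hh⟩) fun hh => Or.inl ⟨hw, hh⟩
  · exact Or.inl (Or.inr hw)
  · exact Or.inr (Or.inr hw)

theorem exists_subset_ncard [Finite V] (X : Set V) :
    ∃ X₀ ⊆ X, X₀.ncard ≤ 3 ∧ (3 ≤ X₀.ncard ∨ X₀ = X) := by
  by_cases h : 3 ≤ X.ncard
  · obtain ⟨X₀, hX₀, hc⟩ := Set.exists_subset_card_eq h
    exact ⟨X₀, hX₀, hc.le, Or.inl hc.ge⟩
  · exact ⟨X, le_rfl, by omega, Or.inr rfl⟩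

theorem resembles_self (h₁ : Disjoint K₁ F) (h₂ : Disjoint K₂ F) (h : Disjoint K₁ K₂)
    (hcut : cut → ∀ u ∈ K₁, ∀ v ∈ K₂, ¬ G.Adj u v) :
    G.Resembles T F K₁ K₂ G T F K₁ K₂ cut id where
  injOn := Set.injOn_id _
  image := Set.image_id _
  adj _ _ _ _ := Iff.rfl
  mem _ _ := Iff.rfl
  disj₁ := h₁
  disj₂ := h₂
  disj := h
  type₁ v hv := ⟨v, hv, Iff.rfl, fun _ _ => Iff.rfl⟩
  type₂ v hv := ⟨v, hv, Iff.rfl, fun _ _ => Iff.rfl⟩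
  cut := hcut

/-- A set without odd `T`-cycles consists of boundedly many vertices `F` and two sets `K₁`, `K₂`
such that all sets that resemble them in a graph of the class have no odd `T`-cycles either. -/
theorem OddFree.exists_model [Finite V] (hG : G.IsInducedFree threeP1AddP2) (hT : G.OddFree T B)
    (hB : B.Nonempty) : ∃ (F K₁ K₂ : Set V) (cut : Bool), F.Nonempty ∧ F.ncard ≤ 39 ∧
      F ∪ K₁ ∪ K₂ = B ∧ G.Resembles T F K₁ K₂ G T F K₁ K₂ (cut = true) id ∧
      ∀ (n : ℕ) (G' : SimpleGraph (Fin n)) (T' F' K₁' K₂' : Set (Fin n)) (φ : Fin n → V),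
        G'.IsInducedFree threeP1AddP2 →
        G.Resembles T F K₁ K₂ G' T' F' K₁' K₂' (cut = true) φ →
        G'.OddFree T' (F' ∪ K₁' ∪ K₂') := by
  -- Here `F` could be empty; one vertex is put into it only because `F` has to be listed by a tuple
  -- of positive length.
  by_cases hTB : Disjoint T B
  · obtain ⟨b, hb⟩ := hB
    have hu : {b} ∪ B \ {b} ∪ ∅ = B := by
      rw [Set.union_empty, Set.union_sdiff_cancel (Set.singleton_subset_iff.2 hb)]
    refine ⟨{b}, B \ {b}, ∅, false, Set.singleton_nonempty b, by simp, hu,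
      resembles_self Set.disjoint_sdiff_left (by simp) (by simp) (by simp),
      fun n G' T' F' K₁' K₂' φ _ h => h.oddFree_of_disjoint ?_⟩
    rwa [hu]
  by_cases hno : G.NoOdd B
  · obtain ⟨X, Y, rfl, hXY, hX, hY⟩ := hno.exists_bipartition
    obtain ⟨X₀, hX₀, hX3, hcX⟩ := exists_subset_ncard X
    obtain ⟨Y₀, hY₀, hY3, hcY⟩ := exists_subset_ncard Y
    have h3 := Set.ncard_union_le X₀ Y₀
    refine ⟨X₀ ∪ Y₀, X \ X₀, Y \ Y₀, false, ?_, by omega, ?_, resembles_self ?_ ?_ ?_ (by simp),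
      fun n G' T' F' K₁' K₂' φ hG' h => h.oddFree_of_bipartition hG' hX hY hX₀ hY₀ hcX hcY⟩
    · by_contra he
      rw [Set.not_nonempty_iff_eq_empty, Set.union_empty_iff] at he
      obtain ⟨rfl, rfl⟩ := he
      rw [Set.ncard_empty] at hcX hcY
      obtain ⟨x, hx | hx⟩ := hB
      · exact absurd (hcX.resolve_left (by omega) ▸ hx) (Set.notMem_empty x)
      · exact absurd (hcY.resolve_left (by omega) ▸ hx) (Set.notMem_empty x)
    · rw [Set.union_assoc, Set.union_assoc, Set.union_left_comm Y₀, Set.union_sdiff_cancel hY₀,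
        ← Set.union_assoc, Set.union_sdiff_cancel hX₀]
    · rw [Set.disjoint_left]
      rintro x ⟨hx, hx'⟩ (h | h)
      exacts [hx' h, Set.disjoint_left.1 hXY hx (hY₀ h)]
    · rw [Set.disjoint_left]
      rintro x ⟨hx, hx'⟩ (h | h)
      exacts [Set.disjoint_left.1 hXY (hX₀ h) hx, hx' h]
    · exact hXY.mono Set.sdiff_subset Set.sdiff_subset
  obtain ⟨t, ht, htB⟩ := Set.not_disjoint_iff.1 hTB
  obtain ⟨X, D₁, D₂, hu, hX₁, hX₂, hD, h₁, h₂, hT₁, hT₂, hc⟩ :=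
    exists_decomposition hG hT hno ht htB
  have f₁ : G.frontier B D₁ ⊆ D₁ := fun x hx => hx.1
  have f₂ : G.frontier B D₂ ⊆ D₂ := fun x hx => hx.1
  -- The cores avoid `T`, so `t` is outside them and `F` is not empty.
  have htX : t ∈ X := by
    rw [← hu] at htB
    rcases htB with (h | h) | h
    exacts [h, absurd h (Set.disjoint_left.1 hT₁ ht), absurd h (Set.disjoint_left.1 hT₂ ht)]
  refine ⟨X ∪ G.frontier B D₁ ∪ G.frontier B D₂, D₁ \ G.frontier B D₁, D₂ \ G.frontier B D₂, true,
    ⟨t, Or.inl (Or.inl htX)⟩, hc, ?_, resembles_self ?_ ?_ ?_ ?_, fun n G' T' F' K₁' K₂' φ hG' h =>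
      Resembles.oddFree hu hD h₁ h₂ hT₁ hT₂ hT (by simpa using h)⟩
  · refine Eq.trans (Set.Subset.antisymm ?_ ?_) hu
    · rintro x ((((h | h) | h) | h) | h)
      exacts [Or.inl (Or.inl h), Or.inl (Or.inr (f₁ h)), Or.inr (f₂ h), Or.inl (Or.inr h.1),
        Or.inr h.1]
    · rintro x ((h | h) | h)
      · exact Or.inl (Or.inl (Or.inl (Or.inl h)))
      · by_cases hx : x ∈ G.frontier B D₁
        exacts [Or.inl (Or.inl (Or.inl (Or.inr hx))), Or.inl (Or.inr ⟨h, hx⟩)]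
      · by_cases hx : x ∈ G.frontier B D₂
        exacts [Or.inl (Or.inl (Or.inr hx)), Or.inr ⟨h, hx⟩]
  · rw [Set.disjoint_left]
    rintro x ⟨hx, hx'⟩ ((h | h) | h)
    exacts [Set.disjoint_left.1 hX₁ h hx, hx' h, Set.disjoint_left.1 hD hx (f₂ h)]
  · rw [Set.disjoint_left]
    rintro x ⟨hx, hx'⟩ ((h | h) | h)
    exacts [Set.disjoint_left.1 hX₂ h hx, Set.disjoint_left.1 hD (f₁ h) hx, hx' h]
  · exact hD.mono Set.sdiff_subset Set.sdiff_subset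
  · rintro - u ⟨hu₁, hu₁'⟩ v ⟨hv, -⟩ huv
    refine hu₁' ⟨hu₁, v, ⟨?_, Set.disjoint_right.1 hD hv⟩, huv⟩
    rw [← hu]
    exact Or.inr hv

end SimpleGraph

/-! ### The decision procedure -/

/-- The condition or its negation. -/
def Cond.lit {ι : Type} (A : Cond ι) (b : Bool) : Cond ι := if b then A else .not A

theorem decide_eq_iff (p : Prop) [Decidable p] (b : Bool) : decide p = b ↔ (p ↔ b = true) := by
  cases b <;> simp

theorem Cond.eval_lit {ι V : Type} (G : SimpleGraph V) (T : Finset V) (ρ : ι → V) (A : Cond ι)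
    (b : Bool) : (A.lit b).Eval G T ρ ↔ (A.Eval G T ρ ↔ b = true) := by
  cases b <;> simp [lit, Eval]

section

variable {c : ℕ} {V : Type} (G : SimpleGraph V) (T : Finset V) (a : Fin c → V)

open Classical in
/-- The equalities and adjacencies in a tuple, and the entries that lie in `T`. -/
noncomputable def tuplePattern : (Fin c → Fin c → Bool × Bool) × (Fin c → Bool) :=
  (fun i j => (decide (a i = a j), decide (G.Adj (a i) (a j))), fun i => decide (a i ∈ T))

open Classical in
/-- Membership of a vertex in `T`, and its adjacencies to a tuple. -/
noncomputable def vertexType (v : V) : Bool × (Fin c → Bool) :=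
  (decide (v ∈ T), fun j => decide (G.Adj v (a j)))

/-- The condition that a tuple has the pattern `π`. -/
def patternCond (π : (Fin c → Fin c → Bool × Bool) × (Fin c → Bool)) : Cond (Fin c) :=
  .and (Cond.all ((List.finRange c).map fun i => Cond.all ((List.finRange c).map fun j =>
      .and (Cond.lit (.eq i j) (π.1 i j).1) (Cond.lit (.adj i j) (π.1 i j).2))))
    (Cond.all ((List.finRange c).map fun i => Cond.lit (.mem i) (π.2 i)))

/-- The condition that a vertex has the type `p`. -/
def typeCond (p : Bool × (Fin c → Bool)) : Cond (Option (Fin c)) :=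
  .and (Cond.lit (.mem none) p.1)
    (Cond.all ((List.finRange c).map fun j => Cond.lit (.adj none (some j)) (p.2 j)))

/-- The condition that a vertex is not in the tuple and has one of the types in `P`. -/
noncomputable def attachCond (P : Finset (Bool × (Fin c → Bool))) : Cond (Option (Fin c)) :=
  .and (.not (tupleCond c)) (.not (Cond.all (P.toList.map fun p => .not (typeCond p))))

theorem eval_patternCond (π : (Fin c → Fin c → Bool × Bool) × (Fin c → Bool)) :
    (patternCond π).Eval G T a ↔ tuplePattern G T a = π := by
  obtain ⟨f, g⟩ := π
  simp [patternCond, Cond.Eval, Cond.eval_all, Cond.eval_lit, tuplePattern, funext_iff,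
    Prod.ext_iff, decide_eq_iff]

theorem at_typeCond (p : Bool × (Fin c → Bool)) (v : V) :
    (typeCond p).At G T a v ↔ vertexType G T a v = p := by
  obtain ⟨b, g⟩ := p
  simp [typeCond, Cond.At, Cond.Eval, Cond.eval_all, Cond.eval_lit, vertexType, funext_iff,
    decide_eq_iff]

theorem at_attachCond (P : Finset (Bool × (Fin c → Bool))) (v : V) :
    (attachCond P).At G T a v ↔ (∀ j, v ≠ a j) ∧ vertexType G T a v ∈ P := by
  have h : ∀ p, (typeCond p).Eval G T (fun o => o.elim v a) ↔ vertexType G T a v = p := fun p =>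
    at_typeCond G T a p v
  simp only [attachCond, Cond.At, Cond.Eval, eval_tupleCond, Cond.eval_all, List.mem_map,
    Finset.mem_toList, forall_exists_index, and_imp, forall_apply_eq_imp_iff₂, h, not_exists,
    not_forall, not_not, exists_prop, exists_eq_right', Option.elim_none, Option.elim_some, ne_eq]

end

/-- A pattern of a tuple, two sets of types, and a flag. -/
abbrev SchemeLabel (c : ℕ) : Type :=
  ((Fin c → Fin c → Bool × Bool) × (Fin c → Bool)) × Finset (Bool × (Fin c → Bool)) ×
    Finset (Bool × (Fin c → Bool)) × Bool

/-- The scheme with a given label. -/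
noncomputable def SchemeLabel.scheme {c : ℕ} (l : SchemeLabel c) : Scheme c where
  pat := patternCond l.1
  A₁ := attachCond l.2.1
  A₂ := attachCond l.2.2.1
  cut := l.2.2.2

/-- All candidate solutions of the scheme in `(3P₁ + P₂)`-free graphs have no odd `T`-cycle. -/
def Scheme.Valid {c : ℕ} (L : Scheme c) : Prop :=
  ∀ (n : ℕ) (G : SimpleGraph (Fin n)) (T : Finset (Fin n)) (a : Fin c → Fin n),
    G.IsInducedFree threeP1AddP2 → L.pat.Eval G T a →
    (∀ v, L.A₁.At G T a v ∨ L.A₂.At G T a v → ∀ j, v ≠ a j) ∧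
    ∀ K₁ K₂ : Set (Fin n), (∀ u ∈ K₁, L.A₁.At G T a u) → (∀ v ∈ K₂, L.A₂.At G T a v) →
      (∀ u ∈ K₁, ∀ v ∈ K₂, ¬ L.Rel G u v) → G.OddFree T (Set.range a ∪ K₁ ∪ K₂)

open Classical in
/-- The valid schemes that come from labels. -/
noncomputable def validSchemes (c : ℕ) : List (Scheme c) :=
  ((Finset.univ : Finset (SchemeLabel c)).toList.map SchemeLabel.scheme).filter
    fun L => decide L.Valid

/-- Validity concerns infinitely many graphs and is decided classically. This is harmless: there are
finitely many labels, so the list is a fixed finite object that is built into the program and never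
computed by it. -/
theorem mem_validSchemes {c : ℕ} {L : Scheme c} :
    L ∈ validSchemes c ↔ (∃ l : SchemeLabel c, l.scheme = L) ∧ L.Valid := by
  simp [validSchemes]

section

variable {R : Type} [Field R] [LinearOrder R] [IsStrictOrderedRing R]

-- The weight of the transversal is the total weight minus that of the tuple, of `K₁` and of `K₂`.
-- The gain adds up to the weights of `A₁`, `A₂` and of the tuple minus the total weight, so the sum
-- is exactly what the cut discards. A tuple may repeat vertices, and the gain counts each only
-- once.
open Classical in
theorem Scheme.sum_add_sum_gain {c : ℕ} (L : Scheme c) (I : WSOCTInstance R)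
    (a : Fin c → Fin I.n) {K₁ K₂ S : Finset (Fin I.n)}
    (ha : ∀ v, L.A₁.At I.G I.T a v ∨ L.A₂.At I.G I.T a v → ∀ j, v ≠ a j)
    (h₁ : ∀ u ∈ K₁, L.A₁.At I.G I.T a u) (h₂ : ∀ v ∈ K₂, L.A₂.At I.G I.T a v)
    (hd : ∀ u ∈ K₁, u ∉ K₂) (hS : ∀ v, v ∈ S ↔ (∀ j, v ≠ a j) ∧ v ∉ K₁ ∧ v ∉ K₂) :
    ∑ v ∈ S, I.w v + ∑ v, L.gain I a v =
      ∑ v with L.A₁.At I.G I.T a v ∧ v ∉ K₁, I.w v +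
        ∑ v with L.A₂.At I.G I.T a v ∧ v ∉ K₂, I.w v := by
  have hs : ∑ v ∈ S, I.w v = ∑ v, if v ∈ S then I.w v else 0 := by
    rw [← Finset.sum_filter]
    simp
  rw [hs, Finset.sum_filter, Finset.sum_filter, ← Finset.sum_add_distrib,
    ← Finset.sum_add_distrib]
  refine Finset.sum_congr rfl fun v _ => ?_
  have e0 := ha v
  have e1 := h₁ v
  have e2 := h₂ v
  have e3 := hd v
  rw [gain, if_congr (hS v) rfl rfl]
  by_cases hv : ∃ j, v = a j
  · obtain ⟨j, hj⟩ := hv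
    have n1 : ¬ L.A₁.At I.G I.T a v := fun h => e0 (Or.inl h) j hj
    have n2 : ¬ L.A₂.At I.G I.T a v := fun h => e0 (Or.inr h) j hj
    rw [if_neg fun h => h.1 j hj, if_pos ⟨j, hj⟩, if_neg n1, if_neg n2, if_neg fun h => n1 h.1,
      if_neg fun h => n2 h.1]
    ring
  · have hv' : ∀ j, v ≠ a j := fun j hj => hv ⟨j, hj⟩
    rw [if_neg hv]
    by_cases k1 : v ∈ K₁
    · rw [if_neg fun h => h.2.1 k1, if_neg (c := L.A₁.At I.G I.T a v ∧ v ∉ K₁) fun h => h.2 k1,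
        if_pos (e1 k1),
        if_congr (and_iff_left (e3 k1)) rfl rfl]
      ring
    · by_cases k2 : v ∈ K₂
      · rw [if_neg fun h => h.2.2 k2, if_neg (c := L.A₂.At I.G I.T a v ∧ v ∉ K₂) fun h => h.2 k2,
          if_pos (e2 k2),
          if_congr (and_iff_left k1) rfl rfl]
        ring
      · rw [if_pos ⟨hv', k1, k2⟩, if_congr (and_iff_left k1) rfl rfl,
          if_congr (and_iff_left k2) rfl rfl]
        ring

theorem Scheme.Succeeds.isYes {c : ℕ} {L : Scheme c} (hL : L.Valid) {I : WSOCTInstance R}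
    (hG : I.G.IsInducedFree threeP1AddP2) {a : Fin c → Fin I.n} (h : L.Succeeds I a) :
    I.IsYes := by
  classical
  obtain ⟨hp, K₁, K₂, h₁, h₂, hr, hle⟩ := h
  obtain ⟨ha, hfree⟩ := hL I.n I.G I.T a hG hp
  have hd : ∀ u ∈ K₁, u ∉ K₂ := fun u hu hu' => hr u hu u hu' (Or.inl rfl)
  set S : Finset (Fin I.n) := {v | (∀ j, v ≠ a j) ∧ v ∉ K₁ ∧ v ∉ K₂} with hS
  have hmem : ∀ v, v ∈ S ↔ (∀ j, v ≠ a j) ∧ v ∉ K₁ ∧ v ∉ K₂ := fun v => by simp [hS]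
  refine ⟨S, ?_, ?_⟩
  · rw [SimpleGraph.isOddCycleTransversal_iff]
    have := hfree K₁ K₂ h₁ h₂ hr
    refine this.mono fun v hv => ?_
    have hv' : ¬ ((∀ j, v ≠ a j) ∧ v ∉ K₁ ∧ v ∉ K₂) := fun hh => hv ((hmem v).2 hh)
    by_contra hcon
    simp only [Set.mem_union, Set.mem_range, Finset.mem_coe, not_or, not_exists] at hcon
    exact hv' ⟨fun j hj => hcon.1.1 j hj.symm, hcon.1.2, hcon.2⟩
  · have := L.sum_add_sum_gain I a ha h₁ h₂ hd hmem
    rw [← this] at hle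
    exact le_of_add_le_add_right hle

end

theorem exists_range_eq {V : Type*} [Finite V] {F : Set V} (hF : F.Nonempty) {c : ℕ}
    (hc : F.ncard ≤ c) : ∃ a : Fin c → V, Set.range a = F := by
  have : Fintype F := Fintype.ofFinite F
  have : Nonempty F := hF.to_subtype
  have hcard : Fintype.card F ≤ Fintype.card (Fin c) := by
    rwa [Fintype.card_fin, ← Nat.card_eq_fintype_card]
  obtain ⟨e⟩ := Function.Embedding.nonempty_of_card_le hcard
  refine ⟨fun i => (Function.invFun e i : F), ?_⟩
  ext x
  constructor
  · rintro ⟨i, rfl⟩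
    exact Subtype.coe_prop _
  · intro hx
    exact ⟨e ⟨x, hx⟩, congrArg Subtype.val (Function.leftInverse_invFun e.injective ⟨x, hx⟩)⟩

open Classical in
/-- Every set without odd `T`-cycles is a candidate solution of a valid scheme. -/
theorem SimpleGraph.OddFree.exists_scheme {n : ℕ} {G : SimpleGraph (Fin n)} {T : Finset (Fin n)}
    {B : Set (Fin n)} (hG : G.IsInducedFree threeP1AddP2) (hT : G.OddFree T B) (hB : B.Nonempty) :
    ∃ L ∈ validSchemes 39, ∃ (a : Fin 39 → Fin n) (K₁ K₂ : Finset (Fin n)), L.pat.Eval G T a ∧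
      (∀ u ∈ K₁, L.A₁.At G T a u) ∧ (∀ v ∈ K₂, L.A₂.At G T a v) ∧
      (∀ u ∈ K₁, ∀ v ∈ K₂, ¬ L.Rel G u v) ∧ Set.range a ∪ K₁ ∪ K₂ = B := by
  obtain ⟨F, K₁, K₂, cut, hFne, hF, hFB, hself, hmodel⟩ := hT.exists_model hG hB
  obtain ⟨a, rfl⟩ := exists_range_eq hFne hF
  set l : SchemeLabel 39 := (tuplePattern G T a, K₁.toFinset.image (vertexType G T a),
    K₂.toFinset.image (vertexType G T a), cut) with hl
  have hne : ∀ {n' : ℕ} {a' : Fin 39 → Fin n'} {K : Set (Fin n')}, Disjoint K (Set.range a') →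
      ∀ u ∈ K, ∀ j, u ≠ a' j := fun hd u hu j hj =>
    Set.disjoint_left.1 hd hu ⟨j, hj.symm⟩
  refine ⟨l.scheme, mem_validSchemes.2 ⟨⟨l, rfl⟩, ?_⟩, a, K₁.toFinset, K₂.toFinset, ?_, ?_, ?_,
    ?_, by simpa using hFB⟩
  -- The label read off from `B` is valid because every candidate for it, in any graph, resembles
  -- `F`, `K₁` and `K₂`.
  · intro n' G' T' a' hG' hp
    have hp' : tuplePattern G' T' a' = tuplePattern G T a := (eval_patternCond _ _ _ _).1 hp
    have heq : ∀ i j, a' i = a' j ↔ a i = a j := fun i j => by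
      simpa [tuplePattern] using congrArg (fun π => (π.1 i j).1) hp'
    have hadj : ∀ i j, G'.Adj (a' i) (a' j) ↔ G.Adj (a i) (a j) := fun i j => by
      simpa [tuplePattern] using congrArg (fun π => (π.1 i j).2) hp'
    have hmem : ∀ i, a' i ∈ T' ↔ a i ∈ T := fun i => by
      simpa [tuplePattern] using congrArg (fun π => π.2 i) hp'
    refine ⟨fun v hv => ?_, fun K₁' K₂' h₁ h₂ hr => ?_⟩
    · rcases hv with hv | hv
      · exact ((at_attachCond _ _ _ _ _).1 hv).1
      · exact ((at_attachCond _ _ _ _ _).1 hv).1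
    -- The map is well defined on the tuple since the pattern records which entries coincide;
    -- outside the tuple its values do not matter.
    · set φ : Fin n' → Fin n := Function.extend a' a fun _ => a 0 with hφ
      have hφa : ∀ i, φ (a' i) = a i := fun i =>
        Function.FactorsThrough.extend_apply (fun i j hij => (heq i j).1 hij) _ i
      have htype : ∀ {K : Set (Fin n)} {v}, vertexType G' T' a' v ∈
          K.toFinset.image (vertexType G T a) → ∃ u ∈ K, (v ∈ (T' : Set (Fin n')) ↔
            u ∈ (T : Set (Fin n))) ∧ ∀ x ∈ Set.range a', G'.Adj v x ↔ G.Adj u (φ x) := by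
        intro K v hv
        obtain ⟨u, hu, huv⟩ := Finset.mem_image.1 hv
        refine ⟨u, by simpa using hu, ?_, ?_⟩
        · simpa [vertexType] using (congrArg Prod.fst huv).symm
        · rintro _ ⟨j, rfl⟩
          rw [hφa]
          simpa [vertexType] using (congrArg (fun p => p.2 j) huv).symm
      refine hmodel n' G' T' (Set.range a') K₁' K₂' φ hG' ⟨?_, ?_, ?_, ?_, ?_, ?_, ?_, ?_, ?_, ?_⟩
      · rintro _ ⟨i, rfl⟩ _ ⟨j, rfl⟩ hij
        rw [hφa, hφa] at hij
        exact (heq i j).2 hij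
      · rw [← Set.range_comp]
        exact congrArg Set.range (funext hφa)
      · rintro _ ⟨i, rfl⟩ _ ⟨j, rfl⟩
        rw [hφa, hφa]
        exact hadj i j
      · rintro _ ⟨i, rfl⟩
        rw [hφa]
        exact hmem i
      · rw [Set.disjoint_left]
        rintro _ hv ⟨j, rfl⟩
        exact ((at_attachCond _ _ _ _ _).1 (h₁ _ hv)).1 j rfl
      · rw [Set.disjoint_left]
        rintro _ hv ⟨j, rfl⟩
        exact ((at_attachCond _ _ _ _ _).1 (h₂ _ hv)).1 j rfl
      · rw [Set.disjoint_left]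
        exact fun v hv hv' => hr v hv v hv' (Or.inl rfl)
      · exact fun v hv => htype ((at_attachCond _ _ _ _ _).1 (h₁ v hv)).2
      · exact fun v hv => htype ((at_attachCond _ _ _ _ _).1 (h₂ v hv)).2
      · exact fun hc u hu v hv huv => hr u hu v hv (Or.inr ⟨hc, huv⟩)
  · exact (eval_patternCond _ _ _ _).2 rfl
  · intro u hu
    exact (at_attachCond _ _ _ _ _).2 ⟨hne hself.disj₁ u (by simpa using hu),
      Finset.mem_image_of_mem _ hu⟩
  · intro u hu
    exact (at_attachCond _ _ _ _ _).2 ⟨hne hself.disj₂ u (by simpa using hu),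
      Finset.mem_image_of_mem _ hu⟩
  · intro u hu v hv
    rw [Set.mem_toFinset] at hu hv
    rintro (rfl | ⟨hc, huv⟩)
    · exact Set.disjoint_left.1 hself.disj hu hv
    · exact hself.cut hc u hu v hv huv

section

variable {R : Type} [Field R] [LinearOrder R] [IsStrictOrderedRing R]

/-- A scheme needs a nonempty complement. If the transversal is everything, one vertex may be
released: a single vertex carries no cycle, and the weight does not increase. -/
theorem WSOCTInstance.IsYes.exists_oddFree {I : WSOCTInstance R} (h : I.IsYes) (hn : 0 < I.n) :
    ∃ S : Finset (Fin I.n), I.G.OddFree I.T (Sᶜ : Set (Fin I.n)) ∧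
      (Sᶜ : Set (Fin I.n)).Nonempty ∧ ∑ v ∈ S, I.w v ≤ (I.k : R) := by
  classical
  obtain ⟨S, hS, hw⟩ := h
  rw [SimpleGraph.isOddCycleTransversal_iff] at hS
  by_cases hne : (Sᶜ : Set (Fin I.n)).Nonempty
  · exact ⟨S, hS, hne, hw⟩
  · refine ⟨Finset.univ.erase ⟨0, hn⟩, ?_, ⟨⟨0, hn⟩, by simp⟩, le_trans ?_ hw⟩
    · intro t _ u htu A hA p
      have h1 := hA p.left_mem
      have h2 := hA p.right_mem
      simp only [Finset.coe_erase, Finset.coe_univ, Set.mem_compl_iff, Set.mem_sdiff,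
        Set.mem_univ, true_and, not_not, Set.mem_singleton_iff] at h1 h2
      exact htu.ne (h2.trans h1.symm)
    · refine Finset.sum_le_sum_of_subset_of_nonneg (fun v _ => ?_) fun v _ _ => I.w_nonneg v
      by_contra hv
      exact hne ⟨v, hv⟩

theorem exists_succeeds_iff {I : WSOCTInstance R} (hG : I.G.IsInducedFree threeP1AddP2) :
    (I.n = 0 ∨ ∃ L ∈ validSchemes 39, ∃ a, L.Succeeds I a) ↔ I.IsYes := by
  classical
  constructor
  · rintro (hn | ⟨L, hL, a, ha⟩)
    · have : IsEmpty (Fin I.n) := by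
        rw [hn]
        infer_instance
      exact ⟨∅, fun v => isEmptyElim v, by simp⟩
    · exact ha.isYes (mem_validSchemes.1 hL).2 hG
  · intro h
    rcases Nat.eq_zero_or_pos I.n with hn | hn
    · exact Or.inl hn
    · obtain ⟨S, hS, hne, hw⟩ := h.exists_oddFree hn
      obtain ⟨L, hL, a, K₁, K₂, hp, h₁, h₂, hr, hB⟩ := hS.exists_scheme hG hne
      refine Or.inr ⟨L, hL, a, hp, K₁, K₂, h₁, h₂, hr, ?_⟩
      have hmem : ∀ v, v ∈ S ↔ (∀ j, v ≠ a j) ∧ v ∉ K₁ ∧ v ∉ K₂ := by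
        intro v
        have hv := Set.ext_iff.1 hB v
        simp only [Set.mem_union, Set.mem_range, Finset.mem_coe, Set.mem_compl_iff] at hv
        rw [← not_iff_not, ← hv]
        simp only [not_and_or, not_forall, not_not, or_assoc, eq_comm]
      rw [← L.sum_add_sum_gain I a
        ((mem_validSchemes.1 hL).2 I.n I.G I.T a hG hp).1 h₁ h₂
        (fun u hu hu' => hr u hu u hu' (Or.inl rfl)) hmem]
      exact add_le_add_left hw _

/-- The program does not depend on `R`; over `ℝ` this is the first claim, and over `ℚ` it is
converted to logarithmic cost. -/
theorem mainProgram_decides : (mainProgram (validSchemes 39)).DecidesWSOCTInPolyTime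
    (CostModel.uniform R) (fun _ G => G.IsInducedFree threeP1AddP2) := by
  obtain ⟨p, hp⟩ := mainProgram_runs (R := R) (validSchemes 39)
  refine ⟨p, fun I hG => ?_⟩
  obtain ⟨t, s, hrun, ht, hs⟩ := hp I
  refine ⟨t, s, hrun, ?_, hs.trans (exists_succeeds_iff hG)⟩
  simpa [WSOCTInstance.size, CostModel.uniform] using ht

end

theorem mainTheorem2 :
    WSOCTPolyTimeSolvable (fun _ G => G.IsInducedFree threeP1AddP2) :=
  ⟨_, mainProgram_decides, mainProgram_decides.logarithmic⟩
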